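/- **Setting.** Let $(E,\omega)$ be a real symplectic plane with a compatible linear complex structure $j$ (so $\omega(x,jx)>0$ for $x\ne0$), and let $(\delta,\varphi)$ be a half-form line: a complex line $\delta$ with an isomorphism $\varphi:\delta^{\otimes2}\to K_j=\{\alpha\in E^*\otimes\mathbb C:\alpha\circ j=i\alpha\}$, with the metric making $\varphi$ an isometry ($K_j\subset E^*\otimes\mathbb C$ carries the Hermitian extension of the Euclidean metric $\omega(\cdot,j\cdot)$). Let $L=E\times\mathbb C$ with the connection $d+\frac1i\alpha$, $\alpha_x(y)=\frac12\omega(x,y)$, and the compatible holomorphic structure. On sections of $L^k$ or $L^k\otimes\delta$ put $(T_x^*\Psi)(y)=e^{-i\frac k2\omega(x,y)}\Psi(x+y)$. For a lattice $R\subset E$ on which $\omega$ takes values in $4\pi\mathbb Z$, let $\mathcal H^R_k$ be the space of holomorphic sections of $L^k\otimes\delta$ fixed by all $T_x^*$, $x\in R$, with scalar product $\langle\Psi_1,\Psi_2\rangle=\int_{E/R}\langle\Psi_1,\Psi_2\rangle_\delta\,|\omega|$. For $v\in E\setminus\{0\}$ a vector $\Omega\in\delta$ with $\varphi(\Omega^2)(v)=1$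 is denoted $\Omega_v$ (it is unique up to sign). Let $\mu,\lambda\in E$ with $\omega(\mu,\lambda)=4\pi$, fix $\Omega_\mu$, and let $a,b$ be coprime positive integers and $D=2ab$. For $k\ge1$ put $q=e^{i\pi/k}$ (and $q^s=e^{i\pi s/k}$ for real $s$). Then $\mathcal H_k=\mathcal H_k^{\mathbb Z\mu\oplus\mathbb Z\lambda}$ has an orthonormal basis $(\xi_\ell)_{\ell\in\mathbb Z/2k}$ with $T^*_{\mu/2k}\xi_\ell=q^\ell\xi_\ell$, $T^*_{-\lambda/2k}\xi_\ell=\xi_{\ell-1}$ and $\xi_0(0)\in\mathbb R_{\ge0}\,\Omega_\mu$. The knot state of the torus knot with parameter $(a,b)$ is $$Z_k=\frac{\sin(\pi/k)}{\sqrt k}\sum_{\ell\in\mathbb Z/2k}J_\ell(-e^{i\pi/2k})\,\xi_\ell,\qquad J_\ell(t)=\frac{t^{ab(1-\ell^2)}}{t^2-t^{-2}}\sum_{r=-\frac{\ell-1}2}^{\frac{\ell-1}2}t^{4abr^2}\bigl(t^{-4(a+b)r+2}-t^{-4(a-b)r-2}\bigr),$$ with representatives $0\le\ell<2k$; $J_\ell$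 is the $\ell$-th (colored) Jones polynomial of the knot ($J_0=0$). A sequence is $O(k^{-\infty})$ if for every $M$ it is bounded by $C_Mk^{-M}$ for all $k\geq 1$. The microsupport of $(Z_k)$ is the set of points of $E$ that have no neighbourhood on which $|Z_k|=O(k^{-\infty})$ uniformly. Put $$A=(-1,0)\mu+\mathbb R\lambda,\qquad I_\ell=\Bigl\{\ell\tfrac\lambda D+t\bigl(\tfrac\lambda D-\tfrac\mu2\bigr):t\in(0,2)\Bigr\}\quad(\ell\in\mathbb Z).$$ **Theorem.** (1) The microsupport of $(Z_k)$ does not meet $A\setminus\bigcup_{\ell\in\mathbb Z}I_\ell$. (2) One can choose the signs of $\Omega_\lambda$ and $\Omega_{D\mu-2\lambda}$ and find, for $k\ge1$, an orthonormal basis $(\Psi_n)_{n\in\mathbb Z/2kD}$ of $\mathcal H_k^{\mathbb ZD\mu\oplus\mathbb Z\lambda}$ with $$T^*_{-\lambda/2kD}\Psi_n=e^{i\pi n/kD}\Psi_n,\quad T^*_{(D\mu-2\lambda)/2kD}\Psi_n=\Psi_{n+1},\quad \Psi_0(0)=e^{i\pi/4}\bigl(\tfrac k{2\pi}\bigr)^{1/4}\Omega_\lambda+O(k^{-\infty}),$$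 and sequences $\alpha(k)$, $\beta_\ell(k)$, $\gamma_\ell(k)$ ($\ell\in\mathbb Z/D$) with the following properties. With $\Phi_\ell=\frac1{\sqrt{2kD}}\sum_{n\in\mathbb Z/2kD}e^{2i\pi n\ell/D}\Psi_n$, for every $k\ge1$, $$Z_k-\sum_{\ell\in\mathbb Z/D}\gamma_\ell(k)\Phi_\ell\ \perp\ \Psi_n\quad\text{for } -ab+a+b<n<2k-ab-a-b,$$ $$\gamma_{-1}(k)=0,\qquad\gamma_0(k)=\tfrac12\beta_0(k),\qquad\gamma_\ell(k)=e^{\frac{2i\pi}D2k(\ell-1)}\gamma_{\ell-2}(k)+\beta_\ell(k),$$ and $$\beta_\ell(k)=-4\alpha(k)\bigl(\tfrac{2k}D\bigr)^{1/2}(-1)^\ell\sin\tfrac{\pi\ell}a\sin\tfrac{\pi\ell}b+O(k^{-\infty}),\qquad\alpha(k)=\tfrac i{\sqrt2}\,q^{-\frac{a^2+b^2}D+\frac D4}+O(k^{-\infty}).$$ Moreover, for every $\ell\in\mathbb Z$ and $x_0\in I_\ell$ there is a neighbourhood $V$ of $x_0$ such that $$Z_k(x)=\Bigl(\frac k{2\pi}\Bigr)^{1/4}\gamma_\ell(k)\,T^*_{-\ell\lambda/D}t^k_{D\mu-2\lambda}(x)\otimes\Omega_{D\mu-2\lambda}+O(k^{-\infty})$$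 uniformly for $x\in V$, where $t_{D\mu-2\lambda}$ is the holomorphic section of $L$ equal to $1$ on the line $\mathbb R(D\mu-2\lambda)$. -/

import Mathlib

open scoped TensorProduct Topology

noncomputable section

namespace TorusKnotState

/-- A real two-dimensional symplectic vector space `(E, ω)` with a compatible linear complex
structure `j`. -/
structure PolarizedPlane (E : Type*) [NormedAddCommGroup E] [NormedSpace ℝ E] where
  ω : E →ₗ[ℝ] E →ₗ[ℝ] ℝ
  j : E →ₗ[ℝ] E
  finrank_eq_two : Module.finrank ℝ E = 2
  ω_self : ∀ x, ω x x = 0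
  j_j : ∀ x, j (j x) = -x
  ω_j_j : ∀ x y, ω (j x) (j y) = ω x y
  ω_j_pos : ∀ x, x ≠ 0 → 0 < ω x (j x)

variable {E : Type*} [NormedAddCommGroup E] [NormedSpace ℝ E]

/-- The canonical line `K_j = {α ∈ E* ⊗ ℂ | α (j x) = i α (x)}`. -/
def PolarizedPlane.canonicalLine (P : PolarizedPlane E) : Submodule ℂ (E →ₗ[ℝ] ℂ) where
  carrier := {α | ∀ x, α (P.j x) = Complex.I * α x}
  add_mem' := by
    intro α β hα hβ x
    simp only [Set.mem_ofPred_eq] at hα hβ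
    simp only [LinearMap.add_apply, hα x, hβ x, mul_add]
  zero_mem' := by
    intro x
    simp
  smul_mem' := by
    intro c α hα x
    simp only [Set.mem_ofPred_eq] at hα
    simp only [LinearMap.smul_apply, hα x, smul_eq_mul]
    ring

/-- A half-form line `(δ, φ)`: a complex line `δ` with an isomorphism `φ : δ ⊗ δ ≃ K_j`, where `δ`
carries the metric that makes `φ` an isometry. The metric of `K_j ⊆ E* ⊗ ℂ` is the Hermitian
extension of the Euclidean metric `ω(·, j ·)`: if `ω(u, j u) = 1` then `(u, j u)` is an orthonormal
basis of `E` and `‖α‖² = |α(u)|² + |α(j u)|²`. -/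
structure HalfFormLine (P : PolarizedPlane E) (δ : Type*) [NormedAddCommGroup δ]
    [InnerProductSpace ℂ δ] where
  φ : (δ ⊗[ℂ] δ) ≃ₗ[ℂ] P.canonicalLine
  finrank_eq_one : Module.finrank ℂ δ = 1
  isometry : ∀ (v w : δ) (u : E), P.ω u (P.j u) = 1 →
    (‖v‖ * ‖w‖) ^ 2 =
      ‖(φ (v ⊗ₜ[ℂ] w) : E →ₗ[ℝ] ℂ) u‖ ^ 2 + ‖(φ (v ⊗ₜ[ℂ] w) : E →ₗ[ℝ] ℂ) (P.j u)‖ ^ 2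

/-- `Ω ∈ δ` satisfies `φ(Ω²)(e) = 1`. -/
def HalfFormLine.IsRootAt {P : PolarizedPlane E} {δ : Type*} [NormedAddCommGroup δ]
    [InnerProductSpace ℂ δ] (H : HalfFormLine P δ) (Ω : δ) (e : E) : Prop :=
  (H.φ (Ω ⊗ₜ[ℂ] Ω) : E →ₗ[ℝ] ℂ) e = 1

section Sections

variable {F : Type*} [NormedAddCommGroup F] [NormedSpace ℂ F]

/-- The covariant derivative `∇_v Ψ (x)` of a section `Ψ` of `L^k ⊗ F` (a function `E → F`), for the
connection `d + (k / i) α`, where `α_x(y) = ω(x, y) / 2`. -/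
def covDeriv (P : PolarizedPlane E) (k : ℕ) (Ψ : E → F) (x v : E) : F :=
  fderiv ℝ Ψ x v + ((k : ℂ) / Complex.I * ((P.ω x v / 2 : ℝ) : ℂ)) • Ψ x

/-- Holomorphic sections of `L^k ⊗ F`, that is `∇_{v + i j v} Ψ = 0` for every `v`. -/
def IsHolomorphicSection (P : PolarizedPlane E) (k : ℕ) (Ψ : E → F) : Prop :=
  Differentiable ℝ Ψ ∧
    ∀ x v, covDeriv P k Ψ x v + Complex.I • covDeriv P k Ψ x (P.j v) = 0

/-- The pull-back by the action of `(x, 1)` in the Heisenberg group at level `k`: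
`(T_x^* Ψ)(y) = exp(-i (k/2) ω(x, y)) Ψ(x + y)`. -/
def pullback (P : PolarizedPlane E) (k : ℕ) (x : E) (Ψ : E → F) : E → F := fun y =>
  Complex.exp (-Complex.I * ((k : ℂ) / 2) * (P.ω x y : ℂ)) • Ψ (x + y)

/-- The space of holomorphic sections of `L^k ⊗ F` that are invariant under the lattice
`ℤ e ⊕ ℤ f`. -/
def quantumSpace (P : PolarizedPlane E) (F : Type*) [NormedAddCommGroup F] [NormedSpace ℂ F]
    (k : ℕ) (e f : E) : Submodule ℂ (E → F) where
  carrier := {Ψ | IsHolomorphicSection P k Ψ ∧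
    ∀ m n : ℤ, pullback P k ((m : ℝ) • e + (n : ℝ) • f) Ψ = Ψ}
  add_mem' := by
    rintro Ψ₁ Ψ₂ ⟨⟨d₁, h₁⟩, i₁⟩ ⟨⟨d₂, h₂⟩, i₂⟩
    refine ⟨⟨d₁.add d₂, fun x v => ?_⟩, fun m n => ?_⟩
    · have e₁ := h₁ x v
      have e₂ := h₂ x v
      simp only [covDeriv] at e₁ e₂ ⊢
      rw [fderiv_add (d₁ x) (d₂ x)]
      simp only [Pi.add_apply, _root_.add_apply, smul_add] at e₁ e₂ ⊢
      rw [← add_zero (0 : F)]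
      nth_rewrite 1 [← e₁]
      rw [← e₂]
      abel
    · have e₁ := i₁ m n
      have e₂ := i₂ m n
      funext y
      have f₁ := congrFun e₁ y
      have f₂ := congrFun e₂ y
      simp only [pullback, Pi.add_apply, smul_add] at f₁ f₂ ⊢
      rw [f₁, f₂]
  zero_mem' := by
    refine ⟨⟨differentiable_const (0 : F), fun x v => ?_⟩, fun m n => ?_⟩
    · have h : fderiv ℝ (0 : E → F) x = 0 := fderiv_const_apply (0 : F)
      simp [covDeriv, h]
    · funext y
      simp [pullback]
  smul_mem' := by
    rintro c Ψ ⟨⟨d, h⟩, i⟩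
    refine ⟨⟨d.const_smul c, fun x v => ?_⟩, fun m n => ?_⟩
    · have e₁ := congrArg (fun z => c • z) (h x v)
      simp only [covDeriv] at e₁ ⊢
      rw [fderiv_const_smul (d x)]
      simp only [Pi.smul_apply, _root_.smul_apply, smul_add, smul_zero] at e₁ ⊢
      rw [← e₁]
      simp only [smul_comm c]
    · funext y
      have f₁ := congrFun (i m n) y
      simp only [pullback, Pi.smul_apply] at f₁ ⊢
      rw [smul_comm, f₁]

/-- The microsupport of a family of sections indexed by the positive integers. -/
def microsupport (ζ : ℕ → E → F) : Set E :=
  {x | ¬ ∃ U ∈ 𝓝 x, ∃ C : ℕ → ℝ, (∀ M, 0 < C M) ∧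
    ∀ M k : ℕ, 0 < k → ∀ y ∈ U, ‖ζ k y‖ ≤ C M / (k : ℝ) ^ M}

/-- `u_k = O(k^{-∞})` for a sequence indexed by the positive integers. -/
def IsNegligible (u : ℕ → F) : Prop :=
  ∀ M : ℕ, ∃ C : ℝ, ∀ k : ℕ, 0 < k → ‖u k‖ ≤ C / (k : ℝ) ^ M

end Sections

section HalfForms

variable {δ : Type*} [NormedAddCommGroup δ] [InnerProductSpace ℂ δ]

/-- The scalar product of `ℤ e ⊕ ℤ f`-invariant sections, the integral of the pointwise scalar
product over the fundamental domain `{p e + q f | 0 ≤ p, q ≤ 1}` with respect to `|ω|`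
(complex linear in the second argument). -/
def sectionInner (P : PolarizedPlane E) (e f : E) (Ψ₁ Ψ₂ : E → δ) : ℂ :=
  ((|P.ω e f| : ℝ) : ℂ) *
    ∫ p in (0 : ℝ)..1, ∫ q in (0 : ℝ)..1, inner ℂ (Ψ₁ (p • e + q • f)) (Ψ₂ (p • e + q • f))

/-- For a lattice basis `(e, f)` with `ω(e, f) = 2πN`: an orthonormal basis
`(Ψ_ℓ, ℓ ∈ ℤ / Nk)` of the quantum space such that
`T^*_{e/Nk} Ψ_ℓ = exp(2iπℓ / Nk) Ψ_ℓ` and `T^*_{f/Nk} Ψ_ℓ = Ψ_{ℓ+1}`. -/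
structure IsHeisenbergBasis (P : PolarizedPlane E) (k N : ℕ) (e f : E)
    (Ψ : ZMod (N * k) → E → δ) : Prop where
  span_eq : Submodule.span ℂ (Set.range Ψ) = quantumSpace P δ k e f
  orthonormal : ∀ m n, sectionInner P e f (Ψ m) (Ψ n) = if m = n then 1 else 0
  pullback_e : ∀ ℓ : ℤ, pullback P k ((1 / ((N : ℝ) * k)) • e) (Ψ (ℓ : ZMod (N * k))) =
    Complex.exp (2 * Complex.I * Real.pi * ℓ / ((N : ℂ) * k)) • Ψ (ℓ : ZMod (N * k))
  pullback_f : ∀ ℓ, pullback P k ((1 / ((N : ℝ) * k)) • f) (Ψ ℓ) = Ψ (ℓ + 1)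

/-- The basis `(ξ_ℓ, ℓ ∈ ℤ / 2k)` of the space attached to the lattice `ℤ μ ⊕ ℤ lam`: with
`M = T^*_{μ/2k}`, `L = T^*_{-lam/2k}` and `q = exp(iπ/k)` one has
`M ξ_ℓ = q^ℓ ξ_ℓ` and `L ξ_ℓ = ξ_{ℓ-1}`, and `ξ_0(0)` lies in `ℝ⁺ Ω_μ`. -/
def IsKnotBasis (P : PolarizedPlane E) (k : ℕ) (mu lam : E) (Ωμ : δ)
    (ξ : ZMod (2 * k) → E → δ) : Prop :=
  IsHeisenbergBasis P k 2 mu lam ξ ∧ ∃ r : ℝ, 0 ≤ r ∧ ξ 0 0 = (r : ℂ) • Ωμ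

/-- The `ℓ`-th Jones polynomial of the torus knot with parameter `(a, b)`, for `ℓ ≥ 0`, as a
function of `t`; the summation index is `m = 2r = 2s - (ℓ - 1)`, `0 ≤ s < ℓ`. -/
def jones (a b ℓ : ℕ) (t : ℂ) : ℂ :=
  t ^ ((a : ℤ) * b * (1 - (ℓ : ℤ) ^ 2)) / (t ^ (2 : ℤ) - t ^ (-2 : ℤ)) *
    ∑ s ∈ Finset.range ℓ,
      t ^ ((a : ℤ) * b * (2 * (s : ℤ) - (ℓ - 1)) ^ 2) *
        (t ^ (-2 * ((a : ℤ) + b) * (2 * (s : ℤ) - (ℓ - 1)) + 2) -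
          t ^ (-2 * ((a : ℤ) - b) * (2 * (s : ℤ) - (ℓ - 1)) - 2))

/-- The knot state
`Z_k = sin(π/k) k^{-1/2} ∑_{ℓ ∈ ℤ/2k} J_ℓ(-exp(iπ/2k)) ξ_ℓ`, the sum being taken over the
representatives `0 ≤ ℓ < 2k` (for `k = 1` the prefactor vanishes). -/
def knotState (a b : ℕ) (ξ : ∀ k : ℕ, ZMod (2 * k) → E → δ) (k : ℕ) : E → δ :=
  ((Real.sin (Real.pi / k) / √(k : ℝ) : ℝ) : ℂ) •
    ∑ ℓ ∈ Finset.range (2 * k),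
      jones a b ℓ (-Complex.exp (Complex.I * Real.pi / (2 * (k : ℂ)))) • ξ k (ℓ : ZMod (2 * k))

/-- `Φ_ℓ = (2kD)^{-1/2} ∑_{n ∈ ℤ/2kD} exp(2iπnℓ/D) Ψ_n`. -/
def fourierState (D k : ℕ) (Ψ : ZMod (2 * D * k) → E → δ) (ℓ : ℤ) : E → δ :=
  ((1 / √(2 * (k : ℝ) * D) : ℝ) : ℂ) •
    ∑ n ∈ Finset.range (2 * D * k),
      Complex.exp (2 * Complex.I * Real.pi * n * ℓ / (D : ℂ)) • Ψ (n : ZMod (2 * D * k))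

/-- With `D = 2ab`: `Ψ_k = (Ψ_n, n ∈ ℤ/2kD)` is the basis of the space `H_{D,k}` attached to the
lattice `ℤ D μ ⊕ ℤ lam` such that, for `S = T^*_{-lam/2kD}` and `R = T^*_{(Dμ - 2 lam)/2kD}`,
`S Ψ_n = exp(iπn/kD) Ψ_n`, `R Ψ_n = Ψ_{n+1}` and
`Ψ_0(0) = exp(iπ/4) (k/2π)^{1/4} Ω_lam + O(k^{-∞})`. -/
def IsAdaptedBasis (P : PolarizedPlane E) (a b : ℕ) (mu lam : E) (Ωlam : δ)
    (Ψ : ∀ k : ℕ, ZMod (2 * (2 * a * b) * k) → E → δ) : Prop :=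
  (∀ k : ℕ, 0 < k →
    IsHeisenbergBasis P k (2 * (2 * a * b)) (-lam) (((2 * a * b : ℕ) : ℝ) • mu - (2 : ℝ) • lam)
      (Ψ k)) ∧
  IsNegligible fun k : ℕ => Ψ k 0 0 -
    (Complex.exp (Complex.I * Real.pi / 4) *
      ((((k : ℝ) / (2 * Real.pi)) ^ (1 / 4 : ℝ) : ℝ) : ℂ)) • Ωlam

/-- The sequences `γ_ℓ(k)`, `ℓ ∈ ℤ/D`, with `D = 2ab`, attached to the knot state: in the basis
`Ψ_n`, `Z_k` and `∑_ℓ γ_ℓ(k) Φ_ℓ` have the same coefficients for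
`-ab + a + b < n < 2k - ab - a - b`, and `γ_ℓ(k)` solves the recurrence relation driven by
`β_ℓ(k) = C_k (-1)^ℓ sin(πℓ/a) sin(πℓ/b) + O(k^{-∞})`, `C_k = -4 α(k) (2k/D)^{1/2}`,
where `α(k) = (i/√2) q^{-(a²+b²)/D + D/4} + O(k^{-∞})` and `q = exp(iπ/k)`. -/
structure IsGammaSystem (P : PolarizedPlane E) (a b : ℕ) (mu lam : E)
    (ξ : ∀ k : ℕ, ZMod (2 * k) → E → δ) (Ψ : ∀ k : ℕ, ZMod (2 * (2 * a * b) * k) → E → δ)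
    (α : ℕ → ℂ) (β γ : ZMod (2 * a * b) → ℕ → ℂ) : Prop where
  coeff_eq : ∀ k : ℕ, 0 < k → ∀ n : ℤ, -(a * b : ℤ) + a + b < n → n < 2 * k - a * b - a - b →
    sectionInner P (-lam) (((2 * a * b : ℕ) : ℝ) • mu - (2 : ℝ) • lam)
      (Ψ k (n : ZMod (2 * (2 * a * b) * k)))
      (knotState a b ξ k - ∑ ℓ ∈ Finset.range (2 * a * b),
        γ (ℓ : ZMod (2 * a * b)) k • fourierState (2 * a * b) k (Ψ k) ℓ) = 0
  gamma_neg_one : ∀ k : ℕ, 0 < k → γ (-1) k = 0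
  gamma_zero : ∀ k : ℕ, 0 < k → γ 0 k = 1 / 2 * β 0 k
  gamma_rec : ∀ k : ℕ, 0 < k → ∀ ℓ : ℤ, γ (ℓ : ZMod (2 * a * b)) k =
    Complex.exp (2 * Complex.I * Real.pi / ((2 * a * b : ℕ) : ℂ) * (2 * k * ((ℓ : ℂ) - 1))) *
      γ ((ℓ - 2 : ℤ) : ZMod (2 * a * b)) k + β (ℓ : ZMod (2 * a * b)) k
  beta_asymp : ∀ ℓ : ℤ, IsNegligible fun k : ℕ => β (ℓ : ZMod (2 * a * b)) k -
    (-4 * α k * ((√(2 * (k : ℝ) / ((2 * a * b : ℕ) : ℝ)) : ℝ) : ℂ)) *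
      ((-1) ^ ℓ * ((Real.sin (Real.pi * ℓ / a) * Real.sin (Real.pi * ℓ / b) : ℝ) : ℂ))
  alpha_asymp : IsNegligible fun k : ℕ => α k -
    Complex.I / ((√2 : ℝ) : ℂ) * Complex.exp (Complex.I * Real.pi / k *
      (-((a : ℂ) ^ 2 + (b : ℂ) ^ 2) / ((2 * a * b : ℕ) : ℂ) + ((2 * a * b : ℕ) : ℂ) / 4))

end HalfForms

/-- The strip `A = (-1, 0) μ + ℝ lam`. -/
def stripA (mu lam : E) : Set E :=
  {x | ∃ s r : ℝ, -1 < s ∧ s < 0 ∧ x = s • mu + r • lam}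

/-- The open interval `I_ℓ = {ℓ lam/D + t (lam/D - μ/2) | t ∈ (0, 2)}`. -/
def intervalI (D : ℕ) (mu lam : E) (ℓ : ℤ) : Set E :=
  {x | ∃ t : ℝ, 0 < t ∧ t < 2 ∧
    x = ((ℓ : ℝ) / D) • lam + t • ((1 / (D : ℝ)) • lam - (1 / 2 : ℝ) • mu)}

/-- `t` is the holomorphic section of `L` equal to `1` on the line `ℝ d`. -/
def IsUnitSectionOn (P : PolarizedPlane E) (d : E) (t : E → ℂ) : Prop :=
  IsHolomorphicSection P 1 t ∧ ∀ s : ℝ, t (s • d) = 1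

end TorusKnotState

end

/-!
# The knot states of torus knots

**Sections and theta series.** For `e ≠ 0` the plane has a complex coordinate `coord e` with value
`1` at `e`, and `L` the holomorphic frame `t_e = lineSection e`, equal to `1` on `ℝ e` and of Gaussian
decay away from it. The series `theta P k e f s = ∑ T^*_{(m+s)f} t_e^k` is a Jacobi theta function in
this frame. If `ω(e, f) = 2πN` with `N` even, the series with `s = n / Nk` form an orthonormal basis
(`isHeisenbergBasis_thetaBasis`): orthonormality is a Gaussian integral, and the dimension is at most
`Nk` because the invariance determines all Fourier coefficients by `Nk` of them. Such a basis is
unique up to a phase (`IsHeisenbergBasis.eq_smul`), and as the value of the theta series at `0` is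
exponentially close to `1`, the phase of the basis `ξ` is exponentially close to `1`
(`exists_phase`). The finite Fourier transform exchanges the theta series along `e` and along `f`
(`theta_poisson`), with a factor whose square has the effect of changing half-forms at `e` into
half-forms at `f` (`HalfFormLine.φ_poissonFactor`).

**Coefficients.** By Poisson summation from `μ` to `lam`, the coefficients of `Z_k` along `Ψ_n` are, up
to a constant, `jonesHat n = q^{-n²/D} ∑_ℓ q^{-nℓ} B_ℓ` with `D = 2ab` and `B_ℓ` proportional to the
Jones polynomial (`knotState_eq_sum`). The sequence `B` has period `2k` and is odd, because of the
vanishing of a difference of Gauss sums (`sum_jonesDiff`, the place where `a` and `b` have to be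
coprime), and it satisfies a difference equation whose inhomogeneous term has only the frequencies
`-ab ± a ± b` (`jonesNum_add_two`). Consequently `jonesHat` is `D`-periodic except for jumps at these
frequencies modulo `2k` (`jonesHat_sub`). Its `D`-periodic part between the jumps is `periodicHat`,
whose Fourier transform on `ℤ / D` is the sequence `γ`. Two windows of length `D` on the two sides of
the jumps compute `γ_ℓ` and the homogeneous term of its recurrence, so that `β_ℓ` is the sum of the
jumps (`betaHat_eq_sum_jumps`), an exact formula; the values `γ_{-1}` and `γ_0` come from oddness.

**Localization.** The difference of `Z_k` and `∑ γ_ℓ Φ_ℓ` only involves states `Ψ_n` that are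
concentrated away from the strip `A` (`rapidlyDecreasing_knotState_sub`). By Poisson summation from
`lam` to `Dμ - 2 lam`, the sum `∑ γ_ℓ Φ_ℓ` is the sum over `r ∈ ℤ` of `γ_r` times the Lagrangian
section on the line through `r lam / D` parallel to `Dμ - 2 lam` (`sum_fourierState_eq_tsum`). Within
`A`, these lines are the intervals `I_r`, so that near a point of `A` at most one of the summands is
not exponentially small (`exists_rapidlyDecreasing_knotState`).
-/

noncomputable section

namespace TorusKnotState

section

variable {E : Type*} [NormedAddCommGroup E] [NormedSpace ℝ E]

/-! ### The complex coordinate of a polarized plane -/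

namespace PolarizedPlane

variable (P : PolarizedPlane E)

theorem omega_swap (x y : E) : P.ω x y = -P.ω y x := by
  have h := P.ω_self (x + y)
  simp only [map_add, LinearMap.add_apply, P.ω_self] at h
  linarith

theorem omega_j_left (x y : E) : P.ω (P.j x) y = -P.ω x (P.j y) := by
  have h := P.ω_j_j (P.j x) y
  rw [P.j_j] at h
  simp only [map_neg, LinearMap.neg_apply] at h
  linarith

theorem finiteDimensional (P : PolarizedPlane E) : FiniteDimensional ℝ E :=
  Module.finite_of_finrank_pos (by rw [P.finrank_eq_two]; norm_num)

theorem continuous_omega (e : E) : Continuous (P.ω e) := by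
  have := P.finiteDimensional
  exact LinearMap.continuous_of_finiteDimensional _

/-- Two vectors with `ω(e, f) ≠ 0` form a basis, with the coordinates given by Cramer's rule. -/
theorem cramer {e f : E} (h : P.ω e f ≠ 0) (x : E) :
    x = (P.ω x f / P.ω e f) • e + (P.ω e x / P.ω e f) • f := by
  have := P.finiteDimensional
  have hli : LinearIndependent ℝ ![e, f] := by
    rw [LinearIndependent.pair_iff]
    intro s t hst
    have h1 : P.ω (s • e + t • f) f = 0 := by rw [hst]; simp
    have h2 : P.ω e (s • e + t • f) = 0 := by rw [hst]; simp
    simp only [map_add, map_smul, LinearMap.add_apply, LinearMap.smul_apply, P.ω_self,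
      smul_eq_mul, mul_zero, add_zero, zero_add] at h1 h2
    exact ⟨(mul_eq_zero.1 h1).resolve_right h, (mul_eq_zero.1 h2).resolve_right h⟩
  have hsp := hli.span_eq_top_of_card_eq_finrank (by simp [P.finrank_eq_two])
  have hx : x ∈ Submodule.span ℝ (Set.range ![e, f]) := by rw [hsp]; trivial
  rw [Matrix.range_cons, Matrix.range_cons, Matrix.range_empty, Set.union_empty,
    Set.singleton_union, Submodule.mem_span_pair] at hx
  obtain ⟨s, t, rfl⟩ := hx
  simp only [map_add, map_smul, LinearMap.add_apply, LinearMap.smul_apply, P.ω_self,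
      smul_eq_mul, mul_zero, add_zero, zero_add]
  rw [mul_div_cancel_right₀ _ h, mul_div_cancel_right₀ _ h]

/-- The Euclidean square `ω(e, j e)` of `e`. -/
def normSq (e : E) : ℝ := P.ω e (P.j e)

theorem normSq_pos {e : E} (he : e ≠ 0) : 0 < P.normSq e := P.ω_j_pos e he

/-- The complex coordinate of `E` normalized by the value `1` at `e`, that is the element of the
canonical line `K_j` that takes the value `1` at `e` (for `e ≠ 0`). -/
def coord (e : E) : E →ₗ[ℝ] ℂ where
  toFun x := (((P.ω x (P.j e) / P.normSq e : ℝ) : ℂ)) +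
    Complex.I * ((P.ω e x / P.normSq e : ℝ) : ℂ)
  map_add' x y := by
    simp only [map_add, LinearMap.add_apply]; push_cast; ring
  map_smul' c x := by
    simp only [map_smul, LinearMap.smul_apply, smul_eq_mul, Complex.real_smul, RingHom.id_apply]
    push_cast; ring

theorem coord_apply (e x : E) : P.coord e x = (((P.ω x (P.j e) / P.normSq e : ℝ) : ℂ)) +
    Complex.I * ((P.ω e x / P.normSq e : ℝ) : ℂ) := rfl

theorem coord_re (e x : E) : (P.coord e x).re = P.ω x (P.j e) / P.normSq e := by
  simp [coord_apply]

theorem coord_im (e x : E) : (P.coord e x).im = P.ω e x / P.normSq e := by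
  simp [coord_apply]

theorem coord_self {e : E} (he : e ≠ 0) : P.coord e e = 1 := by
  rw [coord_apply, P.ω_self]
  have := (P.normSq_pos he).ne'
  rw [show P.ω e (P.j e) = P.normSq e from rfl, div_self this]
  simp

theorem coord_j (e x : E) : P.coord e (P.j x) = Complex.I * P.coord e x := by
  rw [coord_apply, coord_apply, P.ω_j_j, P.omega_swap e (P.j x), P.omega_j_left,
    P.omega_swap x e]
  push_cast
  linear_combination (-(P.ω e x : ℂ) / (P.normSq e : ℂ)) * Complex.I_mul_I

theorem eq_coord {e : E} (he : e ≠ 0) (x : E) :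
    x = (P.coord e x).re • e + (P.coord e x).im • P.j e := by
  rw [coord_re, coord_im]
  exact P.cramer (P.normSq_pos he).ne' x

/-- The canonical line `K_j` has complex dimension one: its elements are multiples of `coord e`. -/
theorem canonicalLine_apply {e : E} (he : e ≠ 0) {α : E →ₗ[ℝ] ℂ} (hα : α ∈ P.canonicalLine)
    (x : E) : α x = P.coord e x * α e := by
  have h : α (P.j e) = Complex.I * α e := hα e
  conv_lhs => rw [P.eq_coord he x]
  rw [map_add, map_smul, map_smul, h, Complex.real_smul, Complex.real_smul]
  conv_rhs => rw [← Complex.re_add_im (P.coord e x)]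
  ring

theorem continuous_coord (e : E) : Continuous (P.coord e) := by
  have := P.finiteDimensional
  exact LinearMap.continuous_of_finiteDimensional _

/-- The identity behind all the computations of exponents: it makes the translates of `lineSection`
exponentials of affine functions of the coordinate. -/
theorem omega_mul_coord {e : E} (he : e ≠ 0) (g x : E) :
    (P.ω e x : ℂ) * P.coord e g - P.ω g x = P.coord e x * P.ω e g := by
  have hs : (P.normSq e : ℂ) ≠ 0 := by exact_mod_cast (P.normSq_pos he).ne'
  have h : P.ω g x * P.normSq e =
      P.ω g (P.j e) * P.ω e x - P.ω e g * P.ω x (P.j e) := by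
    have hx := P.cramer (P.normSq_pos he).ne' x
    have h1 : P.ω g x = P.ω g ((P.ω x (P.j e) / P.normSq e) • e +
      (P.ω e x / P.normSq e) • P.j e) := congrArg _ hx
    rw [map_add, map_smul, map_smul, P.omega_swap g e, smul_eq_mul, smul_eq_mul] at h1
    have := (P.normSq_pos he).ne'
    rw [h1]; field_simp
    ring
  have h' : (P.ω g x : ℂ) * P.normSq e =
      P.ω g (P.j e) * P.ω e x - P.ω e g * P.ω x (P.j e) := by exact_mod_cast h
  rw [coord_apply, coord_apply]
  push_cast
  field_simp
  linear_combination -h'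

theorem coord_smul {e : E} {r : ℝ} (hr : r ≠ 0) (x : E) :
    P.coord (r • e) x = P.coord e x / r := by
  have hr' : (r : ℂ) ≠ 0 := by exact_mod_cast hr
  rw [coord_apply, coord_apply]
  simp only [normSq, map_smul, LinearMap.smul_apply, smul_eq_mul]
  push_cast
  by_cases hs : (P.ω e (P.j e) : ℂ) = 0
  · simp [hs]
  field_simp

theorem coord_change {e g : E} (hg : g ≠ 0) (x : E) :
    P.coord e x = P.coord g x * P.coord e g :=
  P.canonicalLine_apply hg (fun y => P.coord_j e y) x

theorem coord_ne_zero {e g : E} (he : e ≠ 0) (hg : g ≠ 0) : P.coord e g ≠ 0 := by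
  intro h
  have := P.coord_change (e := e) hg e
  rw [P.coord_self he, h, mul_zero] at this
  exact one_ne_zero this

/-! ### Lagrangian sections -/

/-- The holomorphic section of `L` that is equal to `1` on the line `ℝ e`. -/
def lineSection (e x : E) : ℂ :=
  Complex.exp (Complex.I / 2 * P.coord e x * P.ω e x)

theorem lineSection_smul {e : E} {r : ℝ} (hr : r ≠ 0) :
    P.lineSection (r • e) = P.lineSection e := by
  have hr' : (r : ℂ) ≠ 0 := by exact_mod_cast hr
  funext x
  rw [lineSection, lineSection, P.coord_smul hr]
  simp only [map_smul, LinearMap.smul_apply, smul_eq_mul]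
  push_cast
  congr 1; field_simp

theorem norm_lineSection (e x : E) :
    ‖P.lineSection e x‖ = Real.exp (-(P.ω e x) ^ 2 / (2 * P.normSq e)) := by
  rw [lineSection, Complex.norm_exp, coord_apply]
  congr 1
  simp
  ring

theorem lineSection_pow (e : E) (k : ℕ) (x : E) : P.lineSection e x ^ k =
    Complex.exp (k * (Complex.I / 2 * P.coord e x * P.ω e x)) := by
  rw [lineSection, ← Complex.exp_nat_mul]

end PolarizedPlane

section Pullback

variable (P : PolarizedPlane E) {F : Type*} [NormedAddCommGroup F] [NormedSpace ℂ F]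

theorem pullback_pullback (k : ℕ) (x y : E) (Ψ : E → F) :
    pullback P k x (pullback P k y Ψ) =
      Complex.exp (Complex.I * k / 2 * P.ω x y) • pullback P k (x + y) Ψ := by
  funext z
  simp only [pullback, Pi.smul_apply, smul_smul, ← Complex.exp_add, map_add, LinearMap.add_apply]
  rw [← add_assoc, add_comm y x, P.omega_swap y x]
  congr 2
  push_cast
  ring

theorem pullback_smul (k : ℕ) (x : E) (c : ℂ) (Ψ : E → F) :
    pullback P k x (c • Ψ) = c • pullback P k x Ψ := by
  funext z; simp only [pullback, Pi.smul_apply]; rw [smul_comm]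

theorem pullback_sum {ι : Type*} (k : ℕ) (x : E) (s : Finset ι) (Ψ : ι → E → F) :
    pullback P k x (∑ i ∈ s, Ψ i) = ∑ i ∈ s, pullback P k x (Ψ i) := by
  funext z; simp only [pullback, Finset.sum_apply, Finset.smul_sum]

theorem pullback_smul_vec (k : ℕ) (x : E) (f : E → ℂ) (v : F) :
    pullback P k x (fun y => f y • v) = fun y => pullback P k x f y • v := by
  funext z; simp only [pullback, smul_smul, smul_eq_mul]

/-- The Lagrangian section `T_y^* (t_e)^k` of `L^k`, with `t_e = lineSection e`. By `norm_lagr`, it is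
concentrated on the affine line `-y + ℝ e`. -/
def lagr (k : ℕ) (e y : E) : E → ℂ := pullback P k y (fun x => P.lineSection e x ^ k)

theorem lagr_apply (k : ℕ) (e y x : E) : lagr P k e y x =
    Complex.exp (-Complex.I * ((k : ℂ) / 2) * (P.ω y x : ℂ)) * P.lineSection e (y + x) ^ k := rfl

theorem pullback_lagr (k : ℕ) (e x y : E) : pullback P k x (lagr P k e y) =
    Complex.exp (Complex.I * k / 2 * P.ω x y) • lagr P k e (x + y) :=
  pullback_pullback P k x y _

theorem norm_lagr (k : ℕ) (e y x : E) :
    ‖lagr P k e y x‖ = Real.exp (-k * (P.ω e x + P.ω e y) ^ 2 / (2 * P.normSq e)) := by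
  rw [lagr_apply, norm_mul, norm_pow, P.norm_lineSection, Complex.norm_exp, ← Real.exp_nat_mul]
  rw [← Real.exp_add]
  congr 1
  simp
  ring

theorem lagr_smul_left {r : ℝ} (hr : r ≠ 0) (k : ℕ) (e y : E) :
    lagr P k (r • e) y = lagr P k e y := by
  rw [lagr, lagr, P.lineSection_smul hr]

theorem lagr_smul_self {e : E} (he : e ≠ 0) (k : ℕ) (r : ℝ) :
    lagr P k e (r • e) = fun x => P.lineSection e x ^ k := by
  funext x
  rw [lagr_apply, P.lineSection_pow, P.lineSection_pow, ← Complex.exp_add]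
  congr 1
  simp only [map_add, map_smul, LinearMap.smul_apply, P.ω_self, P.coord_self he, smul_eq_mul,
    Complex.real_smul]
  push_cast
  ring

/-- Translations along `ℝ e` act on the Lagrangian sections attached to `e` by phases. -/
theorem lagr_add_smul_self {e : E} (he : e ≠ 0) (k : ℕ) (r : ℝ) (y : E) :
    lagr P k e (y + r • e) =
      Complex.exp (-(Complex.I * k / 2 * P.ω y (r • e))) • lagr P k e y := by
  have h := pullback_lagr P k e y (r • e)
  rw [lagr_smul_self P he] at h
  have h2 : lagr P k e y = pullback P k y (fun x => P.lineSection e x ^ k) := rfl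
  rw [h2, h, smul_smul, ← Complex.exp_add]
  simp

/-- Relative to `(t_e)^k`, a translated Lagrangian section is the exponential of an affine function
of the coordinate, namely the summand of a theta series. -/
theorem lagr_smul {e : E} (he : e ≠ 0) (k : ℕ) (M : ℝ) (g x : E) :
    lagr P k e (M • g) x = P.lineSection e x ^ k *
      Complex.exp (Complex.I * k * P.ω e g * M * P.coord e x +
        Complex.I * k / 2 * P.coord e g * P.ω e g * M ^ 2) := by
  rw [lagr_apply, P.lineSection_pow, P.lineSection_pow, ← Complex.exp_add, ← Complex.exp_add]
  congr 1
  simp only [map_add, map_smul, LinearMap.smul_apply, smul_eq_mul, Complex.real_smul]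
  push_cast
  linear_combination (Complex.I * k * M / 2) * P.omega_mul_coord he g x

end Pullback

end

section

variable {E : Type*} [NormedAddCommGroup E] [NormedSpace ℝ E]

section Theta

variable (P : PolarizedPlane E)

/-! ### Theta series -/

/-- The theta series `∑ m, T_{(m+s)g}^* (t_e)^k`, a section of `L^k` that is concentrated on the
family of parallel lines `-(m+s)g + ℝ e`. -/
def theta (k : ℕ) (e g : E) (s : ℝ) : E → ℂ :=
  fun x => ∑' m : ℤ, lagr P k e (((m : ℝ) + s) • g) x

theorem lagr_eq_jacobiTheta₂_term {e : E} (he : e ≠ 0) (k : ℕ) (g : E) (s : ℝ) (m : ℤ) (x : E) :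
    lagr P k e (((m : ℝ) + s) • g) x = P.lineSection e x ^ k *
      Complex.exp (Complex.I * k * P.ω e g * s * P.coord e x +
        Complex.I * k / 2 * P.coord e g * P.ω e g * s ^ 2) *
      jacobiTheta₂_term m (k * P.ω e g / (2 * Real.pi) * (P.coord e x + s * P.coord e g))
        (k * P.coord e g * P.ω e g / (2 * Real.pi)) := by
  have hpi : (Real.pi : ℂ) ≠ 0 := by exact_mod_cast Real.pi_ne_zero
  rw [lagr_smul P he, jacobiTheta₂_term, mul_assoc (P.lineSection e x ^ k), ← Complex.exp_add]
  congr 2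
  push_cast
  field_simp
  ring

theorem im_period_pos {e g : E} (he : e ≠ 0) {k : ℕ} (hk : 0 < k) (hg : P.ω e g ≠ 0) :
    0 < ((k : ℂ) * P.coord e g * P.ω e g / (2 * Real.pi)).im := by
  have h : (k : ℂ) * P.coord e g * P.ω e g / (2 * Real.pi) =
      ((k * P.ω e g / (2 * Real.pi) : ℝ) : ℂ) * P.coord e g := by
    push_cast; ring
  rw [h, Complex.im_ofReal_mul, P.coord_im]
  have hs := P.normSq_pos he
  have h2 : (k : ℝ) * P.ω e g / (2 * Real.pi) * (P.ω e g / P.normSq e) =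
      k * (P.ω e g) ^ 2 / (2 * Real.pi * P.normSq e) := by
    field_simp
  rw [h2]
  positivity

theorem summable_lagr {e g : E} (he : e ≠ 0) {k : ℕ} (hk : 0 < k) (hg : P.ω e g ≠ 0) (s : ℝ)
    (x : E) : Summable fun m : ℤ => lagr P k e (((m : ℝ) + s) • g) x := by
  simp only [lagr_eq_jacobiTheta₂_term P he]
  exact ((summable_jacobiTheta₂_term_iff _ _).2 (im_period_pos P he hk hg)).mul_left _

theorem theta_eq_jacobiTheta₂ {e : E} (he : e ≠ 0) (k : ℕ) (g : E) (s : ℝ) (x : E) :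
    theta P k e g s x = P.lineSection e x ^ k *
      (Complex.exp (Complex.I * k * P.ω e g * s * P.coord e x +
        Complex.I * k / 2 * P.coord e g * P.ω e g * s ^ 2) *
      jacobiTheta₂ (k * P.ω e g / (2 * Real.pi) * (P.coord e x + s * P.coord e g))
        (k * P.coord e g * P.ω e g / (2 * Real.pi))) := by
  simp only [theta, lagr_eq_jacobiTheta₂_term P he]
  rw [tsum_mul_left, mul_assoc]
  rfl

theorem theta_add_int (k : ℕ) (e g : E) (s : ℝ) (n : ℤ) :
    theta P k e g (s + n) = theta P k e g s := by
  funext x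
  rw [theta, theta, ← (Equiv.addRight n).tsum_eq
    (fun m : ℤ => lagr P k e (((m : ℝ) + s) • g) x)]
  refine tsum_congr fun m => ?_
  simp only [Equiv.coe_addRight]
  push_cast
  rw [show (m : ℝ) + (s + n) = m + n + s by ring]

theorem pullback_tsum (k : ℕ) (x : E) (f : ℤ → E → ℂ) :
    pullback P k x (fun y => ∑' m, f m y) = fun y => ∑' m, pullback P k x (f m) y := by
  funext y
  simp only [pullback, smul_eq_mul, tsum_mul_left]

theorem pullback_theta_right (k : ℕ) (e g : E) (s r : ℝ) :
    pullback P k (r • g) (theta P k e g s) = theta P k e g (s + r) := by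
  unfold theta
  rw [pullback_tsum]
  funext x
  refine tsum_congr fun m => ?_
  rw [pullback_lagr, ← add_smul]
  simp only [map_smul, LinearMap.smul_apply, P.ω_self]
  simp [show r + ((m : ℝ) + s) = m + (s + r) by ring]

/-- Translating a theta series along its own lines multiplies it by a phase, as soon as the phases
acquired by the summands agree. -/
theorem pullback_theta_left {e : E} (he : e ≠ 0) (k : ℕ) (g : E) (s r : ℝ) (n : ℤ)
    (h : k * r * P.ω e g = 2 * Real.pi * n) :
    pullback P k (r • e) (theta P k e g s) =
      Complex.exp (2 * Complex.I * Real.pi * n * s) • theta P k e g s := by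
  unfold theta
  rw [pullback_tsum]
  funext x
  rw [Pi.smul_apply, smul_eq_mul, ← tsum_mul_left]
  refine tsum_congr fun m => ?_
  rw [pullback_lagr, add_comm (r • e), lagr_add_smul_self P he, smul_smul, ← Complex.exp_add,
    Pi.smul_apply, smul_eq_mul]
  congr 1
  have h' : (k : ℂ) * r * P.ω e g = 2 * Real.pi * n := by exact_mod_cast h
  rw [Complex.exp_eq_exp_iff_exists_int]
  refine ⟨n * m, ?_⟩
  rw [P.omega_swap]
  simp only [map_smul, LinearMap.smul_apply, smul_eq_mul]
  rw [P.omega_swap g e]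
  push_cast
  linear_combination (Complex.I * (m + s)) * h'

end Theta

/-! ### Holomorphic sections and entire functions -/

section Holomorphic

variable (P : PolarizedPlane E)

theorem hasFDerivAt_exponent (k : ℕ) (e x : E) : ∃ L : E →L[ℝ] ℂ,
    HasFDerivAt (fun x => (k : ℂ) * (Complex.I / 2 * P.coord e x * P.ω e x)) L x ∧
    ∀ y, L y = k * (Complex.I / 2 * (P.coord e y * P.ω e x + P.coord e x * P.ω e y)) := by
  have := P.finiteDimensional
  have h1 : HasFDerivAt (fun x => P.coord e x) (P.coord e).toContinuousLinearMap x :=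
    (P.coord e).toContinuousLinearMap.hasFDerivAt
  have h2 : HasFDerivAt (fun x => (P.ω e x : ℂ))
      (Complex.ofRealCLM.comp (P.ω e).toContinuousLinearMap) x :=
    (Complex.ofRealCLM.comp (P.ω e).toContinuousLinearMap).hasFDerivAt
  have h3 := ((h1.const_mul (Complex.I / 2)).mul h2).const_mul (k : ℂ)
  refine ⟨_, h3, fun y => ?_⟩
  simp only [_root_.smul_apply, _root_.add_apply, ContinuousLinearMap.comp_apply,
    LinearMap.coe_toContinuousLinearMap', Complex.ofRealCLM_apply, smul_eq_mul]
  ring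

/-- The `(0,1)`-part of the connection form, expressed by the coordinate along `e`. -/
theorem cauchyRiemann_omega {e : E} (he : e ≠ 0) (x y : E) :
    (P.ω x y : ℂ) + Complex.I * P.ω x (P.j y) =
      P.coord e x * (P.ω e y + Complex.I * P.ω e (P.j y)) := by
  have hx := P.eq_coord he x
  have h1 : P.ω x y = (P.coord e x).re * P.ω e y - (P.coord e x).im * P.ω e (P.j y) := by
    conv_lhs => rw [hx]
    simp [P.omega_j_left]
    ring
  have h2 : P.ω x (P.j y) = (P.coord e x).re * P.ω e (P.j y) + (P.coord e x).im * P.ω e y := by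
    conv_lhs => rw [hx]
    simp [P.ω_j_j]
  rw [h1, h2]
  conv_rhs => rw [← Complex.re_add_im (P.coord e x)]
  push_cast
  linear_combination (-(P.coord e x).im * (P.ω e (P.j y)) : ℂ) * Complex.I_mul_I

/-- In the frame `(t_e)^k`, holomorphic sections of `L^k ⊗ F` are entire functions of the coordinate
(here, with values in a line). -/
theorem isHolomorphicSection_of_entire {F : Type*} [NormedAddCommGroup F] [NormedSpace ℂ F]
    {e : E} (he : e ≠ 0) (k : ℕ) {h : ℂ → ℂ} (hh : Differentiable ℂ h) (v : F) :
    IsHolomorphicSection P k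
      (fun x => (P.lineSection e x ^ k * h (P.coord e x)) • v) := by
  have := P.finiteDimensional
  have key : ∀ x, ∃ L : E →L[ℝ] ℂ,
      HasFDerivAt (fun x => P.lineSection e x ^ k * h (P.coord e x)) L x ∧
      ∀ y, L y = P.lineSection e x ^ k * (deriv h (P.coord e x) * P.coord e y +
        k * (Complex.I / 2 * (P.coord e y * P.ω e x + P.coord e x * P.ω e y)) *
          h (P.coord e x)) := by
    intro x
    obtain ⟨L₁, hL₁, hL₁'⟩ := hasFDerivAt_exponent P k e x
    have h1 : HasFDerivAt (fun x => P.coord e x) (P.coord e).toContinuousLinearMap x :=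
      (P.coord e).toContinuousLinearMap.hasFDerivAt
    have h2 := (((hh (P.coord e x)).hasDerivAt.hasFDerivAt).restrictScalars ℝ).comp x h1
    have h3 := (hL₁.cexp).mul h2
    simp only [← P.lineSection_pow] at h3
    refine ⟨_, h3, fun y => ?_⟩
    simp [hL₁']
    ring
  refine ⟨fun x => ?_, fun x v' => ?_⟩
  · obtain ⟨L, hL, -⟩ := key x
    exact (hL.smul_const v).differentiableAt
  · obtain ⟨L, hL, hL'⟩ := key x
    have hd := (hL.smul_const v).fderiv
    simp only [covDeriv]
    rw [hd]
    simp only [ContinuousLinearMap.smulRight_apply, hL', smul_smul, ← add_smul]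
    rw [smul_eq_zero]
    left
    rw [P.coord_j]
    have hcr := cauchyRiemann_omega P he x v'
    have hI : (k : ℂ) / Complex.I = -Complex.I * k := by
      rw [div_eq_iff Complex.I_ne_zero]; linear_combination (k : ℂ) * Complex.I_mul_I
    rw [hI]
    push_cast
    linear_combination (P.lineSection e x ^ k * h (P.coord e x) * (-Complex.I * k / 2)) * hcr +
      P.lineSection e x ^ k * P.coord e v' * (deriv h (P.coord e x) +
        k * (Complex.I / 2 * P.ω e x) * h (P.coord e x)) * Complex.I_mul_I

/-- Conversely to `isHolomorphicSection_of_entire`, a holomorphic section of `L^k` is the product of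
`(t_e)^k` by an entire function of the coordinate. -/
theorem exists_entire {e : E} (he : e ≠ 0) (k : ℕ) {Ψ : E → ℂ}
    (hΨ : IsHolomorphicSection P k Ψ) : ∃ h : ℂ → ℂ, Differentiable ℂ h ∧
      ∀ x, Ψ x = P.lineSection e x ^ k * h (P.coord e x) := by
  have := P.finiteDimensional
  set H : E → ℂ := fun x => Complex.exp (-(k * (Complex.I / 2 * P.coord e x * P.ω e x))) * Ψ x
    with hH
  have key : ∀ x, ∃ L : E →L[ℝ] ℂ, HasFDerivAt H L x ∧ ∀ y, L (P.j y) = Complex.I * L y := by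
    intro x
    obtain ⟨L₁, hL₁, hL₁'⟩ := hasFDerivAt_exponent P k e x
    have h3 := (hL₁.neg.cexp).mul (hΨ.1 x).hasFDerivAt
    refine ⟨_, h3, fun y => ?_⟩
    have hcr := cauchyRiemann_omega P he x y
    have h0 := hΨ.2 x y
    have hI : (k : ℂ) / Complex.I = -Complex.I * k := by
      rw [div_eq_iff Complex.I_ne_zero]; linear_combination (k : ℂ) * Complex.I_mul_I
    simp only [covDeriv, hI, smul_eq_mul] at h0
    push_cast at h0
    simp only [_root_.add_apply, _root_.smul_apply, _root_.neg_apply, smul_eq_mul, hL₁', P.coord_j]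
    generalize Complex.exp (-(k * (Complex.I / 2 * P.coord e x * P.ω e x))) = t
    linear_combination (-Complex.I * t) * h0 + (t * Ψ x * k / 2) * hcr +
      (t * fderiv ℝ Ψ x (P.j y) - t * Ψ x * k / 2 * Complex.I * P.ω x (P.j y) +
        t * Ψ x * k / 2 * (P.coord e x * P.ω e y - P.ω x y)) * Complex.I_mul_I
  set ι : ℂ →L[ℝ] E := Complex.reCLM.smulRight e + Complex.imCLM.smulRight (P.j e) with hι
  refine ⟨fun w => H (ι w), fun w => ?_, fun x => ?_⟩
  · rw [differentiableAt_complex_iff_differentiableAt_real]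
    obtain ⟨L, hL, hL'⟩ := key (ι w)
    have hc := hL.comp w ι.hasFDerivAt
    refine ⟨hc.differentiableAt, ?_⟩
    have := hc.fderiv
    change fderiv ℝ (H ∘ ι) w Complex.I = Complex.I • fderiv ℝ (H ∘ ι) w 1
    rw [this]
    simp [hι, hL']
  · have hx : ι (P.coord e x) = x := by
      simp only [hι, _root_.add_apply, ContinuousLinearMap.smulRight_apply, Complex.reCLM_apply,
        Complex.imCLM_apply]
      exact (P.eq_coord he x).symm
    simp only [hx, hH]
    rw [P.lineSection_pow, ← mul_assoc, ← Complex.exp_add, add_neg_cancel, Complex.exp_zero,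
      one_mul]

theorem isHolomorphicSection_theta {F : Type*} [NormedAddCommGroup F] [NormedSpace ℂ F]
    {e g : E} (he : e ≠ 0) {k : ℕ} (hk : 0 < k) (hg : P.ω e g ≠ 0) (s : ℝ) (v : F) :
    IsHolomorphicSection P k (fun x => theta P k e g s x • v) := by
  simp only [theta_eq_jacobiTheta₂ P he]
  refine isHolomorphicSection_of_entire P he k (h := fun w => Complex.exp (Complex.I * k * P.ω e g *
    s * w + Complex.I * k / 2 * P.coord e g * P.ω e g * s ^ 2) *
      jacobiTheta₂ (k * P.ω e g / (2 * Real.pi) * (w + s * P.coord e g))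
        (k * P.coord e g * P.ω e g / (2 * Real.pi))) ?_ v
  refine Differentiable.mul (by fun_prop) ?_
  intro w
  have h1 := differentiableAt_jacobiTheta₂_fst (k * P.ω e g / (2 * Real.pi) *
    (w + s * P.coord e g)) (im_period_pos P he hk hg)
  exact DifferentiableAt.comp (f := fun w : ℂ => (k : ℂ) * P.ω e g / (2 * Real.pi) *
    (w + s * P.coord e g)) w h1 (by fun_prop)

theorem continuous_theta {e g : E} (he : e ≠ 0) {k : ℕ} (hk : 0 < k) (hg : P.ω e g ≠ 0) (s : ℝ) :
    Continuous (theta P k e g s) := by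
  have h := (isHolomorphicSection_theta P he hk hg s (1 : ℂ)).1.continuous
  simpa using h

theorem continuous_lagr (k : ℕ) (e y : E) : Continuous (lagr P k e y) := by
  have h1 := P.continuous_omega y
  have h2 := P.continuous_coord e
  have h3 := P.continuous_omega e
  unfold lagr pullback PolarizedPlane.lineSection
  fun_prop

end Holomorphic

end

section

/-! ### Fourier series of entire functions and theta series -/

open Complex in
/-- By Cauchy's theorem on a rectangle, the mean of a `1`-periodic entire function over a horizontal
period does not depend on the height. -/
theorem integral_shift_of_entire {h : ℂ → ℂ} (hh : Differentiable ℂ h)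
    (hper : ∀ w, h (w + 1) = h w) (w : ℂ) :
    ∫ x in (0 : ℝ)..1, h (x + w) = ∫ x in (0 : ℝ)..1, h x := by
  have h1 : ∫ x in (0 : ℝ)..1, h (x + w) = ∫ x in (0 : ℝ)..1, h (x + w.im * I) := by
    have hp : Function.Periodic (fun x : ℝ => h (x + w.im * I)) 1 := by
      intro x
      have := hper (x + w.im * I)
      simp only
      rw [← this]; congr 1; push_cast; ring
    have h2 := hp.intervalIntegral_add_eq w.re 0
    rw [zero_add] at h2
    have h5 := intervalIntegral.integral_comp_add_right (a := 0) (b := 1)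
      (fun x : ℝ => h (x + w.im * I)) w.re
    rw [zero_add, add_comm 1] at h5
    rw [← h2, ← h5]
    refine intervalIntegral.integral_congr fun x _ => ?_
    congr 1
    push_cast
    rw [add_assoc, re_add_im]
  rw [h1]
  have h3 := integral_boundary_rect_eq_zero_of_differentiableOn h 0 (1 + w.im * I)
    hh.differentiableOn
  have h4 : ∀ y : ℝ, h (1 + y * I) = h (y * I) := fun y => by rw [add_comm, hper]
  simp [h4] at h3
  exact (sub_eq_zero.1 h3).symm

open Complex in
/-- An entire function with period `1` whose Fourier coefficients vanish is zero. -/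
theorem entire_eq_zero_of_fourier {h : ℂ → ℂ} (hh : Differentiable ℂ h)
    (hper : ∀ w, h (w + 1) = h w)
    (hc : ∀ n : ℤ, ∫ x in (0 : ℝ)..1, h x * exp (-2 * Real.pi * I * n * x) = 0) : h = 0 := by
  have hp : Function.Periodic (fun x : ℝ => h x) 1 := by
    intro x; simp only; rw [← hper x]; push_cast; rfl
  have : Fact ((0 : ℝ) < 1) := ⟨one_pos⟩
  set f : C(AddCircle (1 : ℝ), ℂ) :=
    ⟨hp.lift, continuous_coinduced_dom.2 (hh.continuous.comp continuous_ofReal)⟩ with hf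
  have hcoef : fourierCoeff f = 0 := by
    funext n
    rw [fourierCoeff_eq_intervalIntegral _ _ 0]
    have : ∫ x in (0 : ℝ)..(0 + 1), (fourier (-n) (x : AddCircle (1 : ℝ)) : ℂ) • f x
        = ∫ x in (0 : ℝ)..1, h x * exp (-2 * Real.pi * I * n * x) := by
      rw [zero_add]
      refine intervalIntegral.integral_congr fun x _ => ?_
      simp only [smul_eq_mul, fourier_coe_apply]
      have : f x = h x := rfl
      rw [this, mul_comm]
      congr 2
      push_cast
      ring
    rw [this, hc n]
    simp
  have hzero : ∀ x : ℝ, h x = 0 := by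
    intro x
    have h1 := has_pointwise_sum_fourier_series_of_summable (f := f)
      (by rw [hcoef]; exact summable_zero) (x : AddCircle (1 : ℝ))
    rw [hcoef] at h1
    simp only [Pi.zero_apply, zero_smul] at h1
    exact h1.unique hasSum_zero
  have ha : AnalyticOnNhd ℂ h Set.univ := fun z _ => hh.analyticAt z
  have hz : AnalyticOnNhd ℂ (0 : ℂ → ℂ) Set.univ := fun z _ => analyticAt_const
  refine ha.eq_of_frequently_eq (z₀ := 0) hz ?_
  have ht : Filter.Tendsto (fun x : ℝ => (x : ℂ)) (𝓝[≠] 0) (𝓝[≠] 0) := by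
    refine tendsto_nhdsWithin_iff.2 ⟨?_, ?_⟩
    · have : Continuous (fun x : ℝ => (x : ℂ)) := continuous_ofReal
      exact (this.tendsto' 0 0 (by simp)).mono_left nhdsWithin_le_nhds
    · filter_upwards [self_mem_nhdsWithin] with x hx
      simpa using hx
  refine ht.frequently ?_
  exact Filter.Frequently.of_forall fun x => hzero x

open Complex in
/-- The quasi-periodicity of theta functions of level `K` determines all Fourier coefficients by
those of index `0, …, K - 1`. -/
theorem entire_eq_zero_of_quasiperiodic {h : ℂ → ℂ} (hh : Differentiable ℂ h)
    (hper : ∀ w, h (w + 1) = h w) {K : ℕ} (hK : 0 < K) {τ : ℂ}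
    (hτ : ∀ w, h (w + τ) * exp (I * Real.pi * K * (2 * w + τ)) = h w)
    (hc : ∀ n : Fin K, ∫ x in (0 : ℝ)..1, h x * exp (-2 * Real.pi * I * (n : ℕ) * x) = 0) :
    h = 0 := by
  refine entire_eq_zero_of_fourier hh hper ?_
  set c : ℤ → ℂ := fun n => ∫ x in (0 : ℝ)..1, h x * exp (-2 * Real.pi * I * n * x) with hcdef
  have hstep : ∀ n : ℤ, c n = exp (-(I * Real.pi * K * τ) - 2 * Real.pi * I * n * τ) * c (n + K) := by
    intro n
    have h1 := integral_shift_of_entire (h := fun w => h w * exp (-2 * Real.pi * I * n * w))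
      (hh.mul (by fun_prop)) (fun w => by
        simp only [hper]
        congr 1
        rw [exp_eq_exp_iff_exists_int]
        exact ⟨-n, by push_cast; ring⟩) τ
    simp only [hcdef]
    rw [← h1, ← intervalIntegral.integral_const_mul]
    refine intervalIntegral.integral_congr fun x _ => ?_
    have hx := hτ x
    rw [← hx, mul_comm (exp (-(I * Real.pi * K * τ) - _)), mul_assoc (h (x + τ)), mul_assoc (h _),
      ← exp_add, ← exp_add]
    congr 2
    push_cast
    ring
  have hall : ∀ (r : ℤ), c r = 0 → ∀ j : ℤ, c (r + j * K) = 0 := by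
    intro r hr j
    induction j using Int.induction_on with
    | zero => simpa using hr
    | succ i ih =>
      have h1 := hstep (r + i * K)
      rw [ih] at h1
      have := (mul_eq_zero.1 h1.symm).resolve_left (exp_ne_zero _)
      rw [add_mul, one_mul, ← add_assoc]; exact this
    | pred i ih =>
      rw [hstep, show r + (-(i : ℤ) - 1) * K + K = r + -(i : ℤ) * K by ring, ih, mul_zero]
  intro n
  have hK' : (0 : ℤ) < K := by exact_mod_cast hK
  have hr : c (n % K) = 0 := by
    have h0 := Int.emod_nonneg n hK'.ne'
    have hlt := Int.emod_lt_of_pos n hK'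
    have := hc ⟨(n % K).toNat, by omega⟩
    simp only [hcdef]
    have hcast : (((n % K).toNat : ℕ) : ℂ) = ((n % K : ℤ) : ℂ) := by
      have : (((n % K).toNat : ℤ)) = n % K := Int.toNat_of_nonneg h0
      exact_mod_cast congrArg (fun z : ℤ => (z : ℂ)) this
    rw [← hcast]; exact this
  have := hall _ hr (n / K)
  rw [mul_comm, Int.emod_add_mul_ediv] at this
  exact this

theorem integral_exp_int (n : ℤ) :
    ∫ p in (0 : ℝ)..1, Complex.exp (2 * Real.pi * Complex.I * n * p) = if n = 0 then 1 else 0 := by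
  split_ifs with h
  · simp [h]
  · have hne : (2 * Real.pi * Complex.I * n : ℂ) ≠ 0 := by
      have : (n : ℂ) ≠ 0 := by exact_mod_cast h
      simp [this, Real.pi_ne_zero]
    rw [integral_exp_mul_complex hne]
    rw [show (2 * Real.pi * Complex.I * n * ((1 : ℝ) : ℂ) : ℂ) = n * (2 * Real.pi * Complex.I) by
      push_cast; ring, Complex.exp_int_mul_two_pi_mul_I]
    simp

open ComplexConjugate in
/-- Parseval's identity for two absolutely convergent trigonometric series whose frequencies lie
in residue classes modulo `K`. -/
theorem integral_conj_mul_trig {K : ℕ} (hK : 0 < K) {a b : ℤ → ℂ} (ha : Summable fun m => ‖a m‖)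
    (hb : Summable fun m => ‖b m‖) {ℓ ℓ' : ℕ} (hℓ : ℓ < K) (hℓ' : ℓ' < K) :
    ∫ p in (0 : ℝ)..1,
      conj (∑' m : ℤ, a m * Complex.exp (2 * Real.pi * Complex.I * (ℓ + m * K : ℤ) * p)) *
        (∑' m : ℤ, b m * Complex.exp (2 * Real.pi * Complex.I * (ℓ' + m * K : ℤ) * p)) =
      if ℓ = ℓ' then ∑' m : ℤ, conj (a m) * b m else 0 := by
  have hnorm : ∀ (n : ℤ) (p : ℝ), ‖Complex.exp (2 * Real.pi * Complex.I * n * p)‖ = 1 := by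
    intro n p
    rw [show (2 * Real.pi * Complex.I * n * p : ℂ) = ((2 * Real.pi * n * p : ℝ) : ℂ) * Complex.I by
      push_cast; ring, Complex.norm_exp_ofReal_mul_I]
  set F : ℤ × ℤ → ℝ → ℂ := fun i p => conj (a i.1) * b i.2 *
    Complex.exp (2 * Real.pi * Complex.I * ((ℓ' + i.2 * K : ℤ) - (ℓ + i.1 * K : ℤ) : ℤ) * p) with hF
  have hsum : ∀ p : ℝ, conj (∑' m : ℤ, a m * Complex.exp (2 * Real.pi * Complex.I *
      (ℓ + m * K : ℤ) * p)) * (∑' m : ℤ, b m * Complex.exp (2 * Real.pi * Complex.I *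
      (ℓ' + m * K : ℤ) * p)) = ∑' i, F i p := by
    intro p
    rw [Complex.conj_tsum, tsum_mul_tsum_of_summable_norm]
    · refine tsum_congr fun i => ?_
      simp only [hF, map_mul, ← Complex.exp_conj]
      rw [mul_mul_mul_comm, ← Complex.exp_add]
      congr 2
      simp [map_ofNat]
      ring
    · simpa only [RCLike.norm_conj, norm_mul, hnorm, mul_one] using ha
    · simpa only [norm_mul, hnorm, mul_one] using hb
  simp only [hsum]
  have hFint : ∀ i, MeasureTheory.Integrable (F i)
      (MeasureTheory.volume.restrict (Set.Ioc (0 : ℝ) 1)) := by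
    intro i
    have : Continuous (F i) := by simp only [hF]; fun_prop
    exact this.integrableOn_Ioc
  have hFs : Summable fun i => ∫ p in Set.Ioc (0 : ℝ) 1, ‖F i p‖ := by
    have : ∀ i, ∫ p in Set.Ioc (0 : ℝ) 1, ‖F i p‖ = ‖a i.1‖ * ‖b i.2‖ := by
      intro i
      simp only [hF, norm_mul, hnorm, RCLike.norm_conj, mul_one]
      simp
    simp only [this]
    exact ha.mul_of_nonneg hb (fun _ => norm_nonneg _) (fun _ => norm_nonneg _)
  have h1 := (MeasureTheory.hasSum_integral_of_summable_integral_norm hFint hFs).tsum_eq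
  rw [intervalIntegral.integral_of_le zero_le_one, ← h1]
  have h2 : ∀ i, ∫ p in Set.Ioc (0 : ℝ) 1, F i p =
      if (ℓ' + i.2 * K : ℤ) - (ℓ + i.1 * K : ℤ) = 0 then conj (a i.1) * b i.2 else 0 := by
    intro i
    rw [← intervalIntegral.integral_of_le zero_le_one]
    simp only [hF]
    rw [intervalIntegral.integral_const_mul, integral_exp_int, mul_ite, mul_one, mul_zero]
  simp only [h2]
  have hKz : (0 : ℤ) < K := by exact_mod_cast hK
  have h3 : ∀ i : ℤ × ℤ, (ℓ' + i.2 * K : ℤ) - (ℓ + i.1 * K : ℤ) = 0 ↔ ℓ = ℓ' ∧ i.1 = i.2 := by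
    intro i
    constructor
    · intro h
      have hd : (i.1 - i.2) * K = (ℓ' : ℤ) - ℓ := by linarith
      have : i.1 - i.2 = 0 := by
        by_contra hne
        rcases lt_or_gt_of_ne hne with hlt | hgt
        · nlinarith
        · nlinarith
      rw [this, zero_mul] at hd
      constructor <;> omega
    · rintro ⟨rfl, h⟩
      rw [h, sub_self]
  simp only [h3]
  split_ifs with h
  · simp only [h, true_and]
    rw [← Function.Injective.tsum_eq (g := fun m : ℤ => (m, m))
      (fun x y hxy => (Prod.mk.inj hxy).1)]
    · simp
    · intro i hi
      simp only [Function.mem_support, ne_eq, ite_eq_right_iff, not_forall] at hi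
      exact ⟨i.1, Prod.ext rfl hi.1⟩
  · simp [h]

/-- Unfolding of the Gaussian integral along the unit interval. -/
theorem integral_tsum_gaussian {c : ℝ} (hc : 0 < c) (s : ℝ) :
    ∫ q in (0 : ℝ)..1, ∑' m : ℤ, Real.exp (-c * (q + m + s) ^ 2) = √(Real.pi / c) := by
  have hg : MeasureTheory.Integrable (fun x : ℝ => Real.exp (-c * (x + s) ^ 2)) :=
    (integrable_exp_neg_mul_sq hc).comp_add_right s
  have h1 := hg.hasSum_intervalIntegral_comp_add_int
  have h2 : ∫ x : ℝ, Real.exp (-c * (x + s) ^ 2) = √(Real.pi / c) := by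
    rw [MeasureTheory.integral_add_right_eq_self (fun x : ℝ => Real.exp (-c * x ^ 2)),
      integral_gaussian]
  rw [h2] at h1
  have hF : ∀ m : ℤ, MeasureTheory.Integrable (fun q : ℝ => Real.exp (-c * (q + m + s) ^ 2))
      (MeasureTheory.volume.restrict (Set.Ioc (0 : ℝ) 1)) := fun m =>
    (by fun_prop : Continuous (fun q : ℝ => Real.exp (-c * (q + m + s) ^ 2))).integrableOn_Ioc
  have h3 := (MeasureTheory.hasSum_integral_of_summable_integral_norm hF (by
    simp only [Real.norm_eq_abs, Real.abs_exp]
    simpa only [intervalIntegral.integral_of_le (zero_le_one (α := ℝ))] using h1.summable)).tsum_eq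
  rw [intervalIntegral.integral_of_le zero_le_one, ← h3, ← h1.tsum_eq]
  simp only [intervalIntegral.integral_of_le (zero_le_one (α := ℝ))]

end

section

variable {E : Type*} [NormedAddCommGroup E] [NormedSpace ℝ E]
variable {δ : Type*} [NormedAddCommGroup δ] [InnerProductSpace ℂ δ]

/-! ### The scalar product of sections -/

section Inner

variable (P : PolarizedPlane E)

/-- The two integrations of the scalar product commute; the one in the direction of `e` is done
first in the computation of the norm of a theta series. -/
theorem sectionInner_swap (e f : E) {Ψ₁ Ψ₂ : E → δ} (h₁ : Continuous Ψ₁) (h₂ : Continuous Ψ₂) :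
    sectionInner P e f Ψ₁ Ψ₂ = ((|P.ω e f| : ℝ) : ℂ) * ∫ q in (0 : ℝ)..1, ∫ p in (0 : ℝ)..1,
      inner ℂ (Ψ₁ (p • e + q • f)) (Ψ₂ (p • e + q • f)) := by
  rw [sectionInner, MeasureTheory.intervalIntegral_intervalIntegral_swap]
  have hc : Continuous (Function.uncurry fun p q : ℝ =>
      inner ℂ (Ψ₁ (p • e + q • f)) (Ψ₂ (p • e + q • f))) := by
    unfold Function.uncurry
    fun_prop
  refine (hc.continuousOn.integrableOn_compact ((isCompact_uIcc (a := 0) (b := 1)).prod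
    (isCompact_uIcc (a := 0) (b := 1)))).mono_set ?_
  exact Set.prod_mono Set.uIoc_subset_uIcc Set.uIoc_subset_uIcc

theorem sectionInner_smul_right (e f : E) (c : ℂ) (Ψ₁ Ψ₂ : E → δ) :
    sectionInner P e f Ψ₁ (c • Ψ₂) = c * sectionInner P e f Ψ₁ Ψ₂ := by
  simp only [sectionInner, Pi.smul_apply, inner_smul_right, intervalIntegral.integral_const_mul]
  ring

open ComplexConjugate in
theorem sectionInner_smul_left (e f : E) (c : ℂ) (Ψ₁ Ψ₂ : E → δ) :
    sectionInner P e f (c • Ψ₁) Ψ₂ = conj c * sectionInner P e f Ψ₁ Ψ₂ := by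
  simp only [sectionInner, Pi.smul_apply, inner_smul_left, intervalIntegral.integral_const_mul]
  ring

theorem sectionInner_add_right (e f : E) {Ψ Ψ₁ Ψ₂ : E → δ} (h : Continuous Ψ)
    (h₁ : Continuous Ψ₁) (h₂ : Continuous Ψ₂) :
    sectionInner P e f Ψ (Ψ₁ + Ψ₂) = sectionInner P e f Ψ Ψ₁ + sectionInner P e f Ψ Ψ₂ := by
  have hc : ∀ Φ : E → δ, Continuous Φ → Continuous (Function.uncurry fun p q : ℝ =>
      inner ℂ (Ψ (p • e + q • f)) (Φ (p • e + q • f))) := by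
    intro Φ hΦ
    unfold Function.uncurry
    fun_prop
  simp only [sectionInner, Pi.add_apply, inner_add_right]
  rw [← mul_add, ← intervalIntegral.integral_add]
  · congr 1
    refine intervalIntegral.integral_congr fun p _ => ?_
    refine intervalIntegral.integral_add ?_ ?_ <;>
      exact Continuous.intervalIntegrable (by fun_prop) _ _
  · exact (intervalIntegral.continuous_parametric_intervalIntegral_of_continuous'
      (hc _ h₁) 0 1).intervalIntegrable _ _
  · exact (intervalIntegral.continuous_parametric_intervalIntegral_of_continuous'
      (hc _ h₂) 0 1).intervalIntegrable _ _

theorem sectionInner_sum_right (e f : E) {ι : Type*} (s : Finset ι) {Ψ : E → δ}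
    (h : Continuous Ψ) (c : ι → ℂ) (Φ : ι → E → δ) (hΦ : ∀ i, Continuous (Φ i)) :
    sectionInner P e f Ψ (∑ i ∈ s, c i • Φ i) = ∑ i ∈ s, c i * sectionInner P e f Ψ (Φ i) := by
  classical
  induction s using Finset.induction_on with
  | empty => simp [sectionInner]
  | insert a s ha ih =>
    rw [Finset.sum_insert ha, Finset.sum_insert ha, sectionInner_add_right P e f h
      ((hΦ a).const_smul (c a)) ?_, sectionInner_smul_right, ih]
    have : (∑ i ∈ s, c i • Φ i) = fun x => ∑ i ∈ s, c i • Φ i x := by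
      funext x; simp
    rw [this]
    exact continuous_finsetSum _ fun i _ => (hΦ i).const_smul (c i)

theorem sectionInner_sum_orthonormal {ι : Type*} [Fintype ι] [DecidableEq ι] (e f : E)
    {Ψ : ι → E → δ} (hΨ : ∀ i, Continuous (Ψ i))
    (ho : ∀ m n, sectionInner P e f (Ψ m) (Ψ n) = if m = n then 1 else 0) (c : ι → ℂ) (j : ι) :
    sectionInner P e f (Ψ j) (∑ i, c i • Ψ i) = c j := by
  rw [sectionInner_sum_right P e f _ (hΨ j) _ _ hΨ]
  simp [ho]

theorem linearIndependent_of_orthonormal {ι : Type*} [Fintype ι] [DecidableEq ι] (e f : E)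
    {Ψ : ι → E → δ} (hΨ : ∀ i, Continuous (Ψ i))
    (ho : ∀ m n, sectionInner P e f (Ψ m) (Ψ n) = if m = n then 1 else 0) :
    LinearIndependent ℂ Ψ := by
  rw [Fintype.linearIndependent_iff]
  intro c hc j
  rw [← sectionInner_sum_orthonormal P e f hΨ ho c j, hc]
  simp [sectionInner]

end Inner

/-! ### The theta basis of a quantum space -/

/-- The norm `(k / 2π)^{1/4}` of the normalized Lagrangian states. -/
def ampl (k : ℕ) : ℝ := ((k : ℝ) / (2 * Real.pi)) ^ (1 / 4 : ℝ)

theorem ampl_nonneg (k : ℕ) : 0 ≤ ampl k := Real.rpow_nonneg (by positivity) _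

theorem ampl_sq (k : ℕ) : ampl k ^ 2 = √(k / (2 * Real.pi)) := by
  rw [ampl, ← Real.rpow_natCast, ← Real.rpow_mul (by positivity), Real.sqrt_eq_rpow]
  norm_num

/-- The theta series, with values in the line spanned by `v`, that form a basis of the quantum space
of the lattice `ℤ e ⊕ ℤ f` when `ω(e, f) = 2πN`. They are indexed by `ℤ / Nk`; the choice of the
representative of the index is immaterial, by `thetaBasis_intCast`. -/
def thetaBasis (P : PolarizedPlane E) (k N : ℕ) (e f : E) (v : δ) :
    ZMod (N * k) → E → δ :=
  fun n x => ((ampl k : ℂ) * theta P k e f ((n.val : ℝ) / ((N : ℝ) * k)) x) • v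

section ThetaBasis

variable (P : PolarizedPlane E) {k N : ℕ} {e f : E} {v : δ}

theorem ne_zero_of_omega (hN : 0 < N) (hω : P.ω e f = 2 * Real.pi * N) :
    e ≠ 0 ∧ P.ω e f ≠ 0 := by
  have hN' : (0 : ℝ) < N := by exact_mod_cast hN
  have h : P.ω e f ≠ 0 := by rw [hω]; positivity
  refine ⟨?_, h⟩
  rintro rfl
  simp at h

theorem thetaBasis_intCast (hk : 0 < k) (hN : 0 < N) (n : ℤ) :
    thetaBasis P k N e f v (n : ZMod (N * k)) =
      fun x => ((ampl k : ℂ) * theta P k e f ((n : ℝ) / ((N : ℝ) * k)) x) • v := by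
  have : NeZero (N * k) := ⟨(Nat.mul_pos hN hk).ne'⟩
  funext x
  have h1 : (((n : ZMod (N * k)).val : ℤ)) = n % ((N * k : ℕ) : ℤ) := ZMod.val_intCast n
  have h2 := Int.emod_add_mul_ediv n ((N * k : ℕ) : ℤ)
  rw [← h1] at h2
  have h3 : (n : ℝ) = ((n : ZMod (N * k)).val : ℝ) + N * k * (n / ((N * k : ℕ) : ℤ) : ℤ) := by
    conv_lhs => rw [← h2]
    push_cast; ring
  have hN' : (0 : ℝ) < N := by exact_mod_cast hN
  have hk' : (0 : ℝ) < k := by exact_mod_cast hk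
  rw [thetaBasis, h3, add_div, mul_div_assoc]
  rw [show ((N : ℝ) * k) * ((n / ((N * k : ℕ) : ℤ) : ℤ) / ((N : ℝ) * k)) =
    ((n / ((N * k : ℕ) : ℤ) : ℤ) : ℝ) by field_simp, theta_add_int]

theorem continuous_thetaBasis (hk : 0 < k) (hN : 0 < N) (hω : P.ω e f = 2 * Real.pi * N)
    (n : ZMod (N * k)) : Continuous (thetaBasis P k N e f v n) := by
  obtain ⟨he, hef⟩ := ne_zero_of_omega P hN hω
  have := continuous_theta P he hk hef ((n.val : ℝ) / ((N : ℝ) * k))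
  unfold thetaBasis
  fun_prop

/-- In the coordinates of the lattice basis, a theta series is, up to a phase, a Fourier series in the
direction of `e` whose coefficients are Gaussian functions of the other coordinate. -/
theorem theta_apply_coordinates (hk : 0 < k) (hN : 0 < N) (hω : P.ω e f = 2 * Real.pi * N)
    (ℓ : ℕ) (p q : ℝ) :
    theta P k e f ((ℓ : ℝ) / ((N : ℝ) * k)) (p • e + q • f) =
      Complex.exp (((Real.pi * (N * k) * p * q : ℝ) : ℂ) * Complex.I) *
      ∑' m : ℤ, Complex.exp (Complex.I * Real.pi * (N * k) * P.coord e f *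
        ((q + m + (ℓ : ℝ) / ((N : ℝ) * k) : ℝ) : ℂ) ^ 2) *
        Complex.exp (2 * Real.pi * Complex.I * (ℓ + m * (N * k : ℕ) : ℤ) * p) := by
  obtain ⟨he, hef⟩ := ne_zero_of_omega P hN hω
  have hN' : (N : ℂ) ≠ 0 := by exact_mod_cast hN.ne'
  have hk' : (k : ℂ) ≠ 0 := by exact_mod_cast hk.ne'
  rw [theta, ← tsum_mul_left]
  refine tsum_congr fun m => ?_
  rw [lagr_smul P he, P.lineSection_pow, ← Complex.exp_add, ← Complex.exp_add, ← Complex.exp_add]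
  congr 1
  simp only [map_add, map_smul, P.coord_self he, P.ω_self, hω, smul_eq_mul, Complex.real_smul]
  push_cast
  field_simp
  ring

open ComplexConjugate in
/-- Parseval's identity in the direction of `e` and unfolding in the direction of `f` reduce the
scalar products to one Gaussian integral. -/
theorem thetaBasis_orthonormal (hk : 0 < k) (hN : 0 < N) (hω : P.ω e f = 2 * Real.pi * N)
    (hv : ‖v‖ ^ 4 = 2 / P.normSq e) (m n : ZMod (N * k)) :
    sectionInner P e f (thetaBasis P k N e f v m) (thetaBasis P k N e f v n) =
      if m = n then 1 else 0 := by
  have : NeZero (N * k) := ⟨(Nat.mul_pos hN hk).ne'⟩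
  obtain ⟨he, hef⟩ := ne_zero_of_omega P hN hω
  have hN' : (0 : ℝ) < N := by exact_mod_cast hN
  have hk' : (0 : ℝ) < k := by exact_mod_cast hk
  have hs := P.normSq_pos he
  have him : (P.coord e f).im = 2 * Real.pi * N / P.normSq e := by rw [P.coord_im, hω]
  set τ := P.coord e f with hτ
  -- the coefficients of the Fourier series in the direction of `e`
  set A : ℕ → ℝ → ℤ → ℂ := fun ℓ q m => Complex.exp (Complex.I * Real.pi * (N * k) * τ *
        ((q + m + (ℓ : ℝ) / ((N : ℝ) * k) : ℝ) : ℂ) ^ 2) with hA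
  have hAn : ∀ ℓ q m, ‖A ℓ q m‖ =
      Real.exp (-(Real.pi * (N * k) * τ.im) * (q + m + (ℓ : ℝ) / ((N : ℝ) * k)) ^ 2) := by
    intro ℓ q m
    simp only [hA]
    rw [Complex.norm_exp]
    congr 1
    rw [show Complex.I * Real.pi * (N * k) * τ *
        ((q + m + (ℓ : ℝ) / ((N : ℝ) * k) : ℝ) : ℂ) ^ 2 =
        ((Real.pi * (N * k) * (q + m + (ℓ : ℝ) / ((N : ℝ) * k)) ^ 2 : ℝ) : ℂ) * (Complex.I * τ) by
      push_cast; ring, Complex.re_ofReal_mul]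
    simp
    ring
  have hAs : ∀ ℓ q, Summable fun m => ‖A ℓ q m‖ := by
    intro ℓ q
    have h := (summable_lagr P he hk hef ((ℓ : ℝ) / ((N : ℝ) * k)) (q • f)).norm
    refine h.congr fun m => ?_
    rw [hAn, norm_lagr]
    congr 1
    simp only [map_smul, smul_eq_mul, hω, him]
    field_simp
    ring
  have hinner : ∀ q p : ℝ, inner ℂ (thetaBasis P k N e f v m (p • e + q • f))
      (thetaBasis P k N e f v n (p • e + q • f)) =
      ((ampl k ^ 2 * ‖v‖ ^ 2 : ℝ) : ℂ) * (conj (∑' i : ℤ, A m.val q i *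
        Complex.exp (2 * Real.pi * Complex.I * (m.val + i * (N * k : ℕ) : ℤ) * p)) *
        ∑' i : ℤ, A n.val q i *
        Complex.exp (2 * Real.pi * Complex.I * (n.val + i * (N * k : ℕ) : ℤ) * p)) := by
    intro q p
    set X : ℕ → ℂ := fun ℓ => ∑' i : ℤ, A ℓ q i *
        Complex.exp (2 * Real.pi * Complex.I * (ℓ + i * (N * k : ℕ) : ℤ) * p) with hX
    have hθ : ∀ ℓ : ℕ, theta P k e f ((ℓ : ℝ) / ((N : ℝ) * k)) (p • e + q • f) =
        Complex.exp (((Real.pi * (N * k) * p * q : ℝ) : ℂ) * Complex.I) * X ℓ :=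
      fun ℓ => theta_apply_coordinates P hk hN hω ℓ p q
    change _ = _ * (conj (X m.val) * X n.val)
    simp only [thetaBasis, hθ]
    rw [inner_smul_left, inner_smul_right, inner_self_eq_norm_sq_to_K, map_mul, map_mul,
      Complex.conj_ofReal]
    have h1 : conj (Complex.exp (((Real.pi * (N * k) * p * q : ℝ) : ℂ) * Complex.I)) *
        Complex.exp (((Real.pi * (N * k) * p * q : ℝ) : ℂ) * Complex.I) = 1 := by
      rw [← Complex.exp_conj, ← Complex.exp_add]
      simp
    push_cast at h1 ⊢
    linear_combination (ampl k * conj (X m.val) * (ampl k * X n.val) * ‖v‖ ^ 2) * h1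
  rw [sectionInner_swap P e f (continuous_thetaBasis P hk hN hω m)
    (continuous_thetaBasis P hk hN hω n)]
  simp only [hinner, intervalIntegral.integral_const_mul]
  simp only [integral_conj_mul_trig (Nat.mul_pos hN hk) (hAs _ _) (hAs _ _) (ZMod.val_lt m)
    (ZMod.val_lt n)]
  have hval : m.val = n.val ↔ m = n := ⟨fun h => ZMod.val_injective _ h, fun h => by rw [h]⟩
  simp only [hval]
  split_ifs with h
  · subst h
    have h2 : ∀ (q : ℝ), ∑' i : ℤ, conj (A m.val q i) * A m.val q i =
        ((∑' i : ℤ, Real.exp (-(2 * Real.pi * (N * k) * τ.im) *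
          (q + i + (m.val : ℝ) / ((N : ℝ) * k)) ^ 2) : ℝ) : ℂ) := by
      intro q
      rw [Complex.ofReal_tsum]
      refine tsum_congr fun i => ?_
      rw [mul_comm, Complex.mul_conj, Complex.normSq_eq_norm_sq, hAn, ← Real.exp_nat_mul]
      congr 2
      push_cast
      ring
    simp only [h2]
    rw [intervalIntegral.integral_ofReal, integral_tsum_gaussian (by rw [him]; positivity), hω,
      abs_of_pos (by positivity), ampl_sq]
    have hv2 : ‖v‖ ^ 2 = √(2 / P.normSq e) := by
      rw [← hv, show ‖v‖ ^ 4 = (‖v‖ ^ 2) ^ 2 by ring, Real.sqrt_sq (by positivity)]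
    rw [hv2, him]
    norm_cast
    rw [← Real.sqrt_mul (by positivity), ← Real.sqrt_mul (by positivity)]
    have h3 : (k : ℝ) / (2 * Real.pi) * (2 / P.normSq e) *
        (Real.pi / (2 * Real.pi * (N * k) * (2 * Real.pi * N / P.normSq e))) =
        (1 / (2 * Real.pi * N)) ^ 2 := by
      field_simp
    push_cast
    rw [h3, Real.sqrt_sq (by positivity)]
    field_simp
  · simp

end ThetaBasis

end

section

variable {E : Type*} [NormedAddCommGroup E] [NormedSpace ℝ E]
variable {δ : Type*} [NormedAddCommGroup δ] [InnerProductSpace ℂ δ]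

/-! ### Heisenberg bases of the quantum spaces -/

section Basis

variable (P : PolarizedPlane E) {k N : ℕ} {e f : E} {v : δ}

theorem pullback_thetaBasis_f (hk : 0 < k) (hN : 0 < N) (n : ZMod (N * k)) :
    pullback P k ((1 / ((N : ℝ) * k)) • f) (thetaBasis P k N e f v n) =
      thetaBasis P k N e f v (n + 1) := by
  have : NeZero (N * k) := ⟨(Nat.mul_pos hN hk).ne'⟩
  obtain ⟨m, rfl⟩ := ZMod.intCast_surjective n
  have h1 : (m : ZMod (N * k)) + 1 = ((m + 1 : ℤ) : ZMod (N * k)) := by push_cast; rfl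
  rw [h1, thetaBasis_intCast P hk hN, thetaBasis_intCast P hk hN, pullback_smul_vec]
  funext x
  congr 1
  have h2 := congrFun (pullback_smul P k ((1 / ((N : ℝ) * k)) • f) (ampl k : ℂ)
    (theta P k e f ((m : ℝ) / ((N : ℝ) * k)))) x
  simp only [pullback_theta_right, Pi.smul_apply, smul_eq_mul] at h2
  rw [show ((m + 1 : ℤ) : ℝ) / ((N : ℝ) * k) = (m : ℝ) / ((N : ℝ) * k) + 1 / ((N : ℝ) * k) by
    push_cast; ring, ← h2]
  rfl

theorem pullback_thetaBasis_smul_e (hk : 0 < k) (hN : 0 < N) (hω : P.ω e f = 2 * Real.pi * N)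
    (r : ℤ) (m : ℤ) :
    pullback P k (((r : ℝ) / ((N : ℝ) * k)) • e) (thetaBasis P k N e f v (m : ZMod (N * k))) =
      Complex.exp (2 * Complex.I * Real.pi * (r * m) / ((N : ℂ) * k)) •
        thetaBasis P k N e f v (m : ZMod (N * k)) := by
  obtain ⟨he, hef⟩ := ne_zero_of_omega P hN hω
  have hN' : (N : ℝ) ≠ 0 := by exact_mod_cast hN.ne'
  have hk' : (k : ℝ) ≠ 0 := by exact_mod_cast hk.ne'
  rw [thetaBasis_intCast P hk hN, pullback_smul_vec]
  funext x
  have h2 := congrFun (pullback_smul P k (((r : ℝ) / ((N : ℝ) * k)) • e) (ampl k : ℂ)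
    (theta P k e f ((m : ℝ) / ((N : ℝ) * k)))) x
  have h3 := pullback_theta_left P he k f ((m : ℝ) / ((N : ℝ) * k)) ((r : ℝ) / ((N : ℝ) * k)) r
    (by rw [hω]; field_simp)
  rw [h3] at h2
  change pullback P k _ ((ampl k : ℂ) • theta P k e f ((m : ℝ) / ((N : ℝ) * k))) x • v = _
  rw [h2]
  simp only [Pi.smul_apply, smul_eq_mul, smul_smul]
  rw [mul_left_comm]
  congr 3
  push_cast
  ring_nf

/-- Invariance under the lattice. The translations by `e` and by `f` fix the theta series; the
parity of `N` makes the cocycle trivial on the lattice. -/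
theorem pullback_lattice_thetaBasis (hk : 0 < k) (hN : 0 < N) (hNe : Even N)
    (hω : P.ω e f = 2 * Real.pi * N) (m n : ℤ) (i : ZMod (N * k)) :
    pullback P k ((m : ℝ) • e + (n : ℝ) • f) (thetaBasis P k N e f v i) =
      thetaBasis P k N e f v i := by
  have : NeZero (N * k) := ⟨(Nat.mul_pos hN hk).ne'⟩
  obtain ⟨i, rfl⟩ := ZMod.intCast_surjective i
  have hN' : (N : ℝ) ≠ 0 := by exact_mod_cast hN.ne'
  have hk' : (k : ℝ) ≠ 0 := by exact_mod_cast hk.ne'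
  have hN2 : (N : ℂ) ≠ 0 := by exact_mod_cast hN.ne'
  have hk2 : (k : ℂ) ≠ 0 := by exact_mod_cast hk.ne'
  have hf : ∀ n : ℤ, pullback P k ((n : ℝ) • f) (thetaBasis P k N e f v i) =
      thetaBasis P k N e f v i := by
    intro n
    rw [thetaBasis_intCast P hk hN, pullback_smul_vec]
    funext x
    have h2 := congrFun (pullback_smul P k ((n : ℝ) • f) (ampl k : ℂ)
      (theta P k e f ((i : ℝ) / ((N : ℝ) * k)))) x
    rw [pullback_theta_right, theta_add_int] at h2
    change pullback P k _ ((ampl k : ℂ) • theta P k e f ((i : ℝ) / ((N : ℝ) * k))) x • v = _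
    rw [h2]
    rfl
  have he : pullback P k ((m : ℝ) • e) (thetaBasis P k N e f v i) =
      thetaBasis P k N e f v i := by
    have h := pullback_thetaBasis_smul_e (v := v) P hk hN hω (m * (N * k)) i
    rw [show (((m * (N * k) : ℤ) : ℝ) / ((N : ℝ) * k)) = m by push_cast; field_simp] at h
    rw [h, show (2 * Complex.I * Real.pi * ((m * (N * k) : ℤ) * i) / ((N : ℂ) * k)) =
      ((m * i : ℤ) : ℂ) * (2 * Real.pi * Complex.I) by push_cast; field_simp,
      Complex.exp_int_mul_two_pi_mul_I, one_smul]
  have h := pullback_pullback P k ((m : ℝ) • e) ((n : ℝ) • f) (thetaBasis P k N e f v i)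
  rw [hf, he] at h
  obtain ⟨N', rfl⟩ := hNe
  have hph : Complex.exp (Complex.I * k / 2 * P.ω ((m : ℝ) • e) ((n : ℝ) • f)) = 1 := by
    simp only [map_smul, LinearMap.smul_apply, smul_eq_mul, hω]
    rw [Complex.exp_eq_one_iff]
    exact ⟨k * m * n * N', by push_cast; ring⟩
  rw [hph, one_smul] at h
  exact h.symm

theorem IsHolomorphicSection.clm_comp {F G : Type*} [NormedAddCommGroup F] [NormedSpace ℂ F]
    [NormedAddCommGroup G] [NormedSpace ℂ G] {Ψ : E → F} (h : IsHolomorphicSection P k Ψ)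
    (ψ : F →L[ℂ] G) : IsHolomorphicSection P k (fun x => ψ (Ψ x)) := by
  have hd : ∀ x, HasFDerivAt (fun x => ψ (Ψ x))
      ((ψ.restrictScalars ℝ).comp (fderiv ℝ Ψ x)) x := fun x =>
    (ψ.restrictScalars ℝ).hasFDerivAt.comp x (h.1 x).hasFDerivAt
  refine ⟨fun x => (hd x).differentiableAt, fun x w => ?_⟩
  have := congrArg ψ (h.2 x w)
  simp only [covDeriv, (hd x).fderiv, ContinuousLinearMap.comp_apply,
    ContinuousLinearMap.coe_restrictScalars', map_add, map_smul, map_zero] at this ⊢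
  exact this

theorem continuous_of_mem_quantumSpace {Ψ : E → δ} (h : Ψ ∈ quantumSpace P δ k e f) :
    Continuous Ψ := h.1.1.continuous

theorem exists_line_coordinate (hδ : Module.finrank ℂ δ = 1) :
    ∃ ψ : δ →L[ℂ] ℂ, Function.Injective ψ := by
  obtain ⟨v, hv0, hv⟩ := finrank_eq_one_iff'.1 hδ
  refine ⟨innerSL ℂ v, ?_⟩
  rw [injective_iff_map_eq_zero]
  intro x hx
  obtain ⟨c, rfl⟩ := hv x
  rw [innerSL_apply_apply, inner_smul_right, inner_self_eq_norm_sq_to_K] at hx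
  have : (c : ℂ) = 0 := by
    refine (mul_eq_zero.1 hx).resolve_right ?_
    simpa using hv0
  rw [this, zero_smul]

/-- A section of the quantum space vanishes as soon as `Nk` consecutive Fourier coefficients of its
restriction to `ℝ e` do. -/
theorem eq_zero_of_mem_quantumSpace (hk : 0 < k) (hN : 0 < N) (hω : P.ω e f = 2 * Real.pi * N)
    {ψ : δ →L[ℂ] ℂ} (hψ : Function.Injective ψ) {Ψ : E → δ} (hΨ : Ψ ∈ quantumSpace P δ k e f)
    (hc : ∀ n : Fin (N * k), ∫ x in (0 : ℝ)..1, ψ (Ψ (x • e)) *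
      Complex.exp (-2 * Real.pi * Complex.I * (n : ℕ) * x) = 0) : Ψ = 0 := by
  obtain ⟨he, hef⟩ := ne_zero_of_omega P hN hω
  obtain ⟨h, hh, hhΨ⟩ := exists_entire P he k (hΨ.1.clm_comp P ψ)
  have hline : ∀ w : ℂ, ∃ x, P.coord e x = w := by
    intro w
    refine ⟨w.re • e + w.im • P.j e, ?_⟩
    rw [map_add, map_smul, map_smul, P.coord_j, P.coord_self he]
    simp
  have hinv : ∀ (m n : ℤ) (x : E), h (P.coord e (((m : ℝ) • e + (n : ℝ) • f) + x)) *
      lagr P k e ((m : ℝ) • e + (n : ℝ) • f) x =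
      h (P.coord e x) * P.lineSection e x ^ k := by
    intro m n x
    have h1 := congrArg ψ (congrFun (hΨ.2 m n) x)
    simp only [pullback, map_smul, smul_eq_mul] at h1
    rw [hhΨ, hhΨ] at h1
    rw [lagr_apply]
    linear_combination h1
  have hzero : h = 0 := by
    refine entire_eq_zero_of_quasiperiodic hh ?_ (Nat.mul_pos hN hk) (τ := P.coord e f) ?_ ?_
    · intro w
      obtain ⟨x, rfl⟩ := hline w
      have h1 := hinv 1 0 x
      simp only [Int.cast_one, Int.cast_zero, zero_smul, add_zero] at h1
      rw [lagr_smul_self P he] at h1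
      have h2 := mul_right_cancel₀ (pow_ne_zero k (Complex.exp_ne_zero _)) h1
      rw [map_add, map_smul, P.coord_self he, one_smul] at h2
      rw [add_comm]; exact h2
    · intro w
      obtain ⟨x, rfl⟩ := hline w
      have h1 := hinv 0 1 x
      simp only [Int.cast_zero, zero_smul, zero_add] at h1
      rw [lagr_smul P he, Int.cast_one, one_smul, map_add] at h1
      have h0 : P.lineSection e x ^ k ≠ 0 := pow_ne_zero k (Complex.exp_ne_zero _)
      refine mul_right_cancel₀ h0 ?_
      rw [← h1, add_comm (P.coord e x)]
      rw [mul_assoc, mul_comm _ (P.lineSection e x ^ k)]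
      congr 3
      rw [hω]
      push_cast
      ring
    · intro n
      rw [← hc n]
      refine intervalIntegral.integral_congr fun x _ => ?_
      have h1 := hhΨ (x • e)
      rw [h1, P.lineSection_pow]
      simp [P.coord_self he, P.ω_self]
  funext x
  apply hψ
  have h1 := hhΨ x
  rw [hzero] at h1
  simpa using h1

/-- The first `Nk` Fourier coefficients along `e` embed the quantum space into `ℂ^{Nk}`. -/
theorem finrank_quantumSpace_le (hk : 0 < k) (hN : 0 < N) (hω : P.ω e f = 2 * Real.pi * N)
    (hδ : Module.finrank ℂ δ = 1) :
    FiniteDimensional ℂ (quantumSpace P δ k e f) ∧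
      Module.finrank ℂ (quantumSpace P δ k e f) ≤ N * k := by
  obtain ⟨ψ, hψ⟩ := exists_line_coordinate hδ
  have hint : ∀ (n : Fin (N * k)) (Ψ : quantumSpace P δ k e f), IntervalIntegrable
      (fun x : ℝ => ψ (Ψ.1 (x • e)) * Complex.exp (-2 * Real.pi * Complex.I * (n : ℕ) * x))
      MeasureTheory.volume 0 1 := by
    intro n Ψ
    have h1 := continuous_of_mem_quantumSpace P Ψ.2
    exact Continuous.intervalIntegrable (by fun_prop) _ _
  let T : quantumSpace P δ k e f →ₗ[ℂ] (Fin (N * k) → ℂ) :=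
    { toFun := fun Ψ n => ∫ x in (0 : ℝ)..1, ψ (Ψ.1 (x • e)) *
        Complex.exp (-2 * Real.pi * Complex.I * (n : ℕ) * x)
      map_add' := by
        intro Ψ₁ Ψ₂
        funext n
        rw [Pi.add_apply, ← intervalIntegral.integral_add (hint n Ψ₁) (hint n Ψ₂)]
        refine intervalIntegral.integral_congr fun x _ => ?_
        simp [add_mul]
      map_smul' := by
        intro c Ψ
        funext n
        rw [Pi.smul_apply, smul_eq_mul, RingHom.id_apply, ← intervalIntegral.integral_const_mul]
        refine intervalIntegral.integral_congr fun x _ => ?_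
        simp [mul_assoc] }
  have hT : Function.Injective T := by
    rw [injective_iff_map_eq_zero]
    intro Ψ hΨ
    exact Subtype.ext (eq_zero_of_mem_quantumSpace P hk hN hω hψ Ψ.2 fun n => congrFun hΨ n)
  refine ⟨FiniteDimensional.of_injective T hT, ?_⟩
  simpa using LinearMap.finrank_le_finrank_of_injective hT

/-- The theta series are `Nk` orthonormal elements of a space of dimension at most `Nk`. -/
theorem isHeisenbergBasis_thetaBasis (hk : 0 < k) (hN : 0 < N) (hNe : Even N)
    (hω : P.ω e f = 2 * Real.pi * N) (hδ : Module.finrank ℂ δ = 1)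
    (hv : ‖v‖ ^ 4 = 2 / P.normSq e) :
    IsHeisenbergBasis P k N e f (thetaBasis P k N e f v) := by
  have : NeZero (N * k) := ⟨(Nat.mul_pos hN hk).ne'⟩
  obtain ⟨he, hef⟩ := ne_zero_of_omega P hN hω
  have hort := thetaBasis_orthonormal P hk hN hω hv
  refine ⟨?_, hort, fun ℓ => ?_, pullback_thetaBasis_f P hk hN⟩
  · obtain ⟨hfd, hle⟩ := finrank_quantumSpace_le P hk hN hω hδ
    have hmem : ∀ i, thetaBasis P k N e f v i ∈ quantumSpace P δ k e f := by
      intro i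
      refine ⟨?_, fun m n => pullback_lattice_thetaBasis P hk hN hNe hω m n i⟩
      have h1 := isHolomorphicSection_theta P he hk hef ((i.val : ℝ) / ((N : ℝ) * k))
        ((ampl k : ℂ) • v)
      have h2 : thetaBasis P k N e f v i = fun x =>
          theta P k e f ((i.val : ℝ) / ((N : ℝ) * k)) x • ((ampl k : ℂ) • v) := by
        funext x
        rw [thetaBasis, smul_smul, mul_comm]
      rw [h2]; exact h1
    set B : ZMod (N * k) → quantumSpace P δ k e f := fun i => ⟨_, hmem i⟩ with hB
    have hli : LinearIndependent ℂ B := by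
      refine LinearIndependent.of_comp (quantumSpace P δ k e f).subtype ?_
      exact linearIndependent_of_orthonormal P e f (continuous_thetaBasis P hk hN hω) hort
    have hcard := hli.fintype_card_le_finrank
    rw [ZMod.card] at hcard
    have hspan := hli.span_eq_top_of_card_eq_finrank'
      (by rw [ZMod.card]; exact le_antisymm hcard hle)
    have h3 := congrArg (Submodule.map (quantumSpace P δ k e f).subtype) hspan
    rw [Submodule.map_span, ← Set.range_comp, Submodule.map_top, Submodule.range_subtype] at h3
    exact h3
  · have h := pullback_thetaBasis_smul_e (v := v) P hk hN hω 1 ℓ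
    simpa using h

/-- A Heisenberg basis is unique up to a common phase. -/
theorem IsHeisenbergBasis.eq_smul (hk : 0 < k) (hN : 0 < N) {Ψ ξ : ZMod (N * k) → E → δ}
    (hΨ : IsHeisenbergBasis P k N e f Ψ) (hξ : IsHeisenbergBasis P k N e f ξ) :
    ∃ u : ℂ, ‖u‖ = 1 ∧ ∀ ℓ, ξ ℓ = u • Ψ ℓ := by
  have : NeZero (N * k) := ⟨(Nat.mul_pos hN hk).ne'⟩
  have hN2 : (N : ℂ) ≠ 0 := by exact_mod_cast hN.ne'
  have hk2 : (k : ℂ) ≠ 0 := by exact_mod_cast hk.ne'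
  have hcont : ∀ i, Continuous (Ψ i) := fun i => continuous_of_mem_quantumSpace P
    (by rw [← hΨ.span_eq]; exact Submodule.subset_span ⟨i, rfl⟩)
  have hmem : ξ 0 ∈ Submodule.span ℂ (Set.range Ψ) := by
    rw [hΨ.span_eq, ← hξ.span_eq]; exact Submodule.subset_span ⟨0, rfl⟩
  obtain ⟨c, hc⟩ := (Submodule.mem_span_range_iff_exists_fun ℂ).1 hmem
  have hci : ∀ i, i ≠ 0 → c i = 0 := by
    intro i hi
    have h1 := hξ.pullback_e 0
    simp only [Int.cast_zero, mul_zero, zero_div, Complex.exp_zero, one_smul] at h1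
    rw [← hc, pullback_sum] at h1
    have h2 : ∀ i : ZMod (N * k), pullback P k ((1 / ((N : ℝ) * k)) • e) (c i • Ψ i) =
        (c i * Complex.exp (2 * Complex.I * Real.pi * i.val / ((N : ℂ) * k))) • Ψ i := by
      intro i
      rw [pullback_smul, mul_smul]
      congr 1
      have := hΨ.pullback_e i.val
      rw [Int.cast_natCast, ZMod.natCast_zmod_val] at this
      rw [this]
      push_cast
      rfl
    simp only [h2] at h1
    have h3 := sectionInner_sum_orthonormal P e f hcont hΨ.orthonormal
      (fun i => c i * Complex.exp (2 * Complex.I * Real.pi * i.val / ((N : ℂ) * k))) i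
    rw [h1, sectionInner_sum_orthonormal P e f hcont hΨ.orthonormal] at h3
    by_contra hne
    have h4 : Complex.exp (2 * Complex.I * Real.pi * i.val / ((N : ℂ) * k)) = 1 :=
      mul_left_cancel₀ hne (by rw [← h3, mul_one])
    rw [Complex.exp_eq_one_iff] at h4
    obtain ⟨n, hn⟩ := h4
    have hpi : (Real.pi : ℂ) ≠ 0 := by exact_mod_cast Real.pi_ne_zero
    have h5 : (i.val : ℂ) = n * (N * k) := by
      field_simp at hn
      linear_combination hn
    have h6 : (i.val : ℤ) = n * ((N * k : ℕ) : ℤ) := by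
      have : ((i.val : ℤ) : ℂ) = ((n * ((N * k : ℕ) : ℤ) : ℤ) : ℂ) := by push_cast; exact h5
      exact_mod_cast this
    have h7 : ((i.val : ℤ) : ZMod (N * k)) = 0 := by rw [h6]; push_cast; simp [← Nat.cast_mul]
    rw [Int.cast_natCast, ZMod.natCast_zmod_val] at h7
    exact hi h7
  have h0 : ξ 0 = c 0 • Ψ 0 := by
    rw [← hc]
    exact Finset.sum_eq_single 0 (fun i _ hi => by rw [hci i hi, zero_smul]) (by simp)
  refine ⟨c 0, ?_, fun ℓ => ?_⟩
  · have h1 := hξ.orthonormal 0 0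
    rw [h0, sectionInner_smul_left, sectionInner_smul_right, hΨ.orthonormal] at h1
    simp only [if_true, mul_one] at h1
    rw [mul_comm, Complex.mul_conj, Complex.normSq_eq_norm_sq] at h1
    have h2 : ‖c 0‖ ^ 2 = 1 := by exact_mod_cast h1
    exact (pow_eq_one_iff_of_nonneg (norm_nonneg _) two_ne_zero).1 h2
  · have key : ∀ n : ℕ, ξ (n : ZMod (N * k)) = c 0 • Ψ (n : ZMod (N * k)) := by
      intro n
      induction n with
      | zero => simpa using h0
      | succ n ih =>
        rw [Nat.cast_succ, ← hξ.pullback_f, ← hΨ.pullback_f, ih, pullback_smul]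
    have := key ℓ.val
    rwa [ZMod.natCast_zmod_val] at this

end Basis

end

section

variable {E : Type*} [NormedAddCommGroup E] [NormedSpace ℝ E]

/-! ### Poisson summation for theta series -/

theorem tsum_int_mod {g : ℤ → ℂ} (hg : Summable g) {K : ℕ} (hK : 0 < K) :
    ∑' n : ℤ, g n = ∑ r ∈ Finset.range K, ∑' m : ℤ, g (m * K + r) := by
  have : NeZero K := ⟨hK.ne'⟩
  have h1 := (Int.divModEquiv K).symm.tsum_eq g
  have hs : Summable fun p : ℤ × Fin K => g ((Int.divModEquiv K).symm p) :=
    (Int.divModEquiv K).symm.summable_iff.2 hg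
  rw [← h1, ← (Equiv.prodComm _ _).tsum_eq]
  have hs' := (Equiv.prodComm (Fin K) ℤ).summable_iff.2 hs
  rw [Finset.sum_range, ← tsum_fintype (L := .unconditional _)]
  exact hs'.tsum_prod

/-- Orthogonality of the characters of `ℤ / K`. -/
theorem sum_exp_int {K : ℕ} (hK : 0 < K) (m : ℤ) :
    ∑ n ∈ Finset.range K, Complex.exp (2 * Real.pi * Complex.I * (n * m) / K) =
      if (K : ℤ) ∣ m then (K : ℂ) else 0 := by
  have hK' : (K : ℂ) ≠ 0 := by exact_mod_cast hK.ne'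
  have hpi : (Real.pi : ℂ) ≠ 0 := by exact_mod_cast Real.pi_ne_zero
  have hterm : ∀ n : ℕ, Complex.exp (2 * Real.pi * Complex.I * (n * m) / K) =
      Complex.exp (2 * Real.pi * Complex.I * m / K) ^ n := by
    intro n
    rw [← Complex.exp_nat_mul]; congr 1; ring
  simp only [hterm]
  split_ifs with h
  · obtain ⟨j, rfl⟩ := h
    have : Complex.exp (2 * Real.pi * Complex.I * ((K : ℤ) * j : ℤ) / K) = 1 := by
      rw [Complex.exp_eq_one_iff]
      exact ⟨j, by push_cast; field_simp⟩
    simp only [this, one_pow, Finset.sum_const, Finset.card_range, nsmul_eq_mul, mul_one]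
  · have hne : Complex.exp (2 * Real.pi * Complex.I * m / K) ≠ 1 := by
      intro h1
      rw [Complex.exp_eq_one_iff] at h1
      obtain ⟨j, hj⟩ := h1
      apply h
      refine ⟨j, ?_⟩
      field_simp at hj
      have : ((m : ℤ) : ℂ) = ((K * j : ℤ) : ℂ) := by push_cast; linear_combination hj
      exact_mod_cast this
    rw [geom_sum_eq hne, ← Complex.exp_nat_mul]
    have : Complex.exp (K * (2 * Real.pi * Complex.I * m / K)) = 1 := by
      rw [Complex.exp_eq_one_iff]
      exact ⟨m, by field_simp⟩
    rw [this]
    simp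

theorem ofReal_mul_cpow {r : ℝ} (hr : 0 < r) {z : ℂ} (hz : z ≠ 0) (w : ℂ) :
    ((r : ℂ) * z) ^ w = (r : ℂ) ^ w * z ^ w := by
  have hr' : (r : ℂ) ≠ 0 := by exact_mod_cast hr.ne'
  rw [Complex.cpow_def_of_ne_zero (mul_ne_zero hr' hz), Complex.cpow_def_of_ne_zero hr',
    Complex.cpow_def_of_ne_zero hz, Complex.log_ofReal_mul hr hz, ← Complex.exp_add,
    Complex.ofReal_log hr.le]
  ring_nf

section

variable (P : PolarizedPlane E)

/-- The factor `(-i τ)^{-1/2}`, `τ = z_e(f)`, of the Poisson summation formula that exchanges the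
lines parallel to `e` and those parallel to `f`. -/
def poissonFactor (e f : E) : ℂ := 1 / (-Complex.I * P.coord e f) ^ (1 / 2 : ℂ)

theorem poissonFactor_sq {e f : E} (he : e ≠ 0) (hf : f ≠ 0) :
    poissonFactor P e f ^ 2 * (-Complex.I * P.coord e f) = 1 := by
  have h0 : -Complex.I * P.coord e f ≠ 0 :=
    mul_ne_zero (neg_ne_zero.2 Complex.I_ne_zero) (P.coord_ne_zero he hf)
  have h1 : ((-Complex.I * P.coord e f) ^ (1 / 2 : ℂ)) ^ 2 = -Complex.I * P.coord e f := by
    rw [← Complex.cpow_nat_mul]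
    norm_num
  rw [poissonFactor, div_pow, h1, one_pow, one_div, inv_mul_cancel₀ h0]

variable {k N : ℕ} {e f : E}

/-- The functional equation of Jacobi's theta function, in geometric form. -/
theorem theta_poisson_zero (hk : 0 < k) (hN : 0 < N) (hω : P.ω e f = 2 * Real.pi * N) :
    theta P k e ((1 / ((N : ℝ) * k)) • f) 0 =
      ((√((N : ℝ) * k) : ℝ) * poissonFactor P e f : ℂ) • theta P k f e 0 := by
  obtain ⟨he, hef⟩ := ne_zero_of_omega P hN hω
  have hf : f ≠ 0 := by rintro rfl; simp at hef
  have hN' : (N : ℂ) ≠ 0 := by exact_mod_cast hN.ne'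
  have hk' : (k : ℂ) ≠ 0 := by exact_mod_cast hk.ne'
  have hNr : (0 : ℝ) < N := by exact_mod_cast hN
  have hkr : (0 : ℝ) < k := by exact_mod_cast hk
  have hpi : (Real.pi : ℂ) ≠ 0 := by exact_mod_cast Real.pi_ne_zero
  have hτ0 : P.coord e f ≠ 0 := P.coord_ne_zero he hf
  funext x
  rw [Pi.smul_apply, smul_eq_mul, theta_eq_jacobiTheta₂ P he, theta_eq_jacobiTheta₂ P hf]
  simp only [map_smul, smul_eq_mul, hω, P.omega_swap f e, Complex.real_smul]
  have hcf : P.coord e x = P.coord f x * P.coord e f := P.coord_change hf x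
  have hcf' : P.coord f e = 1 / P.coord e f := by
    have := P.coord_change (e := e) hf e
    rw [P.coord_self he] at this
    rw [eq_div_iff hτ0, ← this]
  have ha1 : (k : ℂ) * ((1 / ((N : ℝ) * k) * (2 * Real.pi * N) : ℝ) : ℂ) / (2 * Real.pi) *
      (P.coord e x + ((0 : ℝ) : ℂ) * (((1 / ((N : ℝ) * k) : ℝ) : ℂ) * P.coord e f)) =
      P.coord e x := by
    push_cast; field_simp; ring
  have ha2 : (k : ℂ) * (((1 / ((N : ℝ) * k) : ℝ) : ℂ) * P.coord e f) *
      ((1 / ((N : ℝ) * k) * (2 * Real.pi * N) : ℝ) : ℂ) / (2 * Real.pi) =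
      P.coord e f / (N * k) := by
    push_cast; field_simp
  have hb1 : (k : ℂ) * ((-(2 * Real.pi * N) : ℝ) : ℂ) / (2 * Real.pi) *
      (P.coord f x + ((0 : ℝ) : ℂ) * P.coord f e) = -(P.coord e x / (P.coord e f / (N * k))) := by
    rw [hcf]; push_cast; field_simp; ring
  have hb2 : (k : ℂ) * P.coord f e * ((-(2 * Real.pi * N) : ℝ) : ℂ) / (2 * Real.pi) =
      -1 / (P.coord e f / (N * k)) := by
    rw [hcf']; push_cast; field_simp
  rw [ha1, ha2, hb1, hb2, jacobiTheta₂_neg_left, jacobiTheta₂_functional_equation]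
  have hsq : 1 / (-Complex.I * (P.coord e f / (N * k))) ^ (1 / 2 : ℂ) =
      ((√((N : ℝ) * k) : ℝ) : ℂ) * poissonFactor P e f := by
    have h1 : -Complex.I * (P.coord e f / (N * k)) =
        ((1 / ((N : ℝ) * k) : ℝ) : ℂ) * (-Complex.I * P.coord e f) := by
      push_cast; field_simp
    have h2 : (((1 / ((N : ℝ) * k) : ℝ) : ℂ)) ^ (1 / 2 : ℂ) =
        ((1 / √((N : ℝ) * k) : ℝ) : ℂ) := by
      rw [show (1 / 2 : ℂ) = ((1 / 2 : ℝ) : ℂ) by push_cast; rfl,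
        ← Complex.ofReal_cpow (by positivity), ← Real.sqrt_eq_rpow, Real.sqrt_div zero_le_one,
        Real.sqrt_one]
    have h3 : ((√((N : ℝ) * k) : ℝ) : ℂ) ≠ 0 := by
      exact_mod_cast (Real.sqrt_pos.2 (mul_pos hNr hkr)).ne'
    have h0 : -Complex.I * P.coord e f ≠ 0 := mul_ne_zero (neg_ne_zero.2 Complex.I_ne_zero) hτ0
    rw [h1, ofReal_mul_cpow (by positivity) h0, h2, poissonFactor]
    push_cast
    field_simp
  rw [hsq]
  have hexp : P.lineSection e x ^ k * Complex.exp (-Real.pi * Complex.I * P.coord e x ^ 2 /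
      (P.coord e f / (N * k))) = P.lineSection f x ^ k := by
    rw [P.lineSection_pow, P.lineSection_pow, ← Complex.exp_add]
    congr 1
    have h := P.omega_mul_coord he f x
    rw [hω] at h
    push_cast at h
    rw [hcf] at h ⊢
    have h' : (P.ω f x : ℂ) = P.ω e x * P.coord e f -
      P.coord f x * P.coord e f * (2 * Real.pi * N) := by linear_combination -h
    rw [h']
    field_simp
    ring
  rw [← hexp]
  simp only [Complex.ofReal_zero, mul_zero, zero_mul, ne_eq, OfNat.ofNat_ne_zero,
    not_false_eq_true, zero_pow, add_zero, Complex.exp_zero, one_mul]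
  ring

/-- A sum over a progression of step one is the sum over the `D` progressions of step `D`. -/
theorem theta_refine (he : e ≠ 0) (hk : 0 < k) {g : E} (hg : P.ω e g ≠ 0) {D : ℕ} (hD : 0 < D)
    (s : ℝ) : ∑ j ∈ Finset.range D, theta P k e ((D : ℝ) • g) ((s + j) / D) =
      theta P k e g s := by
  have hD' : (D : ℝ) ≠ 0 := by exact_mod_cast hD.ne'
  funext x
  rw [Finset.sum_apply, theta, tsum_int_mod (summable_lagr P he hk hg s x) hD]
  refine Finset.sum_congr rfl fun j _ => tsum_congr fun m => ?_
  rw [smul_smul]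
  congr 2
  push_cast
  field_simp
  ring

/-- Poisson summation: the finite Fourier transform of the theta series along the lines parallel
to `e` is the family of theta series along the lines parallel to `f`. -/
theorem theta_poisson (hk : 0 < k) (hN : 0 < N) (hω : P.ω e f = 2 * Real.pi * N) (n : ℤ) :
    ∑ ℓ ∈ Finset.range (N * k), Complex.exp (2 * Real.pi * Complex.I * (ℓ * n) / (N * k : ℕ)) •
      theta P k e f (ℓ / ((N : ℝ) * k)) =
      ((√((N : ℝ) * k) : ℝ) * poissonFactor P e f : ℂ) • theta P k f e (n / ((N : ℝ) * k)) := by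
  obtain ⟨he, hef⟩ := ne_zero_of_omega P hN hω
  have hNr : (N : ℝ) ≠ 0 := by exact_mod_cast hN.ne'
  have hkr : (k : ℝ) ≠ 0 := by exact_mod_cast hk.ne'
  have h1 := theta_refine P he hk (g := (1 / ((N : ℝ) * k)) • f)
    (by rw [map_smul, smul_eq_mul]; exact mul_ne_zero (by positivity) hef)
    (Nat.mul_pos hN hk) 0
  rw [theta_poisson_zero P hk hN hω, smul_smul, Nat.cast_mul, mul_one_div_cancel
    (mul_ne_zero hNr hkr), one_smul] at h1
  have h2 := congrArg (pullback P k (((n : ℝ) / ((N : ℝ) * k)) • e)) h1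
  rw [pullback_sum, pullback_smul, pullback_theta_right, zero_add] at h2
  rw [← h2]
  refine Finset.sum_congr rfl fun ℓ _ => ?_
  rw [zero_add, pullback_theta_left P he k f _ _ n (by rw [hω]; field_simp)]
  congr 2
  push_cast
  ring

/-- The inverse of the finite Fourier transform in `theta_poisson`. -/
theorem theta_inverse_poisson (hk : 0 < k) (hN : 0 < N) (hω : P.ω e f = 2 * Real.pi * N)
    {ℓ : ℕ} (hℓ : ℓ < N * k) :
    theta P k e f (ℓ / ((N : ℝ) * k)) = (poissonFactor P e f / (√((N : ℝ) * k) : ℝ) : ℂ) •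
      ∑ n ∈ Finset.range (N * k), Complex.exp (-(2 * Real.pi * Complex.I * (n * ℓ) / (N * k : ℕ))) •
        theta P k f e (n / ((N : ℝ) * k)) := by
  have hK : 0 < N * k := Nat.mul_pos hN hk
  have hKr : (0 : ℝ) < (N : ℝ) * k := by exact_mod_cast hK
  have hK' : ((N * k : ℕ) : ℂ) ≠ 0 := by exact_mod_cast hK.ne'
  have hs : ((√((N : ℝ) * k) : ℝ) : ℂ) ≠ 0 := by exact_mod_cast (Real.sqrt_pos.2 hKr).ne'
  have hs2 : ((√((N : ℝ) * k) : ℝ) : ℂ) * ((√((N : ℝ) * k) : ℝ) : ℂ) = (N * k : ℕ) := by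
    rw [← Complex.ofReal_mul, Real.mul_self_sqrt hKr.le]; push_cast; rfl
  have h1 : ((N * k : ℕ) : ℂ) • ((poissonFactor P e f / (√((N : ℝ) * k) : ℝ) : ℂ) •
      ∑ n ∈ Finset.range (N * k), Complex.exp (-(2 * Real.pi * Complex.I * (n * ℓ) / (N * k : ℕ))) •
        theta P k f e (n / ((N : ℝ) * k))) =
      ∑ n ∈ Finset.range (N * k), Complex.exp (-(2 * Real.pi * Complex.I * (n * ℓ) / (N * k : ℕ))) •
        ∑ ℓ' ∈ Finset.range (N * k),
          Complex.exp (2 * Real.pi * Complex.I * (ℓ' * n) / (N * k : ℕ)) •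
            theta P k e f (ℓ' / ((N : ℝ) * k)) := by
    rw [Finset.smul_sum, Finset.smul_sum]
    refine Finset.sum_congr rfl fun n _ => ?_
    have := theta_poisson P hk hN hω (n : ℤ)
    push_cast at this ⊢
    rw [this]
    simp only [smul_smul]
    congr 1
    rw [← Nat.cast_mul, ← hs2]
    field_simp
  have h2 : ∑ n ∈ Finset.range (N * k),
      Complex.exp (-(2 * Real.pi * Complex.I * (n * ℓ) / (N * k : ℕ))) •
        ∑ ℓ' ∈ Finset.range (N * k),
          Complex.exp (2 * Real.pi * Complex.I * (ℓ' * n) / (N * k : ℕ)) •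
            theta P k e f (ℓ' / ((N : ℝ) * k)) =
      ((N * k : ℕ) : ℂ) • theta P k e f (ℓ / ((N : ℝ) * k)) := by
    simp only [Finset.smul_sum, smul_smul, ← Complex.exp_add]
    rw [Finset.sum_comm]
    have h3 : ∀ ℓ' ∈ Finset.range (N * k), ∑ n ∈ Finset.range (N * k),
        Complex.exp (-(2 * Real.pi * Complex.I * (n * ℓ) / (N * k : ℕ)) +
          2 * Real.pi * Complex.I * (ℓ' * n) / (N * k : ℕ)) • theta P k e f (ℓ' / ((N : ℝ) * k)) =
        if ℓ' = ℓ then ((N * k : ℕ) : ℂ) • theta P k e f (ℓ' / ((N : ℝ) * k)) else 0 := by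
      intro ℓ' hℓ'
      rw [Finset.mem_range] at hℓ'
      rw [← Finset.sum_smul]
      have h4 := sum_exp_int hK ((ℓ' : ℤ) - ℓ)
      have h5 : ((N * k : ℕ) : ℤ) ∣ (ℓ' : ℤ) - ℓ ↔ ℓ' = ℓ := by
        constructor
        · intro hd
          have := Int.eq_zero_of_abs_lt_dvd hd (by rw [abs_lt]; constructor <;> omega)
          omega
        · rintro rfl; simp
      simp only [h5] at h4
      rw [show (∑ n ∈ Finset.range (N * k),
        Complex.exp (-(2 * Real.pi * Complex.I * (n * ℓ) / (N * k : ℕ)) +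
          2 * Real.pi * Complex.I * (ℓ' * n) / (N * k : ℕ))) = _ from
        (Finset.sum_congr rfl fun n _ => by congr 1; push_cast; ring).trans h4]
      split_ifs <;> simp
    rw [Finset.sum_congr rfl h3, Finset.sum_ite_eq' , if_pos (Finset.mem_range.2 hℓ)]
  rw [h2] at h1
  exact (smul_right_injective _ hK' h1).symm

end

end

section

/-! ### The colored Jones polynomials at roots of unity -/

/-- The power `q^r`, `q = exp(iπ/k)`. -/
def qpow (k : ℕ) (r : ℂ) : ℂ := Complex.exp (Complex.I * Real.pi * r / k)

theorem qpow_add (k : ℕ) (r s : ℂ) : qpow k (r + s) = qpow k r * qpow k s := by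
  rw [qpow, qpow, qpow, ← Complex.exp_add]; congr 1; ring

theorem qpow_zero (k : ℕ) : qpow k 0 = 1 := by simp [qpow]

theorem qpow_period {k : ℕ} (hk : 0 < k) (j : ℤ) : qpow k (2 * k * j) = 1 := by
  have hk' : (k : ℂ) ≠ 0 := by exact_mod_cast hk.ne'
  rw [qpow, Complex.exp_eq_one_iff]
  exact ⟨j, by field_simp⟩

theorem qpow_congr {k : ℕ} (hk : 0 < k) {r s : ℂ} (j : ℤ) (h : r = s + 2 * k * j) :
    qpow k r = qpow k s := by
  rw [h, qpow_add, qpow_period hk, mul_one]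

theorem norm_qpow (k : ℕ) (r : ℝ) : ‖qpow k r‖ = 1 := by
  rw [qpow, show Complex.I * Real.pi * r / k = ((Real.pi * r / k : ℝ) : ℂ) * Complex.I by
    push_cast; ring, Complex.norm_exp_ofReal_mul_I]

theorem sum_qpow {k : ℕ} (hk : 0 < k) (x : ℤ) :
    ∑ ℓ ∈ Finset.range (2 * k), qpow k (x * (ℓ + 2)) =
      if (2 * k : ℤ) ∣ x then (2 * k : ℂ) else 0 := by
  have hk' : (k : ℂ) ≠ 0 := by exact_mod_cast hk.ne'
  have h := sum_exp_int (K := 2 * k) (by omega) x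
  have h1 : ∀ ℓ : ℕ, qpow k (x * (ℓ + 2)) = qpow k (2 * x) *
      Complex.exp (2 * Real.pi * Complex.I * (ℓ * x) / (2 * k : ℕ)) := by
    intro ℓ
    rw [show (x : ℂ) * (ℓ + 2) = 2 * x + ℓ * x by ring, qpow_add]
    congr 1
    rw [qpow]; congr 1; push_cast; field_simp
  simp only [h1]
  rw [← Finset.mul_sum, h]
  push_cast
  split_ifs with hd
  · obtain ⟨j, hj⟩ := hd
    have : qpow k (2 * x) = 1 := by
      rw [hj, ← qpow_period hk (2 * j)]; congr 1; push_cast; ring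
    rw [this, one_mul]
  · rw [mul_zero]

/-- A sum over a period does not depend on its origin. -/
theorem sum_range_shift {g : ℤ → ℂ} {k : ℕ} (hg : ∀ s, g (s + k) = g s) (c : ℤ) :
    ∑ s ∈ Finset.range k, g (s + c) = ∑ s ∈ Finset.range k, g s := by
  have h1 : ∀ c : ℤ, ∑ s ∈ Finset.range k, g (s + (c + 1)) = ∑ s ∈ Finset.range k, g (s + c) := by
    intro c
    have h2 := Finset.sum_range_succ (fun s : ℕ => g (s + c)) k
    have h3 := Finset.sum_range_succ' (fun s : ℕ => g (s + c)) k
    rw [h2] at h3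
    have h4 : g (k + c) = g c := by rw [add_comm, hg]
    simp only [Nat.cast_zero, zero_add, h4] at h3
    have h5 := add_right_cancel h3
    rw [h5]
    refine Finset.sum_congr rfl fun s _ => ?_
    push_cast
    congr 1; ring
  induction c using Int.induction_on with
  | zero => simp
  | succ i ih => rw [h1, ih]
  | pred i ih =>
    have := h1 (-(i : ℤ) - 1)
    rw [sub_add_cancel] at this
    rw [← this, ih]

/-- The exponential `q^{(ab m² - 2(a + ε b) m + 2ε)/2}`, `ε = ±1`. -/
def jonesTerm (a b : ℕ) (k : ℕ) (ε : ℤ) (m : ℤ) : ℂ :=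
  qpow k (((a : ℂ) * b * m ^ 2 - 2 * (a + ε * b) * m + 2 * ε) / 2)

/-- The summand of index `m = 2r` of the Jones polynomial, up to the factors independent of `m`. -/
def jonesDiff (a b : ℕ) (k : ℕ) (m : ℤ) : ℂ := jonesTerm a b k 1 m - jonesTerm a b k (-1) m

theorem jonesTerm_add_period (a b : ℕ) {k : ℕ} (hk : 0 < k) (ε : ℤ) (m j : ℤ) :
    jonesTerm a b k ε (m + 2 * k * j) = jonesTerm a b k ε m :=
  qpow_congr hk (a * b * m * j + a * b * k * j ^ 2 - (a + ε * b) * j) (by push_cast; ring)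

theorem jonesDiff_add_period (a b : ℕ) {k : ℕ} (hk : 0 < k) (m j : ℤ) :
    jonesDiff a b k (m + 2 * k * j) = jonesDiff a b k m := by
  rw [jonesDiff, jonesTerm_add_period a b hk, jonesTerm_add_period a b hk, jonesDiff]

/-- The Gauss sums behind the periodicity of the colored Jones polynomials. If `a` is invertible
modulo `k`, a translation carries one of the two exponentials to the other; otherwise each of the
two sums vanishes. -/
theorem sum_jonesDiff {a b : ℕ} (hab : Nat.Coprime a b) {k : ℕ} (hk : 0 < k) (m₀ : ℤ) :
    ∑ s ∈ Finset.range k, jonesDiff a b k (m₀ + 2 * s) = 0 := by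
  have hk' : (k : ℂ) ≠ 0 := by exact_mod_cast hk.ne'
  have hper : ∀ ε s : ℤ, jonesTerm a b k ε (m₀ + 2 * (s + k)) = jonesTerm a b k ε (m₀ + 2 * s) := by
    intro ε s
    rw [← jonesTerm_add_period a b hk ε (m₀ + 2 * s) 1]; congr 1; ring
  simp only [jonesDiff, Finset.sum_sub_distrib]
  by_cases hg : Nat.gcd a k = 1
  · have hbez := Nat.gcd_eq_gcd_ab a k
    rw [hg] at hbez
    set c := Nat.gcdA a k
    set d := Nat.gcdB a k
    have hsh := sum_range_shift (g := fun s => jonesTerm a b k 1 (m₀ + 2 * s)) (hper 1) c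
    rw [sub_eq_zero, ← hsh]
    refine Finset.sum_congr rfl fun s _ => ?_
    have hd : (a : ℂ) * c = 1 - k * d := by
      have : ((1 : ℕ) : ℂ) = ((a * c + k * d : ℤ) : ℂ) := by rw [← hbez]; simp
      push_cast at this
      linear_combination -this
    refine qpow_congr hk (-(b * (m₀ + 2 * s) * d) - d * (b * c - 1)) ?_
    push_cast
    linear_combination (2 * b * (m₀ + 2 * s) + 2 * (b * c - 1)) * hd
  · have hpos : 0 < Nat.gcd a k := Nat.gcd_pos_of_pos_right _ hk
    obtain ⟨a', ha'⟩ := Nat.gcd_dvd_left a k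
    obtain ⟨k', hk'2⟩ := Nat.gcd_dvd_right a k
    set g := Nat.gcd a k with hgdef
    have hg' : (g : ℂ) ≠ 0 := by exact_mod_cast hpos.ne'
    have hkc : (k : ℂ) = g * k' := by exact_mod_cast hk'2
    have hac : (a : ℂ) = g * a' := by exact_mod_cast ha'
    have hk'0 : (k' : ℂ) ≠ 0 := by rintro h; rw [h, mul_zero] at hkc; exact hk' hkc
    have hzero : ∀ ε : ℤ, ε = 1 ∨ ε = -1 →
        ∑ s ∈ Finset.range k, jonesTerm a b k ε (m₀ + 2 * s) = 0 := by
      intro ε hε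
      have h1 := sum_range_shift (g := fun s => jonesTerm a b k ε (m₀ + 2 * s)) (hper ε) k'
      have h2 : ∀ s : ℕ, jonesTerm a b k ε (m₀ + 2 * (s + k')) =
          qpow k (-2 * ε * b * k') * jonesTerm a b k ε (m₀ + 2 * s) := by
        intro s
        rw [jonesTerm, jonesTerm, ← qpow_add]
        refine qpow_congr hk (a' * b * (m₀ + 2 * s) + a' * b * k' - a') ?_
        rw [hkc, hac]
        push_cast
        ring
      simp only [h2, ← Finset.mul_sum] at h1
      have hne : qpow k (-2 * ε * b * k') ≠ 1 := by
        intro h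
        rw [qpow, Complex.exp_eq_one_iff] at h
        obtain ⟨j, hj⟩ := h
        have hpi : (Real.pi : ℂ) ≠ 0 := by exact_mod_cast Real.pi_ne_zero
        rw [hkc] at hj
        field_simp at hj
        have h3 : (-(ε * b) : ℤ) = g * j := by
          have : ((-(ε * b) : ℤ) : ℂ) = ((g * j : ℤ) : ℂ) := by
            push_cast; linear_combination hj
          exact_mod_cast this
        have h4 : (g : ℤ) ∣ b := by
          rcases hε with rfl | rfl
          · exact ⟨-j, by linarith⟩
          · exact ⟨j, by linarith⟩
        have h5 : g ∣ b := by exact_mod_cast h4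
        have h6 : g ∣ Nat.gcd a b := Nat.dvd_gcd (Nat.gcd_dvd_left a k) h5
        rw [hab] at h6
        exact hg (Nat.dvd_one.1 h6)
      by_contra hS
      exact hne (mul_right_cancel₀ hS (by rw [h1, one_mul]))
    rw [hzero 1 (Or.inl rfl), hzero (-1) (Or.inr rfl), sub_zero]

theorem sum_jonesDiff_two_mul {a b : ℕ} (hab : Nat.Coprime a b) {k : ℕ} (hk : 0 < k) (m₀ : ℤ) :
    ∑ s ∈ Finset.range (2 * k), jonesDiff a b k (m₀ + 2 * s) = 0 := by
  rw [two_mul, Finset.sum_range_add, sum_jonesDiff hab hk, zero_add,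
    ← sum_jonesDiff hab hk (m₀ + 2 * k)]
  refine Finset.sum_congr rfl fun s _ => ?_
  congr 1; push_cast; ring

/-- The product of the Jones polynomial `J_ℓ(-exp(iπ/2k))` by `q - q⁻¹`. -/
def jonesNum (a b k ℓ : ℕ) : ℂ :=
  qpow k ((a : ℂ) * b * (1 - ℓ ^ 2) / 2) *
    ∑ s ∈ Finset.range ℓ, jonesDiff a b k (-((ℓ : ℤ) - 1) + 2 * s)

theorem zpow_eq_qpow {k : ℕ} (n j : ℤ) (h : n = 2 * j) :
    (-Complex.exp (Complex.I * Real.pi / (2 * (k : ℂ)))) ^ n = qpow k (n / 2) := by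
  subst h
  rw [zpow_mul, zpow_ofNat, neg_sq, ← Complex.exp_nat_mul, ← Complex.exp_int_mul, qpow]
  congr 1
  push_cast
  ring

/-- The normalizing factor of the knot state cancels the denominator of the Jones polynomial. This
needs `k ≥ 2`: for `k = 1` both vanish, and the quotient has the value `0`. -/
theorem jones_eq (a b : ℕ) {k : ℕ} (hk : 2 ≤ k) (ℓ : ℕ) :
    ((Real.sin (Real.pi / k) / √(k : ℝ) : ℝ) : ℂ) *
      jones a b ℓ (-Complex.exp (Complex.I * Real.pi / (2 * (k : ℂ)))) =
      1 / (2 * Complex.I * (√(k : ℝ) : ℝ)) * jonesNum a b k ℓ := by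
  have hk0 : (0 : ℝ) < k := by exact_mod_cast (by omega : 0 < k)
  have hkc : (k : ℂ) ≠ 0 := by exact_mod_cast hk0.ne'
  have hsin : (Real.sin (Real.pi / k) : ℂ) ≠ 0 := by
    have : 0 < Real.sin (Real.pi / k) := by
      apply Real.sin_pos_of_pos_of_lt_pi
      · positivity
      · rw [div_lt_iff₀ hk0]
        have : (2 : ℝ) ≤ k := by exact_mod_cast hk
        nlinarith [Real.pi_pos]
    exact_mod_cast this.ne'
  have hsq : ((√(k : ℝ) : ℝ) : ℂ) ≠ 0 := by exact_mod_cast (Real.sqrt_pos.2 hk0).ne'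
  set t : ℂ := -Complex.exp (Complex.I * Real.pi / (2 * (k : ℂ))) with ht
  have ht0 : t ≠ 0 := neg_ne_zero.2 (Complex.exp_ne_zero _)
  have hden : t ^ (2 : ℤ) - t ^ (-2 : ℤ) = 2 * Complex.I * Real.sin (Real.pi / k) := by
    rw [ht, zpow_eq_qpow 2 1 (by norm_num), zpow_eq_qpow (-2) (-1) (by norm_num), qpow, qpow]
    push_cast
    rw [Complex.sin]
    have h1 : Complex.I * Real.pi * (2 / 2) / k = Real.pi / k * Complex.I := by ring
    have h2 : Complex.I * Real.pi * (-2 / 2) / k = -(Real.pi / k) * Complex.I := by ring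
    rw [h1, h2]
    linear_combination (Complex.exp (Real.pi / k * Complex.I) -
      Complex.exp (-(Real.pi / k) * Complex.I)) * Complex.I_mul_I
  have hsum : t ^ ((a : ℤ) * b * (1 - (ℓ : ℤ) ^ 2)) * ∑ s ∈ Finset.range ℓ,
      t ^ ((a : ℤ) * b * (2 * (s : ℤ) - (ℓ - 1)) ^ 2) *
        (t ^ (-2 * ((a : ℤ) + b) * (2 * (s : ℤ) - (ℓ - 1)) + 2) -
          t ^ (-2 * ((a : ℤ) - b) * (2 * (s : ℤ) - (ℓ - 1)) - 2)) = jonesNum a b k ℓ := by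
    rw [jonesNum, Finset.mul_sum, Finset.mul_sum]
    refine Finset.sum_congr rfl fun s _ => ?_
    -- `1 - ℓ² + m²` is even for `m = 2s - (ℓ - 1)`, so that the sign of `t` disappears
    rw [mul_sub (t ^ ((a : ℤ) * b * (2 * (s : ℤ) - (ℓ - 1)) ^ 2)),
      mul_sub (t ^ ((a : ℤ) * b * (1 - (ℓ : ℤ) ^ 2))), ← zpow_add₀ ht0, ← zpow_add₀ ht0,
      ← zpow_add₀ ht0, ← zpow_add₀ ht0, jonesDiff, mul_sub (qpow k _), jonesTerm, jonesTerm, ← qpow_add, ← qpow_add]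
    congr 1
    · rw [ht, zpow_eq_qpow _ ((a : ℤ) * b * (1 - ℓ - 2 * s * (ℓ - 1) + 2 * s ^ 2) -
        (a + b) * (2 * s - (ℓ - 1)) + 1) (by ring)]
      congr 1
      push_cast
      ring
    · rw [ht, zpow_eq_qpow _ ((a : ℤ) * b * (1 - ℓ - 2 * s * (ℓ - 1) + 2 * s ^ 2) -
        (a - b) * (2 * s - (ℓ - 1)) - 1) (by ring)]
      congr 1
      push_cast
      ring
  rw [jones, hden, div_mul_eq_mul_div, hsum]
  push_cast at hsin ⊢
  field_simp

theorem jonesNum_zero (a b k : ℕ) : jonesNum a b k 0 = 0 := by simp [jonesNum]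

theorem jonesNum_reflect {a b : ℕ} (hab : Nat.Coprime a b) {k : ℕ} (hk : 0 < k) {ℓ : ℕ}
    (hℓ : ℓ ≤ 2 * k) : jonesNum a b k (2 * k - ℓ) = -jonesNum a b k ℓ := by
  have h1 := sum_jonesDiff_two_mul hab hk (-(((2 * k - ℓ : ℕ) : ℤ) - 1))
  have h2 : 2 * k = (2 * k - ℓ) + ℓ := by omega
  conv at h1 => lhs; rw [h2]
  rw [Finset.sum_range_add, Nat.add_sub_cancel] at h1
  have h3 : ∑ s ∈ Finset.range ℓ, jonesDiff a b k (-(((2 * k - ℓ : ℕ) : ℤ) - 1) +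
      2 * ((2 * k - ℓ + s : ℕ) : ℤ)) = ∑ s ∈ Finset.range ℓ,
      jonesDiff a b k (-((ℓ : ℤ) - 1) + 2 * s) := by
    refine Finset.sum_congr rfl fun s _ => ?_
    rw [← jonesDiff_add_period a b hk (-((ℓ : ℤ) - 1) + 2 * s) 1]
    congr 1
    push_cast [hℓ]
    ring
  rw [h3] at h1
  rw [jonesNum, eq_neg_of_add_eq_zero_left h1, jonesNum, mul_neg]
  congr 2
  refine qpow_congr hk (a * b * (ℓ - k)) ?_
  push_cast [hℓ]
  ring

theorem jonesNum_two_mul {a b : ℕ} (hab : Nat.Coprime a b) {k : ℕ} (hk : 0 < k) :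
    jonesNum a b k (2 * k) = 0 := by
  have := jonesNum_reflect hab hk (Nat.zero_le (2 * k))
  rwa [Nat.sub_zero, jonesNum_zero, neg_zero] at this

theorem jonesNum_two_mul_add_one {a b : ℕ} (hab : Nat.Coprime a b) {k : ℕ} (hk : 0 < k) :
    jonesNum a b k (2 * k + 1) = jonesNum a b k 1 := by
  rw [jonesNum, jonesNum, Finset.sum_range_succ, sum_jonesDiff_two_mul hab hk, zero_add,
    Finset.sum_range_one]
  congr 1
  · exact qpow_congr hk (-(a * b * (k + 1))) (by push_cast; ring)
  · rw [← jonesDiff_add_period a b hk _ 1]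
    rw [← jonesDiff_add_period a b hk (-(((1 : ℕ) : ℤ) - 1) + 2 * ((0 : ℕ) : ℤ)) 2]
    congr 1
    push_cast
    ring

/-- The frequencies `-ab ± b ± a` of the inhomogeneous term of the difference equation
`jonesNum_add_two`. -/
def jumpFreq (a b : ℕ) (ε : ℤˣ × ℤˣ) : ℤ := -((a : ℤ) * b) + ε.1 * b + ε.2 * a

/-- The exponent of `q` in the constant factor attached to the frequency `jumpFreq`. -/
def jumpExp (a b : ℕ) (ε : ℤˣ × ℤˣ) : ℤ := (a : ℤ) * b - ε.1 * b - ε.2 * a + ε.1 * ε.2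

theorem sum_intUnits (f : ℤˣ → ℂ) : ∑ ε, f ε = f 1 + f (-1) := by
  rw [show (Finset.univ : Finset ℤˣ) = {1, -1} from rfl, Finset.sum_pair (by decide)]

/-- The `q`-difference equation of the colored Jones polynomials of a torus knot. -/
theorem jonesNum_add_two (a b k ℓ : ℕ) : jonesNum a b k (ℓ + 2) =
    qpow k (-(2 * a * b * (ℓ + 1))) * jonesNum a b k ℓ +
      ∑ ε : ℤˣ × ℤˣ, ((ε.1 * ε.2 : ℤ) : ℂ) *
        qpow k ((ℓ + 2) * jumpFreq a b ε + jumpExp a b ε) := by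
  have h1 : ∑ s ∈ Finset.range (ℓ + 2), jonesDiff a b k (-(((ℓ + 2 : ℕ) : ℤ) - 1) + 2 * s) =
      jonesDiff a b k (-((ℓ : ℤ) + 1)) +
        ∑ s ∈ Finset.range ℓ, jonesDiff a b k (-((ℓ : ℤ) - 1) + 2 * s) +
        jonesDiff a b k ((ℓ : ℤ) + 1) := by
    rw [Finset.sum_range_succ, Finset.sum_range_succ', add_comm (∑ s ∈ Finset.range ℓ, _)]
    congr 1
    · congr 1
      · congr 1; push_cast; ring
      · refine Finset.sum_congr rfl fun s _ => ?_
        congr 1; push_cast; ring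
    · congr 1; push_cast; ring
  rw [jonesNum, h1, mul_add, mul_add, add_right_comm, add_comm]
  congr 1
  · rw [jonesNum, ← mul_assoc, ← qpow_add]
    congr 2
    push_cast
    ring
  · rw [Fintype.sum_prod_type]
    simp only [sum_intUnits, jonesDiff, jonesTerm, mul_add, mul_sub, ← qpow_add, jumpFreq, jumpExp]
    push_cast
    ring_nf

end

section

/-! ### The Fourier coefficients of the knot state -/

section Hat

variable (a b k : ℕ)

/-- Up to a constant factor, the coefficient of the knot state along `Ψ_n`. -/
def jonesHat (n : ℤ) : ℂ :=
  qpow k (-(n ^ 2 / (2 * a * b : ℕ))) *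
    ∑ ℓ ∈ Finset.range (2 * k), qpow k (-(n * ℓ)) * jonesNum a b k ℓ

variable {a b k}

/-- The coefficients `jonesHat` are `2ab`-periodic in `n`, except for jumps at the frequencies
`jumpFreq` modulo `2k`. -/
theorem jonesHat_sub (ha : 0 < a) (hb : 0 < b) (hab : Nat.Coprime a b) (hk : 0 < k) (n : ℤ) :
    jonesHat a b k n - jonesHat a b k (n + (2 * a * b : ℕ)) =
      ∑ ε : ℤˣ × ℤˣ, ((ε.1 * ε.2 : ℤ) : ℂ) *
        ((if (2 * k : ℤ) ∣ jumpFreq a b ε - n then (2 * k : ℂ) else 0) *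
          qpow k (jumpExp a b ε - n ^ 2 / (2 * a * b : ℕ))) := by
  have ha' : (a : ℂ) ≠ 0 := by exact_mod_cast ha.ne'
  have hb' : (b : ℂ) ≠ 0 := by exact_mod_cast hb.ne'
  have h1 : ∑ ℓ ∈ Finset.range (2 * k), qpow k (-(n * ℓ)) * jonesNum a b k ℓ =
      ∑ ℓ ∈ Finset.range (2 * k), qpow k (-(n * (ℓ + 2 : ℕ))) * jonesNum a b k (ℓ + 2) := by
    set h : ℕ → ℂ := fun ℓ => qpow k (-(n * ℓ)) * jonesNum a b k ℓ with hh
    have e1 := Finset.sum_range_add h (2 * k) 2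
    have e2 := Finset.sum_range_add h 2 (2 * k)
    rw [add_comm 2 (2 * k), e1] at e2
    have e3 : ∑ x ∈ Finset.range 2, h (2 * k + x) = ∑ x ∈ Finset.range 2, h x := by
      simp only [Finset.sum_range_succ, Finset.sum_range_zero, zero_add, hh, add_zero]
      rw [jonesNum_two_mul hab hk, jonesNum_zero, jonesNum_two_mul_add_one hab hk]
      have e5 : qpow k (-(n * ((2 * k + 1 : ℕ) : ℂ))) = qpow k (-(n * ((1 : ℕ) : ℂ))) :=
        qpow_congr hk (-n) (by push_cast; ring)
      rw [e5]
      simp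
    rw [e3, add_comm] at e2
    have e4 := add_left_cancel e2
    rw [e4]
    exact Finset.sum_congr rfl fun ℓ _ => by rw [add_comm 2 ℓ]
  rw [jonesHat, h1]
  simp only [jonesNum_add_two, mul_add (qpow k _), Finset.sum_add_distrib, Finset.mul_sum]
  have h2 : ∑ ℓ ∈ Finset.range (2 * k), qpow k (-(n ^ 2 / (2 * a * b : ℕ))) *
      (qpow k (-(n * (ℓ + 2 : ℕ))) * (qpow k (-(2 * a * b * (ℓ + 1))) * jonesNum a b k ℓ)) =
      jonesHat a b k (n + (2 * a * b : ℕ)) := by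
    rw [jonesHat, Finset.mul_sum]
    refine Finset.sum_congr rfl fun ℓ _ => ?_
    rw [← mul_assoc, ← mul_assoc, ← mul_assoc, ← qpow_add, ← qpow_add, ← qpow_add]
    congr 2
    push_cast
    field_simp
    ring
  rw [h2, add_sub_cancel_left, Finset.sum_comm]
  refine Finset.sum_congr rfl fun ε _ => ?_
  have h3 := sum_qpow hk (jumpFreq a b ε - n)
  rw [← h3, Finset.sum_mul, Finset.mul_sum]
  refine Finset.sum_congr rfl fun ℓ _ => ?_
  have h4 : qpow k (-(n ^ 2 / (2 * a * b : ℕ))) * (qpow k (-(n * (ℓ + 2 : ℕ))) *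
      qpow k ((ℓ + 2) * jumpFreq a b ε + jumpExp a b ε)) =
      qpow k ((jumpFreq a b ε - n : ℤ) * (ℓ + 2)) *
        qpow k (jumpExp a b ε - n ^ 2 / (2 * a * b : ℕ)) := by
    rw [← qpow_add, ← qpow_add, ← qpow_add]
    congr 1
    push_cast
    ring
  rw [← h4]
  ring

/-- The antisymmetry `ℓ ↦ 2k - ℓ` of the Jones polynomials makes `jonesHat` odd. -/
theorem jonesHat_neg (hab : Nat.Coprime a b) (hk : 0 < k) (n : ℤ) :
    jonesHat a b k (-n) = -jonesHat a b k n := by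
  have key : ∀ m : ℤ, ∑ ℓ ∈ Finset.range (2 * k), qpow k (-(m * ℓ)) * jonesNum a b k ℓ =
      ∑ ℓ ∈ Finset.range (2 * k + 1), qpow k (-(m * ℓ)) * jonesNum a b k ℓ := by
    intro m
    rw [Finset.sum_range_succ, jonesNum_two_mul hab hk, mul_zero, add_zero]
  rw [jonesHat, jonesHat, key, key, ← Finset.sum_range_reflect, ← mul_neg, ← Finset.sum_neg_distrib]
  congr 1
  · congr 1; push_cast; ring
  · refine Finset.sum_congr rfl fun ℓ hℓ => ?_
    rw [Finset.mem_range] at hℓ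
    have hle : ℓ ≤ 2 * k := by omega
    rw [Nat.add_sub_cancel, jonesNum_reflect hab hk hle, mul_neg]
    congr 2
    exact qpow_congr hk n (by push_cast [hle]; ring)

theorem jumpFreq_bounds (ε : ℤˣ × ℤˣ) :
    -(a * b : ℤ) - a - b ≤ jumpFreq a b ε ∧ jumpFreq a b ε ≤ -(a * b : ℤ) + a + b := by
  obtain ⟨e1, e2⟩ := ε
  rcases Int.units_eq_one_or e1 with rfl | rfl <;> rcases Int.units_eq_one_or e2 with rfl | rfl <;>
    simp [jumpFreq] <;> constructor <;> omega

/-- Between the jumps, `jonesHat` is `2ab`-periodic. -/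
theorem jonesHat_step (ha : 0 < a) (hb : 0 < b) (hab : Nat.Coprime a b) (hk : 0 < k) {n : ℤ}
    (h1 : -(a * b : ℤ) + a + b < n) (h2 : n < 2 * k - a * b - a - b) :
    jonesHat a b k (n + (2 * a * b : ℕ)) = jonesHat a b k n := by
  have h := jonesHat_sub ha hb hab hk n
  rw [Finset.sum_eq_zero] at h
  · exact (sub_eq_zero.1 h).symm
  · intro ε _
    rw [if_neg, zero_mul, mul_zero]
    rintro ⟨c, hc⟩
    have hb := jumpFreq_bounds (a := a) (b := b) ε
    have hk' : (0 : ℤ) < k := by exact_mod_cast hk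
    have hc1 : 2 * (k : ℤ) * c < 0 := by omega
    have hc2 : -(2 * (k : ℤ)) < 2 * k * c := by omega
    have hc3 : c < 0 := by nlinarith
    have hc4 : -1 < c := by nlinarith
    omega

variable [NeZero (2 * a * b)]

theorem stdAddChar_int (n : ℤ) : ZMod.stdAddChar (N := 2 * a * b) (n : ZMod (2 * a * b)) =
    Complex.exp (2 * Real.pi * Complex.I * n / (2 * a * b : ℕ)) := ZMod.stdAddChar_coe n

theorem jonesHat_add_period (hk : 0 < k) (n : ℤ) :
    jonesHat a b k (n + 2 * k) =
      ZMod.stdAddChar (N := 2 * a * b) ((-2 * (n + k) : ℤ) : ZMod (2 * a * b)) *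
        jonesHat a b k n := by
  have hk' : (k : ℂ) ≠ 0 := by exact_mod_cast hk.ne'
  have hD' : ((2 * a * b : ℕ) : ℂ) ≠ 0 := by exact_mod_cast NeZero.ne (2 * a * b)
  rw [stdAddChar_int, jonesHat, jonesHat, ← mul_assoc]
  congr 1
  · rw [qpow, qpow, ← Complex.exp_add]
    congr 1
    rw [Nat.cast_mul, Nat.cast_mul] at hD'
    push_cast
    field_simp
    ring
  · refine Finset.sum_congr rfl fun ℓ _ => ?_
    congr 1
    exact qpow_congr hk (-ℓ) (by push_cast; ring)

theorem jonesHat_reflect (hab : Nat.Coprime a b) (hk : 0 < k) (n : ℤ) :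
    jonesHat a b k (2 * k - n) =
      -(ZMod.stdAddChar (N := 2 * a * b) ((2 * (n - k) : ℤ) : ZMod (2 * a * b)) *
        jonesHat a b k n) := by
  have h := jonesHat_add_period (a := a) (b := b) hk (-n)
  rw [jonesHat_neg hab hk] at h
  rw [show 2 * (k : ℤ) - n = -n + 2 * k by ring, h,
    show -2 * (-n + (k : ℤ)) = 2 * (n - k) by ring]
  ring

/-! ### The periodic extension of the Fourier coefficients and its Fourier transform -/

theorem sum_zmod_eq_sum_range {D : ℕ} [NeZero D] (F : ZMod D → ℂ) (N : ℤ) :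
    ∑ y, F y = ∑ i ∈ Finset.range D, F ((N + i : ℤ) : ZMod D) := by
  rw [← Equiv.sum_comp (Equiv.addLeft (N : ZMod D)) F]
  symm
  refine Finset.sum_nbij' (fun i : ℕ => (i : ZMod D)) ZMod.val (fun _ _ => Finset.mem_univ _)
    (fun y _ => Finset.mem_range.2 (ZMod.val_lt y)) (fun i hi => ?_) (fun y _ => ?_) (fun i _ => ?_)
  · exact ZMod.val_cast_of_lt (Finset.mem_range.1 hi)
  · exact ZMod.natCast_zmod_val y
  · simp

variable (a b k) in
/-- The `2ab`-periodic sequence that coincides with `jonesHat` on the window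
`-ab + a + b < n < 2k + ab - a - b`. -/
def periodicHat (x : ZMod (2 * a * b)) : ℂ :=
  jonesHat a b k ((-(a * b : ℤ) + a + b + 1) +
    (x - ((-(a * b : ℤ) + a + b + 1 : ℤ) : ZMod (2 * a * b))).val)

theorem periodicHat_eq (ha : 0 < a) (hb : 0 < b) (hab : Nat.Coprime a b) (hk : 0 < k) {n : ℤ}
    (h1 : -(a * b : ℤ) + a + b < n) (h2 : n < 2 * k + a * b - a - b) :
    periodicHat a b k (n : ZMod (2 * a * b)) = jonesHat a b k n := by
  set n₀ : ℤ := -(a * b : ℤ) + a + b + 1 with hn₀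
  have hDpos : (0 : ℤ) < (2 * a * b : ℕ) := by exact_mod_cast NeZero.pos (2 * a * b)
  have hval : (((n : ZMod (2 * a * b)) - (n₀ : ZMod (2 * a * b))).val : ℤ) =
      (n - n₀) % ((2 * a * b : ℕ) : ℤ) := by
    rw [← Int.cast_sub, ZMod.val_intCast]
  rw [periodicHat, ← hn₀, hval]
  have hr := Int.emod_nonneg (n - n₀) hDpos.ne'
  obtain ⟨q, hq⟩ : ∃ q : ℕ, (n - n₀) / ((2 * a * b : ℕ) : ℤ) = q :=
    ⟨_, (Int.toNat_of_nonneg (Int.ediv_nonneg (by omega) hDpos.le)).symm⟩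
  have hdm := Int.emod_add_mul_ediv (n - n₀) ((2 * a * b : ℕ) : ℤ)
  rw [hq] at hdm
  set r := (n - n₀) % ((2 * a * b : ℕ) : ℤ)
  have key : ∀ i : ℕ, i ≤ q → jonesHat a b k (n₀ + r + (2 * a * b : ℕ) * i) =
      jonesHat a b k (n₀ + r) := by
    intro i
    induction i with
    | zero => intro _; simp
    | succ i ih =>
      intro hi
      have hpos : (0 : ℤ) ≤ (2 * a * b : ℕ) * i := by positivity
      have hmul : ((2 * a * b : ℕ) : ℤ) * (i + 1 : ℕ) ≤ (2 * a * b : ℕ) * q := by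
        have : ((i + 1 : ℕ) : ℤ) ≤ q := by exact_mod_cast hi
        exact mul_le_mul_of_nonneg_left this hDpos.le
      have hexp : ((2 * a * b : ℕ) : ℤ) * (i + 1 : ℕ) = (2 * a * b : ℕ) * i + (2 * a * b : ℕ) := by
        push_cast; ring
      have hDz : ((2 * a * b : ℕ) : ℤ) = 2 * (a * b) := by push_cast; ring
      rw [hexp, ← add_assoc, jonesHat_step ha hb hab hk (by linarith) (by linarith)]
      exact ih (by omega)
  rw [← key q le_rfl]
  congr 1
  linarith

variable (a b k) in
/-- The Fourier transform of `periodicHat`; up to a constant factor, the sequence `γ_ℓ(k)`. -/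
def gammaHat (x : ZMod (2 * a * b)) : ℂ :=
  1 / (2 * a * b : ℕ) * ∑ y : ZMod (2 * a * b), ZMod.stdAddChar (N := 2 * a * b) (-(y * x)) * periodicHat a b k y

/-- Fourier inversion on `ℤ / 2ab`. -/
theorem sum_gammaHat (y : ZMod (2 * a * b)) :
    ∑ x, gammaHat a b k x * ZMod.stdAddChar (N := 2 * a * b) (y * x) = periodicHat a b k y := by
  have hD' : ((2 * a * b : ℕ) : ℂ) ≠ 0 := by exact_mod_cast NeZero.ne (2 * a * b)
  have h1 : ∀ x : ZMod (2 * a * b), gammaHat a b k x * ZMod.stdAddChar (N := 2 * a * b) (y * x) =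
      1 / (2 * a * b : ℕ) * ∑ z : ZMod (2 * a * b), ZMod.stdAddChar (N := 2 * a * b) (x * (y - z)) *
        periodicHat a b k z := by
    intro x
    rw [gammaHat, mul_assoc, Finset.sum_mul]
    congr 1
    refine Finset.sum_congr rfl fun z _ => ?_
    rw [mul_right_comm, ← AddChar.map_add_eq_mul]
    congr 2
    ring
  simp only [h1]
  rw [← Finset.mul_sum, Finset.sum_comm]
  simp only [← Finset.sum_mul, AddChar.sum_mulShift _ (ZMod.isPrimitive_stdAddChar (2 * a * b)),
    sub_eq_zero, ZMod.card]
  simp only [ite_mul, zero_mul, Finset.sum_ite_eq, Finset.mem_univ, if_true, Nat.cast_ite,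
    Nat.cast_zero]
  field_simp

/-- Oddness of `jonesHat` and its quasi-period `2k` combine to a reflection of its window of
periodicity into itself, which is therefore a symmetry of `periodicHat`. -/
theorem periodicHat_reflect (ha : 0 < a) (hb : 0 < b) (hab : Nat.Coprime a b)
    (hk : a + b + 1 ≤ k) (x : ZMod (2 * a * b)) :
    periodicHat a b k (2 * k - x) =
      -(ZMod.stdAddChar (N := 2 * a * b) (2 * (x - k)) * periodicHat a b k x) := by
  set n₀ : ℤ := -(a * b : ℤ) + a + b + 1 with hn₀
  have hDz : ((2 * a * b : ℕ) : ℤ) = 2 * (a * b) := by push_cast; ring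
  obtain ⟨n, rfl, hn1, hn2⟩ : ∃ n : ℤ, (n : ZMod (2 * a * b)) = x ∧ n₀ ≤ n ∧
      n < n₀ + (2 * a * b : ℕ) := by
    refine ⟨n₀ + ((x - n₀ : ZMod (2 * a * b)).val : ℤ), ?_, by omega, ?_⟩
    · push_cast
      rw [ZMod.natCast_zmod_val]
      ring
    · have := ZMod.val_lt (x - n₀ : ZMod (2 * a * b))
      omega
  have h1 : (2 * (k : ZMod (2 * a * b)) - n) = ((2 * k - n : ℤ) : ZMod (2 * a * b)) := by
    push_cast; rfl
  rw [h1, periodicHat_eq ha hb hab (by omega) (by omega) (by omega),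
    periodicHat_eq ha hb hab (by omega) (by omega) (by omega), jonesHat_reflect hab (by omega)]
  push_cast
  rfl

theorem gammaHat_reflect (ha : 0 < a) (hb : 0 < b) (hab : Nat.Coprime a b)
    (hk : a + b + 1 ≤ k) (x : ZMod (2 * a * b)) :
    gammaHat a b k x = -(ZMod.stdAddChar (N := 2 * a * b) (-(2 * k * (x + 1))) * gammaHat a b k (-x - 2)) := by
  have h : ∑ y, ZMod.stdAddChar (N := 2 * a * b) (-(y * x)) * periodicHat a b k y =
      -(ZMod.stdAddChar (N := 2 * a * b) (-(2 * k * (x + 1))) *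
        ∑ y, ZMod.stdAddChar (N := 2 * a * b) (-(y * (-x - 2))) * periodicHat a b k y) := by
    rw [← Equiv.sum_comp (Equiv.subLeft (2 * k : ZMod (2 * a * b))), Finset.mul_sum,
      ← Finset.sum_neg_distrib]
    refine Finset.sum_congr rfl fun y _ => ?_
    rw [Equiv.subLeft_apply, periodicHat_reflect ha hb hab hk, mul_neg, ← mul_assoc, ← mul_assoc,
      ← AddChar.map_add_eq_mul, ← AddChar.map_add_eq_mul]
    congr 3
    ring
  rw [gammaHat, gammaHat, h]
  ring

variable (a b k) in
/-- Up to a constant factor, the inhomogeneity `β_ℓ(k)` of the recurrence for `γ_ℓ(k)`. -/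
def betaHat (x : ZMod (2 * a * b)) : ℂ :=
  gammaHat a b k x - ZMod.stdAddChar (N := 2 * a * b) (2 * k * (x - 1)) * gammaHat a b k (x - 2)

/-- The point `-1` is fixed by the symmetry of `gammaHat`, which acts there by a sign. -/
theorem gammaHat_neg_one (ha : 0 < a) (hb : 0 < b) (hab : Nat.Coprime a b)
    (hk : a + b + 1 ≤ k) : gammaHat a b k (-1) = 0 := by
  have h := gammaHat_reflect ha hb hab hk (-1)
  rw [show (-(2 * (k : ZMod (2 * a * b)) * (-1 + 1))) = 0 by ring, AddChar.map_zero_eq_one, one_mul,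
    show (-(-1) - 2 : ZMod (2 * a * b)) = -1 by ring] at h
  linear_combination h / 2

/-- The symmetry of `gammaHat` exchanges `0` and `-2`, and identifies the homogeneous term of the
recurrence at `0` with `-gammaHat 0`. -/
theorem gammaHat_zero (ha : 0 < a) (hb : 0 < b) (hab : Nat.Coprime a b)
    (hk : a + b + 1 ≤ k) : gammaHat a b k 0 = 1 / 2 * betaHat a b k 0 := by
  have h := gammaHat_reflect ha hb hab hk 0
  rw [betaHat]
  rw [show (-(2 * (k : ZMod (2 * a * b)) * (0 + 1))) = 2 * k * (0 - 1) by ring,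
    show (-0 - 2 : ZMod (2 * a * b)) = 0 - 2 by ring] at h
  linear_combination h / 2

/-- The two terms of `betaHat` are sums of `n ↦ χ(-nℓ) jonesHat n` over two intervals of length
`2ab`, whose difference telescopes to the jumps of `jonesHat`. -/
theorem betaHat_eq_sum_jumps (ha : 0 < a) (hb : 0 < b) (hab : Nat.Coprime a b)
    (hk : a + b + 1 ≤ k) (x : ZMod (2 * a * b)) :
    betaHat a b k x = -(2 * k / (2 * a * b : ℕ)) *
      qpow k (-((a : ℂ) ^ 2 + (b : ℂ) ^ 2) / (2 * a * b : ℕ) + (2 * a * b : ℕ) / 4) *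
      ∑ ε : ℤˣ × ℤˣ, ((ε.1 * ε.2 : ℤ) : ℂ) *
        ZMod.stdAddChar (N := 2 * a * b) (-((jumpFreq a b ε : ZMod (2 * a * b)) * x)) := by
  have ha' : (a : ℂ) ≠ 0 := by exact_mod_cast ha.ne'
  have hb' : (b : ℂ) ≠ 0 := by exact_mod_cast hb.ne'
  have hDz : ((2 * a * b : ℕ) : ℤ) = 2 * (a * b) := by push_cast; ring
  have hkpos : 0 < k := by omega
  set n₀ : ℤ := -(a * b : ℤ) + a + b + 1 with hn₀
  set n₁ : ℤ := -(a * b : ℤ) - a - b with hn₁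
  set g : ℤ → ℂ := fun n =>
    ZMod.stdAddChar (N := 2 * a * b) (-((n : ZMod (2 * a * b)) * x)) * jonesHat a b k n with hg
  set S : ℤ → ℂ := fun N => ∑ i ∈ Finset.range (2 * a * b), g (N + i) with hS
  have h1 : gammaHat a b k x = 1 / (2 * a * b : ℕ) * S n₀ := by
    rw [gammaHat, sum_zmod_eq_sum_range _ n₀]
    congr 1
    refine Finset.sum_congr rfl fun i hi => ?_
    rw [Finset.mem_range] at hi
    rw [periodicHat_eq ha hb hab hkpos (by omega) (by omega)]
  have h2 : ZMod.stdAddChar (N := 2 * a * b) (2 * k * (x - 1)) * gammaHat a b k (x - 2) =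
      1 / (2 * a * b : ℕ) * S n₁ := by
    rw [gammaHat, mul_left_comm, sum_zmod_eq_sum_range _ (n₁ + 2 * k), Finset.mul_sum]
    congr 1
    refine Finset.sum_congr rfl fun i hi => ?_
    rw [Finset.mem_range] at hi
    rw [show n₁ + 2 * (k : ℤ) + i = (n₁ + i) + 2 * k by ring,
      periodicHat_eq ha hb hab hkpos (by omega) (by omega), jonesHat_add_period hkpos,
      ← mul_assoc, ← mul_assoc, ← AddChar.map_add_eq_mul, ← AddChar.map_add_eq_mul]
    congr 2
    push_cast
    ring
  have h3 : ∀ N : ℤ, S (N + 1) - S N = ZMod.stdAddChar (N := 2 * a * b) (-((N : ZMod (2 * a * b)) * x)) *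
      (jonesHat a b k (N + (2 * a * b : ℕ)) - jonesHat a b k N) := by
    intro N
    have e1 := Finset.sum_range_succ (fun i : ℕ => g (N + i)) (2 * a * b)
    have e2 := Finset.sum_range_succ' (fun i : ℕ => g (N + i)) (2 * a * b)
    rw [e1] at e2
    have e3 : ∑ i ∈ Finset.range (2 * a * b), g (N + (i + 1 : ℕ)) = S (N + 1) :=
      Finset.sum_congr rfl fun i _ => by congr 1; push_cast; ring
    rw [e3] at e2
    have e4 : S (N + 1) - S N = g (N + (2 * a * b : ℕ)) - g N := by
      simp only [Nat.cast_zero, add_zero] at e2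
      linear_combination -e2
    rw [e4, hg]
    simp only
    have e5 : ((N + (2 * a * b : ℕ) : ℤ) : ZMod (2 * a * b)) = N := by
      rw [Int.cast_add, Int.cast_natCast, ZMod.natCast_self, add_zero]
    rw [e5]
    ring
  -- the interval from `n₁` to `n₀` contains all the jumps, each of them once
  have h4 : S n₀ - S n₁ = ∑ i ∈ Finset.range (2 * a + 2 * b + 1),
      (S (n₁ + (i + 1 : ℕ)) - S (n₁ + i)) := by
    rw [Finset.sum_range_sub (fun i : ℕ => S (n₁ + i))]
    congr 2
    · rw [hn₀, hn₁]; push_cast; ring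
    · simp
  have h5 : ∀ i ∈ Finset.range (2 * a + 2 * b + 1), S (n₁ + (i + 1 : ℕ)) - S (n₁ + i) =
      ∑ ε : ℤˣ × ℤˣ, if i = (jumpFreq a b ε - n₁).toNat then
        -(2 * k * qpow k (-((a : ℂ) ^ 2 + (b : ℂ) ^ 2) / (2 * a * b : ℕ) + (2 * a * b : ℕ) / 4) *
          (((ε.1 * ε.2 : ℤ) : ℂ) *
          ZMod.stdAddChar (N := 2 * a * b) (-((jumpFreq a b ε : ZMod (2 * a * b)) * x)))) else 0 := by
    intro i hi
    rw [Finset.mem_range] at hi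
    have e0 : n₁ + ((i + 1 : ℕ) : ℤ) = n₁ + i + 1 := by push_cast; ring
    rw [e0, h3, ← neg_sub, jonesHat_sub ha hb hab hkpos, mul_neg, Finset.mul_sum,
      ← Finset.sum_neg_distrib]
    refine Finset.sum_congr rfl fun ε _ => ?_
    have hbd := jumpFreq_bounds (a := a) (b := b) ε
    have hiff : (2 * k : ℤ) ∣ jumpFreq a b ε - (n₁ + i) ↔ i = (jumpFreq a b ε - n₁).toNat := by
      constructor
      · intro hd
        have := Int.eq_zero_of_abs_lt_dvd hd (by rw [abs_lt]; constructor <;> omega)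
        omega
      · intro h
        rw [show jumpFreq a b ε - (n₁ + i) = 0 by omega]
        exact dvd_zero _
    by_cases hi' : i = (jumpFreq a b ε - n₁).toNat
    · rw [if_pos (hiff.2 hi'), if_pos hi']
      have hN : n₁ + (i : ℤ) = jumpFreq a b ε := by omega
      rw [hN]
      have hexp : (jumpExp a b ε : ℂ) - (jumpFreq a b ε : ℂ) ^ 2 / (2 * a * b : ℕ) =
          -((a : ℂ) ^ 2 + (b : ℂ) ^ 2) / (2 * a * b : ℕ) + (2 * a * b : ℕ) / 4 := by
        have u1 : ((ε.1 : ℤ) : ℂ) ^ 2 = 1 := by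
          have : ((ε.1 : ℤ)) ^ 2 = 1 := by
            rcases Int.units_eq_one_or ε.1 with h | h <;> rw [h] <;> norm_num
          exact_mod_cast this
        have u2 : ((ε.2 : ℤ) : ℂ) ^ 2 = 1 := by
          have : ((ε.2 : ℤ)) ^ 2 = 1 := by
            rcases Int.units_eq_one_or ε.2 with h | h <;> rw [h] <;> norm_num
          exact_mod_cast this
        simp only [jumpExp, jumpFreq]
        push_cast
        field_simp
        linear_combination (-4 * b ^ 2 : ℂ) * u1 + (-4 * a ^ 2 : ℂ) * u2
      rw [hexp]
      ring
    · rw [if_neg (fun h => hi' (hiff.1 h)), if_neg hi']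
      simp
  rw [betaHat, h1, h2, ← mul_sub, h4, Finset.sum_congr rfl h5, Finset.sum_comm]
  have h6 : ∀ ε : ℤˣ × ℤˣ, (jumpFreq a b ε - n₁).toNat ∈ Finset.range (2 * a + 2 * b + 1) := by
    intro ε
    have hbd := jumpFreq_bounds (a := a) (b := b) ε
    rw [Finset.mem_range]
    omega
  simp only [Finset.sum_ite_eq', h6, if_true]
  rw [Finset.sum_neg_distrib, ← Finset.mul_sum]
  ring

/-- The four frequencies combine to a product of two sines. -/
theorem sum_jump_phases (ha : 0 < a) (hb : 0 < b) (ℓ : ℤ) :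
    ∑ ε : ℤˣ × ℤˣ, ((ε.1 * ε.2 : ℤ) : ℂ) *
        ZMod.stdAddChar (N := 2 * a * b) (-((jumpFreq a b ε : ZMod (2 * a * b)) * (ℓ : ZMod (2 * a * b)))) =
      -4 * ((-1) ^ ℓ *
        ((Real.sin (Real.pi * ℓ / a) * Real.sin (Real.pi * ℓ / b) : ℝ) : ℂ)) := by
  have ha' : (a : ℂ) ≠ 0 := by exact_mod_cast ha.ne'
  have hb' : (b : ℂ) ≠ 0 := by exact_mod_cast hb.ne'
  have h1 : ∀ ε : ℤˣ × ℤˣ,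
      ZMod.stdAddChar (N := 2 * a * b) (-((jumpFreq a b ε : ZMod (2 * a * b)) * (ℓ : ZMod (2 * a * b)))) =
      (-1) ^ ℓ * (Complex.exp (-(ε.1 : ℤ) * (Real.pi * ℓ / a) * Complex.I) *
        Complex.exp (-(ε.2 : ℤ) * (Real.pi * ℓ / b) * Complex.I)) := by
    intro ε
    rw [← Int.cast_mul, ← Int.cast_neg, stdAddChar_int, ← Complex.exp_pi_mul_I,
      ← Complex.exp_int_mul, ← Complex.exp_add, ← Complex.exp_add]
    congr 1
    simp only [jumpFreq]
    push_cast
    field_simp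
    ring
  simp only [h1]
  rw [Fintype.sum_prod_type]
  simp only [sum_intUnits]
  push_cast
  rw [Complex.sin, Complex.sin]
  simp only [neg_mul, one_mul, neg_neg]
  linear_combination ((-1) ^ ℓ * (Complex.exp (-(Real.pi * ℓ / a * Complex.I)) -
    Complex.exp (Real.pi * ℓ / a * Complex.I)) * (Complex.exp (-(Real.pi * ℓ / b * Complex.I)) -
    Complex.exp (Real.pi * ℓ / b * Complex.I)) : ℂ) * Complex.I_mul_I

end Hat

end

section

variable {E : Type*} [NormedAddCommGroup E] [NormedSpace ℝ E]
variable {δ : Type*} [NormedAddCommGroup δ] [InnerProductSpace ℂ δ]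

/-! ### Expansion of the knot state in the adapted basis -/

section Expansion

variable (P : PolarizedPlane E) {mu lam : E}

theorem sum_range_range {M : Type*} [AddCommMonoid M] (F : ℕ → M) (K D : ℕ) :
    ∑ n ∈ Finset.range K, ∑ j ∈ Finset.range D, F (n + K * j) =
      ∑ m ∈ Finset.range (K * D), F m := by
  rw [Finset.sum_comm]
  induction D with
  | zero => simp
  | succ D ih =>
    rw [Finset.sum_range_succ, ih, Nat.mul_succ, Finset.sum_range_add]
    congr 1
    exact Finset.sum_congr rfl fun n _ => by rw [add_comm]

theorem omega_adapted {D : ℕ} (hω : P.ω mu lam = 4 * Real.pi) :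
    P.ω (-lam) ((D : ℝ) • mu - (2 : ℝ) • lam) = 2 * Real.pi * (2 * D : ℕ) := by
  have h := P.omega_swap lam mu
  simp only [map_neg, map_sub, map_smul, LinearMap.neg_apply, smul_eq_mul, P.ω_self]
  push_cast
  rw [h, hω]
  ring

/-- The theta series along the lines parallel to `lam` attached to the translations by `Dμ` and by
`Dμ - 2 lam` differ by a quadratic phase. -/
theorem theta_shear {k D : ℕ} (hk : 0 < k) (hD : 0 < D) (hω : P.ω mu lam = 4 * Real.pi)
    (n : ℤ) :
    theta P k (-lam) ((D : ℝ) • mu - (2 : ℝ) • lam) (n / (((2 * D : ℕ) : ℝ) * k)) =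
      qpow k (n ^ 2 / D) • theta P k lam ((D : ℝ) • mu) (n / (((2 * D : ℕ) : ℝ) * k)) := by
  have hlam : lam ≠ 0 := by
    rintro rfl
    rw [map_zero] at hω
    linarith [Real.pi_pos]
  have hk' : (k : ℂ) ≠ 0 := by exact_mod_cast hk.ne'
  have hD' : (D : ℂ) ≠ 0 := by exact_mod_cast hD.ne'
  set s : ℝ := n / (((2 * D : ℕ) : ℝ) * k) with hs
  have hsC : (s : ℂ) = n / ((2 * D) * k) := by rw [hs]; push_cast; rfl
  funext x
  simp only [theta, Pi.smul_apply, smul_eq_mul]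
  rw [← tsum_mul_left]
  refine tsum_congr fun m => ?_
  have h1 : ((m : ℝ) + s) • ((D : ℝ) • mu - (2 : ℝ) • lam) =
      ((m : ℝ) + s) • (D : ℝ) • mu + (-(2 * ((m : ℝ) + s))) • lam := by
    module
  have h2 : (-lam : E) = (-1 : ℝ) • lam := by simp
  rw [h1, h2, lagr_smul_left P (by norm_num), lagr_add_smul_self P hlam, Pi.smul_apply,
    smul_eq_mul]
  congr 1
  -- the phase of the `m`-th summand depends on `m` only through an even multiple of `π`
  have h3 : qpow k (n ^ 2 / D) = qpow k (n ^ 2 / D + 2 * k * ((2 * (k * D * m ^ 2 + n * m) : ℤ))) :=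
    (qpow_congr hk _ rfl).symm
  rw [h3, qpow]
  congr 1
  simp only [map_smul, LinearMap.smul_apply, smul_eq_mul, hω]
  push_cast
  rw [hsC]
  field_simp
  ring

/-- Change of polarization from `μ` to `lam`, together with the refinement of the lattice from
`ℤ μ ⊕ ℤ lam` to `ℤ Dμ ⊕ ℤ lam`. -/
theorem theta_eq_sum_theta_adapted {k D : ℕ} (hk : 0 < k) (hD : 0 < D)
    (hω : P.ω mu lam = 4 * Real.pi) {ℓ : ℕ} (hℓ : ℓ < 2 * k) :
    theta P k mu lam (ℓ / (((2 : ℕ) : ℝ) * k)) =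
      (poissonFactor P mu lam / (√(2 * (k : ℝ)) : ℝ) : ℂ) • ∑ n ∈ Finset.range (2 * D * k),
        (qpow k (-(n ^ 2 / D)) * qpow k (-(n * ℓ))) •
          theta P k (-lam) ((D : ℝ) • mu - (2 : ℝ) • lam) (n / (((2 * D : ℕ) : ℝ) * k)) := by
  have hω2 : P.ω mu lam = 2 * Real.pi * (2 : ℕ) := by rw [hω]; push_cast; ring
  have hlam : lam ≠ 0 := by
    rintro rfl
    rw [map_zero] at hω
    linarith [Real.pi_pos]
  have hω' : P.ω lam mu ≠ 0 := by
    rw [P.omega_swap, hω]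
    linarith [Real.pi_pos]
  have hk' : (k : ℝ) ≠ 0 := by exact_mod_cast hk.ne'
  have hkC : (k : ℂ) ≠ 0 := by exact_mod_cast hk.ne'
  have hD' : (D : ℝ) ≠ 0 := by exact_mod_cast hD.ne'
  rw [theta_inverse_poisson P hk two_pos hω2 hℓ]
  have h0 : √(((2 : ℕ) : ℝ) * k) = √(2 * (k : ℝ)) := by norm_num
  rw [h0]
  congr 1
  rw [show 2 * D * k = (2 * k) * D by ring, ← sum_range_range _ (2 * k) D]
  refine Finset.sum_congr rfl fun n _ => ?_
  rw [← theta_refine P hlam hk hω' hD, Finset.smul_sum]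
  refine Finset.sum_congr rfl fun j _ => ?_
  have h := theta_shear P hk hD hω ((n + 2 * k * j : ℕ) : ℤ)
  rw [Int.cast_natCast, Int.cast_natCast] at h
  have h1 : qpow k (-(((n + 2 * k * j : ℕ) : ℂ) ^ 2 / D)) *
      qpow k (((n + 2 * k * j : ℕ) : ℂ) ^ 2 / D) = 1 := by
    rw [← qpow_add, neg_add_cancel, qpow_zero]
  rw [h, smul_smul, mul_right_comm (qpow k _), h1, one_mul]
  congr 1
  · have h2 : qpow k (-(((n + 2 * k * j : ℕ) : ℂ) * ℓ)) = qpow k (-(n * ℓ)) :=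
      qpow_congr hk (-(j * ℓ)) (by push_cast; ring)
    rw [h2, qpow]
    congr 1
    push_cast
    field_simp
  · congr 1
    push_cast
    field_simp

/-- The constant factor between `jonesHat` and the coefficients of the knot state: it collects
`sin(π/k) / √k`, the denominator of the Jones polynomial and the `1 / √(2k)` of the finite Fourier
transform. -/
def knotScale (k : ℕ) : ℂ := 1 / (2 * Complex.I * (√(k : ℝ) : ℝ) * (√(2 * (k : ℝ)) : ℝ))

/-- The coefficients of the knot state along the states `Ψ_n`. For `k = 1` the knot state is zero,
which the right-hand side need not be. -/
theorem knotState_eq_sum (a b : ℕ) (ha : 0 < a) (hb : 0 < b) {k : ℕ} (hk : 2 ≤ k)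
    (hω : P.ω mu lam = 4 * Real.pi) {ξ : ∀ k : ℕ, ZMod (2 * k) → E → δ} {v : δ} {u : ℂ}
    (hξ : ∀ ℓ, ξ k ℓ = u • thetaBasis P k 2 mu lam v ℓ) :
    knotState a b ξ k = ∑ n ∈ Finset.range (2 * (2 * a * b) * k),
      (knotScale k * jonesHat a b k n) • thetaBasis P k (2 * (2 * a * b)) (-lam)
        (((2 * a * b : ℕ) : ℝ) • mu - (2 : ℝ) • lam) (u • poissonFactor P mu lam • v)
        (n : ZMod (2 * (2 * a * b) * k)) := by
  have hk0 : 0 < k := by omega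
  have hD : 0 < 2 * a * b := by positivity
  funext x
  have h1 : ∀ ℓ ∈ Finset.range (2 * k), ((Real.sin (Real.pi / k) / √(k : ℝ) : ℝ) : ℂ) •
      (jones a b ℓ (-Complex.exp (Complex.I * Real.pi / (2 * (k : ℂ)))) •
        ξ k (ℓ : ZMod (2 * k)) x) = ∑ n ∈ Finset.range (2 * (2 * a * b) * k),
      (knotScale k * (qpow k (-(n ^ 2 / (2 * a * b : ℕ))) * (qpow k (-(n * ℓ)) *
        jonesNum a b k ℓ)) * (ampl k * theta P k (-lam)
        (((2 * a * b : ℕ) : ℝ) • mu - (2 : ℝ) • lam) (n / (((2 * (2 * a * b) : ℕ) : ℝ) * k)) x)) •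
        (u • poissonFactor P mu lam • v) := by
    intro ℓ hℓ
    have h2 := thetaBasis_intCast P (e := mu) (f := lam) (v := v) hk0 two_pos ℓ
    rw [Int.cast_natCast, Int.cast_natCast] at h2
    rw [smul_smul, jones_eq a b hk, hξ, h2,
      theta_eq_sum_theta_adapted P hk0 hD hω (Finset.mem_range.1 hℓ)]
    simp only [Pi.smul_apply, Finset.sum_apply, smul_smul, smul_eq_mul]
    rw [← Finset.sum_smul]
    congr 1
    simp only [Finset.mul_sum]
    refine Finset.sum_congr rfl fun n _ => ?_
    rw [knotScale, ← div_div]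
    ring
  simp only [knotState, Pi.smul_apply, Finset.sum_apply, Finset.smul_sum]
  rw [Finset.sum_congr rfl h1, Finset.sum_comm]
  refine Finset.sum_congr rfl fun n _ => ?_
  have h3 := thetaBasis_intCast P (N := 2 * (2 * a * b)) (e := -lam)
    (f := ((2 * a * b : ℕ) : ℝ) • mu - (2 : ℝ) • lam)
    (v := u • poissonFactor P mu lam • v) hk0 (by positivity) n
  rw [Int.cast_natCast, Int.cast_natCast] at h3
  rw [← Finset.sum_smul, h3, ← Finset.sum_mul, ← Finset.mul_sum, ← Finset.mul_sum, jonesHat,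
    Int.cast_natCast, smul_smul (knotScale k * _)]

variable {P}

/-- Poisson summation turns `Φ_ℓ` into a theta series along the lines parallel to `f`. -/
theorem fourierState_eq_theta {k D : ℕ} (hk : 0 < k) (hD : 0 < D) {e f : E}
    (hω : P.ω e f = 2 * Real.pi * (2 * D : ℕ)) (v : δ) (ℓ : ℤ) :
    fourierState D k (thetaBasis P k (2 * D) e f v) ℓ =
      fun x => (ampl k * theta P k f e (ℓ / D) x : ℂ) • (poissonFactor P e f • v) := by
  have hk' : (k : ℝ) ≠ 0 := by exact_mod_cast hk.ne'
  have hkC : (k : ℂ) ≠ 0 := by exact_mod_cast hk.ne'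
  have hD' : (D : ℝ) ≠ 0 := by exact_mod_cast hD.ne'
  have hDC : (D : ℂ) ≠ 0 := by exact_mod_cast hD.ne'
  have hs : √(2 * (k : ℝ) * D) ≠ 0 := (Real.sqrt_pos.2 (by positivity)).ne'
  have hsC : ((√(2 * (k : ℝ) * D) : ℝ) : ℂ) ≠ 0 := by exact_mod_cast hs
  funext x
  have h1 := congrFun (theta_poisson P hk (by positivity : 0 < 2 * D) hω (2 * k * ℓ)) x
  have h2 : ((2 * k * ℓ : ℤ) : ℝ) / (((2 * D : ℕ) : ℝ) * k) = ℓ / D := by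
    push_cast
    field_simp
  have h3 : √(((2 * D : ℕ) : ℝ) * k) = √(2 * (k : ℝ) * D) := by
    congr 1
    push_cast
    ring
  rw [h2, h3] at h1
  simp only [Finset.sum_apply, Pi.smul_apply, smul_eq_mul] at h1
  simp only [fourierState, Pi.smul_apply, Finset.sum_apply]
  have h4 : ∀ n ∈ Finset.range (2 * D * k), Complex.exp (2 * Complex.I * Real.pi * n * ℓ / (D : ℂ)) •
      thetaBasis P k (2 * D) e f v (n : ZMod (2 * D * k)) x =
      (ampl k * (Complex.exp (2 * Real.pi * Complex.I * (n * (2 * k * ℓ : ℤ)) / (2 * D * k : ℕ)) *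
        theta P k e f (n / (((2 * D : ℕ) : ℝ) * k)) x)) • v := by
    intro n _
    have h5 := thetaBasis_intCast P (N := 2 * D) (e := e) (f := f) (v := v) hk (by positivity) n
    rw [Int.cast_natCast, Int.cast_natCast] at h5
    rw [h5, smul_smul, mul_left_comm]
    congr 4
    push_cast
    field_simp
  rw [Finset.sum_congr rfl h4, ← Finset.sum_smul, ← Finset.mul_sum, h1, smul_smul, smul_smul]
  congr 1
  push_cast
  field_simp

/-- A combination of the states `Φ_ℓ` with `D`-periodic coefficients is a sum of Lagrangian states
over a family of parallel lines. -/
theorem sum_fourierState_eq_tsum {k D : ℕ} [NeZero D] (hk : 0 < k) {e f : E}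
    (hω : P.ω e f = 2 * Real.pi * (2 * D : ℕ)) (v : δ) (g : ZMod D → ℂ) (x : E) :
    (∑ ℓ ∈ Finset.range D, g (ℓ : ZMod D) •
      fourierState D k (thetaBasis P k (2 * D) e f v) ℓ) x =
      (ampl k * ∑' r : ℤ, g (r : ZMod D) * lagr P k f (((r : ℝ) / D) • e) x : ℂ) •
        (poissonFactor P e f • v) := by
  have hD : 0 < D := NeZero.pos D
  have hD' : (D : ℝ) ≠ 0 := by exact_mod_cast hD.ne'
  have hf : f ≠ 0 := by
    rintro rfl
    have : (0 : ℝ) < (2 * D : ℕ) := by exact_mod_cast (by positivity : 0 < 2 * D)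
    rw [map_zero] at hω
    have := Real.pi_pos
    have : 0 < 2 * Real.pi * (2 * D : ℕ) := by positivity
    linarith
  have hfe : P.ω f e ≠ 0 := by
    rw [P.omega_swap, neg_ne_zero]
    exact (ne_zero_of_omega P (by positivity) hω).2
  have hterm : ∀ (m : ℤ) (r : ℕ), (((m * D + r : ℤ) : ℝ) / D) • e = ((m : ℝ) + (r : ℝ) / D) • e := by
    intro m r
    congr 1
    push_cast
    field_simp
  have hg : ∀ (m : ℤ) (r : ℕ), g ((m * D + r : ℤ) : ZMod D) = g r := by
    intro m r
    congr 1
    push_cast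
    rw [ZMod.natCast_self, mul_zero, zero_add]
  have hsum : Summable fun r : ℤ => g (r : ZMod D) * lagr P k f (((r : ℝ) / D) • e) x := by
    have h0 : Summable fun r : ℤ => lagr P k f (((r : ℝ) / D) • e) x := by
      have h1 := summable_lagr P (g := (1 / (D : ℝ)) • e) hf hk
        (by rw [map_smul, smul_eq_mul]; exact mul_ne_zero (by positivity) hfe) 0 x
      refine h1.congr fun r => ?_
      rw [add_zero, smul_smul, mul_one_div]
    obtain ⟨B, hB⟩ : ∃ B : ℝ, ∀ y, ‖g y‖ ≤ B :=
      ⟨∑ y, ‖g y‖, fun y => Finset.single_le_sum (f := fun y => ‖g y‖)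
        (fun _ _ => norm_nonneg _) (Finset.mem_univ y)⟩
    refine Summable.of_norm_bounded (h0.norm.mul_left B) fun r => ?_
    rw [norm_mul]
    exact mul_le_mul_of_nonneg_right (hB _) (norm_nonneg _)
  rw [tsum_int_mod hsum hD]
  simp only [hterm, hg, tsum_mul_left]
  simp only [Finset.sum_apply, Pi.smul_apply, fourierState_eq_theta hk hD hω, theta, smul_smul,
    Int.cast_natCast]
  rw [← Finset.sum_smul, Finset.mul_sum, Finset.sum_mul]
  congr 1
  exact Finset.sum_congr rfl fun r _ => by ring

end Expansion

end

section

variable {E : Type*} [NormedAddCommGroup E] [NormedSpace ℝ E]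
variable {δ : Type*} [NormedAddCommGroup δ] [InnerProductSpace ℂ δ]

/-! ### Half-forms -/

namespace HalfFormLine

variable {P : PolarizedPlane E} (H : HalfFormLine P δ)

theorem φ_smul (c : ℂ) (v : δ) (x : E) :
    (H.φ ((c • v) ⊗ₜ[ℂ] (c • v)) : E →ₗ[ℝ] ℂ) x = c ^ 2 * (H.φ (v ⊗ₜ[ℂ] v) : E →ₗ[ℝ] ℂ) x := by
  rw [TensorProduct.smul_tmul_smul, map_smul, Submodule.coe_smul, LinearMap.smul_apply,
    smul_eq_mul, sq]

theorem φ_apply {e : E} (he : e ≠ 0) (v : δ) (x : E) :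
    (H.φ (v ⊗ₜ[ℂ] v) : E →ₗ[ℝ] ℂ) x = P.coord e x * (H.φ (v ⊗ₜ[ℂ] v) : E →ₗ[ℝ] ℂ) e :=
  P.canonicalLine_apply he (H.φ (v ⊗ₜ[ℂ] v)).2 x

/-- The metric of `δ`, in the normalization that makes the theta series orthonormal. -/
theorem norm_pow_four {e : E} (he : e ≠ 0) {v : δ}
    (hv : ‖(H.φ (v ⊗ₜ[ℂ] v) : E →ₗ[ℝ] ℂ) e‖ = 1) : ‖v‖ ^ 4 = 2 / P.normSq e := by
  have hs := P.normSq_pos he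
  have hs' : √(P.normSq e) ≠ 0 := (Real.sqrt_pos.2 hs).ne'
  have hsq : √(P.normSq e) ^ 2 = P.normSq e := Real.sq_sqrt hs.le
  set u : E := (1 / √(P.normSq e)) • e with hu
  have h1 : P.ω u (P.j u) = 1 := by
    have : P.ω e (P.j e) = √(P.normSq e) ^ 2 := by rw [hsq]; rfl
    rw [hu]
    simp only [map_smul, LinearMap.smul_apply, smul_eq_mul]
    rw [this]
    field_simp
  have h2 := H.isometry v v u h1
  have h3 : (H.φ (v ⊗ₜ[ℂ] v) : E →ₗ[ℝ] ℂ) (P.j u) =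
      Complex.I * (H.φ (v ⊗ₜ[ℂ] v) : E →ₗ[ℝ] ℂ) u := (H.φ (v ⊗ₜ[ℂ] v)).2 u
  rw [h3, norm_mul, Complex.norm_I, one_mul, hu, map_smul, norm_smul, hv, mul_one,
    Real.norm_of_nonneg (by positivity), div_pow, hsq] at h2
  calc ‖v‖ ^ 4 = (‖v‖ * ‖v‖) ^ 2 := by ring
    _ = 2 / P.normSq e := by rw [h2]; ring

/-- Multiplication by the factor of the Poisson summation formula turns a square root of the form
with value `1` at `e` into one of the form with value `i` at `f`. -/
theorem φ_poissonFactor {e f : E} (he : e ≠ 0) (hf : f ≠ 0) (v : δ) :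
    (H.φ ((poissonFactor P e f • v) ⊗ₜ[ℂ] (poissonFactor P e f • v)) : E →ₗ[ℝ] ℂ) f =
      Complex.I * (H.φ (v ⊗ₜ[ℂ] v) : E →ₗ[ℝ] ℂ) e := by
  have h := poissonFactor_sq P he hf
  rw [φ_smul, H.φ_apply he]
  linear_combination (Complex.I * (H.φ (v ⊗ₜ[ℂ] v) : E →ₗ[ℝ] ℂ) e) * h +
    (poissonFactor P e f ^ 2 * P.coord e f * (H.φ (v ⊗ₜ[ℂ] v) : E →ₗ[ℝ] ℂ) e) * Complex.I_sq

end HalfFormLine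

/-! ### Rapidly decreasing families -/

section Decay

variable {X F : Type*} [NormedAddCommGroup F]

/-- `ζ_k = O(k^{-∞})` uniformly on `V`. -/
def RapidlyDecreasing (V : Set X) (ζ : ℕ → X → F) : Prop :=
  ∀ M : ℕ, ∃ C : ℝ, ∀ k : ℕ, 0 < k → ∀ x ∈ V, ‖ζ k x‖ ≤ C / (k : ℝ) ^ M

theorem exists_pow_mul_exp_le {c : ℝ} (hc : 0 < c) (p : ℕ) :
    ∃ C : ℝ, ∀ k : ℕ, (k : ℝ) ^ p * Real.exp (-(c * k)) ≤ C := by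
  have h1 := (Real.tendsto_pow_mul_exp_neg_atTop_nhds_zero p).comp
    (tendsto_natCast_atTop_atTop.const_mul_atTop hc)
  obtain ⟨C, hC⟩ := h1.bddAbove_range
  refine ⟨C / c ^ p, fun k => ?_⟩
  have h2 : (c * k) ^ p * Real.exp (-(c * k)) ≤ C := hC ⟨k, rfl⟩
  rw [le_div_iff₀ (by positivity)]
  calc (k : ℝ) ^ p * Real.exp (-(c * k)) * c ^ p = (c * k) ^ p * Real.exp (-(c * k)) := by
        rw [mul_pow]; ring
    _ ≤ C := h2

/-- An exponential bound for large `k` is enough: the finitely many remaining terms are bounded on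
the compact set `V`. -/
theorem RapidlyDecreasing.of_exp [TopologicalSpace X] {V : Set X} (hV : IsCompact V)
    {ζ : ℕ → X → F} (hζ : ∀ k, 0 < k → Continuous (ζ k)) {B c : ℝ} {p K : ℕ} (hc : 0 < c)
    (hB : ∀ k, 0 < k → K ≤ k → ∀ x ∈ V, ‖ζ k x‖ ≤ B * k ^ p * Real.exp (-(c * k))) :
    RapidlyDecreasing V ζ := by
  intro M
  obtain ⟨C₁, hC₁⟩ := exists_pow_mul_exp_le hc (p + M)
  have hC₁0 : 0 ≤ C₁ := le_trans (by positivity) (hC₁ 1)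
  have h2 : ∀ k, ∃ C : ℝ, 0 ≤ C ∧ (0 < k → ∀ x ∈ V, ‖ζ k x‖ ≤ C) := by
    intro k
    by_cases hk : 0 < k
    · obtain ⟨C, hC⟩ := hV.exists_bound_of_continuousOn (hζ k hk).continuousOn
      exact ⟨max C 0, le_max_right _ _, fun _ x hx => (hC x hx).trans (le_max_left _ _)⟩
    · exact ⟨0, le_rfl, fun h => absurd h hk⟩
  choose C₂ hC₂0 hC₂ using h2
  have hsum : 0 ≤ ∑ k ∈ Finset.range K, C₂ k * (k : ℝ) ^ M :=
    Finset.sum_nonneg fun k _ => mul_nonneg (hC₂0 k) (by positivity)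
  refine ⟨|B| * C₁ + ∑ k ∈ Finset.range K, C₂ k * (k : ℝ) ^ M, fun k hk x hx => ?_⟩
  have hkM : (0 : ℝ) < (k : ℝ) ^ M := by positivity
  rw [le_div_iff₀ hkM]
  rcases lt_or_ge k K with h | h
  · have h3 := Finset.single_le_sum (f := fun k => C₂ k * (k : ℝ) ^ M)
      (fun k _ => mul_nonneg (hC₂0 k) (by positivity)) (Finset.mem_range.2 h)
    have h4 := mul_le_mul_of_nonneg_right (hC₂ k hk x hx) hkM.le
    have h5 : 0 ≤ |B| * C₁ := by positivity
    linarith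
  · have h3 := mul_le_mul_of_nonneg_right (hB k hk h x hx) hkM.le
    have h4 : B * k ^ p * Real.exp (-(c * k)) * k ^ M ≤ |B| * C₁ := by
      calc B * k ^ p * Real.exp (-(c * k)) * k ^ M
          = B * (k ^ (p + M) * Real.exp (-(c * k))) := by rw [pow_add]; ring
        _ ≤ |B| * (k ^ (p + M) * Real.exp (-(c * k))) :=
          mul_le_mul_of_nonneg_right (le_abs_self B) (by positivity)
        _ ≤ |B| * C₁ := mul_le_mul_of_nonneg_left (hC₁ k) (abs_nonneg B)
    linarith

theorem IsNegligible.of_exp {F : Type*} [NormedAddCommGroup F] [NormedSpace ℂ F] {u : ℕ → F}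
    {B c : ℝ} {p K : ℕ} (hc : 0 < c)
    (hB : ∀ k, 0 < k → K ≤ k → ‖u k‖ ≤ B * k ^ p * Real.exp (-(c * k))) : IsNegligible u := by
  intro M
  obtain ⟨C, hC⟩ := RapidlyDecreasing.of_exp (V := {()}) isCompact_singleton
    (ζ := fun k _ => u k) (fun _ _ => continuous_const) hc (fun k hk hK x _ => hB k hk hK) M
  exact ⟨C, fun k hk => hC k hk () rfl⟩

theorem RapidlyDecreasing.add {V : Set X} {ζ η : ℕ → X → F} (hζ : RapidlyDecreasing V ζ)
    (hη : RapidlyDecreasing V η) : RapidlyDecreasing V (ζ + η) := by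
  intro M
  obtain ⟨C, hC⟩ := hζ M
  obtain ⟨C', hC'⟩ := hη M
  refine ⟨C + C', fun k hk x hx => ?_⟩
  rw [add_div]
  exact (norm_add_le _ _).trans (add_le_add (hC k hk x hx) (hC' k hk x hx))

end Decay

/-! ### Gaussian estimates for theta series -/

theorem summable_exp_neg_mul_int_sq {c : ℝ} (hc : 0 < c) :
    Summable fun m : ℤ => Real.exp (-(c * (m : ℝ) ^ 2)) := by
  have h : 0 < (Complex.I * (c / Real.pi : ℝ)).im := by
    simp only [Complex.mul_im, Complex.I_re, Complex.I_im, Complex.ofReal_re, Complex.ofReal_im,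
      zero_mul, one_mul, zero_add]
    positivity
  refine ((summable_jacobiTheta₂_term_iff 0 _).2 h).norm.congr fun m => ?_
  rw [norm_jacobiTheta₂_term]
  congr 1
  simp only [Complex.mul_im, Complex.I_re, Complex.I_im, Complex.ofReal_re, Complex.ofReal_im,
    Complex.zero_im]
  field_simp
  ring

/-- A Gaussian sum over the integers at distance at least `ε` from `y` is exponentially small. -/
theorem norm_tsum_gaussian_le {κ : ℝ} (hκ : 0 < κ) (Y : ℝ) : ∃ C : ℝ, 0 ≤ C ∧
    ∀ k : ℕ, 0 < k → ∀ y : ℝ, |y| ≤ Y → ∀ ε B : ℝ, 0 ≤ ε → 0 ≤ B → ∀ F : ℤ → ℂ,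
      (∀ m, ‖F m‖ ≤ B * Real.exp (-(k * κ * (y - m) ^ 2))) → (∀ m, F m = 0 ∨ ε ≤ |y - m|) →
      ‖∑' m, F m‖ ≤ B * C * Real.exp (-(κ * ε ^ 2 / 2 * k)) := by
  have hsum := summable_exp_neg_mul_int_sq (c := κ / 4) (by positivity)
  refine ⟨Real.exp (κ * Y ^ 2 / 2) * ∑' m : ℤ, Real.exp (-(κ / 4 * (m : ℝ) ^ 2)),
    mul_nonneg (Real.exp_pos _).le (tsum_nonneg fun _ => (Real.exp_pos _).le), ?_⟩
  intro k hk y hy ε B hε hB F hF hF0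
  have hk1 : (1 : ℝ) ≤ k := by exact_mod_cast hk
  have key : ∀ m, ‖F m‖ ≤ B * Real.exp (-(κ * ε ^ 2 / 2 * k)) * Real.exp (κ * Y ^ 2 / 2) *
      Real.exp (-(κ / 4 * (m : ℝ) ^ 2)) := by
    intro m
    rcases hF0 m with h | h
    · rw [h, norm_zero]
      positivity
    · refine (hF m).trans ?_
      rw [mul_assoc B, mul_assoc B, ← Real.exp_add, ← Real.exp_add]
      refine mul_le_mul_of_nonneg_left (Real.exp_le_exp.2 ?_) hB
      have h1 : ε ^ 2 ≤ (y - m) ^ 2 := by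
        rw [← sq_abs (y - m)]
        exact pow_le_pow_left₀ hε h 2
      have h2 : y ^ 2 ≤ Y ^ 2 := by
        rw [← sq_abs y]
        exact pow_le_pow_left₀ (abs_nonneg y) hy 2
      have h3 : (m : ℝ) ^ 2 / 2 - y ^ 2 ≤ (y - m) ^ 2 := by nlinarith [sq_nonneg (2 * y - m)]
      have h4 : κ * (k * ε ^ 2) ≤ κ * (k * (y - m) ^ 2) :=
        mul_le_mul_of_nonneg_left (mul_le_mul_of_nonneg_left h1 (by positivity)) hκ.le
      have h5 : κ * ((y - m) ^ 2) ≤ κ * (k * (y - m) ^ 2) := by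
        refine mul_le_mul_of_nonneg_left ?_ hκ.le
        nlinarith [sq_nonneg (y - m)]
      have h6 : κ * ((m : ℝ) ^ 2 / 2 - Y ^ 2) ≤ κ * (y - m) ^ 2 :=
        mul_le_mul_of_nonneg_left (by linarith) hκ.le
      linarith
  refine (tsum_of_norm_bounded (hsum.mul_left _).hasSum key).trans (le_of_eq ?_)
  rw [tsum_mul_left]
  ring

section ThetaEstimates

variable (P : PolarizedPlane E)

/-- The rate of Gaussian decay of the terms of the theta series, as functions of the index. -/
def decayRate (e g : E) : ℝ := P.ω e g ^ 2 / (2 * P.normSq e)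

theorem decayRate_pos {e g : E} (he : e ≠ 0) (hg : P.ω e g ≠ 0) : 0 < decayRate P e g := by
  have := P.normSq_pos he
  unfold decayRate
  positivity

theorem norm_lagr_smul {e g : E} (hg : P.ω e g ≠ 0) (k : ℕ) (s : ℝ) (m : ℤ) (x : E) :
    ‖lagr P k e (((m : ℝ) + s) • g) x‖ =
      Real.exp (-(k * decayRate P e g * (-(P.ω e x / P.ω e g + s) - m) ^ 2)) := by
  rw [norm_lagr, decayRate, map_smul, smul_eq_mul]
  congr 1
  field_simp
  ring

/-- A theta series is exponentially small away from the lines on which it is concentrated. -/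
theorem norm_theta_le {e g : E} (he : e ≠ 0) (hg : P.ω e g ≠ 0) (Y : ℝ) : ∃ C : ℝ, 0 ≤ C ∧
    ∀ k : ℕ, 0 < k → ∀ (s ε : ℝ) (x : E), |P.ω e x / P.ω e g + s| ≤ Y → 0 ≤ ε →
      (∀ m : ℤ, ε ≤ |P.ω e x / P.ω e g + s + m|) →
      ‖theta P k e g s x‖ ≤ C * Real.exp (-(decayRate P e g * ε ^ 2 / 2 * k)) := by
  obtain ⟨C, hC0, hC⟩ := norm_tsum_gaussian_le (decayRate_pos P he hg) Y
  refine ⟨C, hC0, fun k hk s ε x hY hε hm => ?_⟩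
  have := hC k hk (-(P.ω e x / P.ω e g + s)) (by rwa [abs_neg]) ε 1 hε zero_le_one
    (fun m => lagr P k e (((m : ℝ) + s) • g) x)
    (fun m => by rw [norm_lagr_smul P hg, one_mul])
    (fun m => Or.inr (by rw [← abs_neg, neg_sub, sub_neg_eq_add, add_comm]; exact hm m))
  rwa [one_mul] at this

/-- At the origin, the only summand of the theta series that is not exponentially small is the one
of index `0`, whose value is `1`. -/
theorem norm_theta_zero_sub_one_le {e g : E} (he : e ≠ 0) (hg : P.ω e g ≠ 0) : ∃ C : ℝ, 0 ≤ C ∧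
    ∀ k : ℕ, 0 < k → ‖theta P k e g 0 0 - 1‖ ≤
      C * Real.exp (-(decayRate P e g / 2 * k)) := by
  obtain ⟨C, hC0, hC⟩ := norm_tsum_gaussian_le (decayRate_pos P he hg) 0
  refine ⟨C, hC0, fun k hk => ?_⟩
  have h0 : lagr P k e 0 0 = 1 := by simp [lagr_apply, PolarizedPlane.lineSection]
  have h1 : theta P k e g 0 0 - 1 =
      ∑' m : ℤ, if m = 0 then 0 else lagr P k e (((m : ℝ) + 0) • g) 0 := by
    have := (summable_lagr P he hk hg 0 0).tsum_eq_add_tsum_ite 0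
    rw [theta, this]
    simp [h0]
  have h2 := hC k hk 0 (by simp) 1 1 zero_le_one zero_le_one
    (fun m => if m = 0 then 0 else lagr P k e (((m : ℝ) + 0) • g) 0)
    (fun m => by
      split_ifs
      · rw [norm_zero]; positivity
      · rw [norm_lagr_smul P hg, one_mul]; simp)
    (fun m => by
      by_cases hm : m = 0
      · exact Or.inl (if_pos hm)
      · refine Or.inr ?_
        rw [zero_sub, abs_neg, ← Int.cast_abs]
        exact_mod_cast Int.one_le_abs hm)
  rw [h1]
  simpa using h2

/-- The part of a sum of Lagrangian states over parallel lines that comes from the lines that do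
not pass near `x` is exponentially small. -/
theorem norm_tsum_lagr_sub_le {D : ℕ} {f e : E} (hf : f ≠ 0) (he : P.ω f e ≠ 0) (hD : 0 < D)
    (Y : ℝ) : ∃ C : ℝ, 0 ≤ C ∧ ∀ k : ℕ, 0 < k → ∀ (x : E) (ε B : ℝ) (S : Finset ℤ) (g : ℤ → ℂ),
      |D * (P.ω f x / P.ω f e)| ≤ Y → 0 ≤ ε → (∀ r, ‖g r‖ ≤ B) →
      (∀ r : ℤ, r ∉ S → ε ≤ |D * (P.ω f x / P.ω f e) + r|) →
      ‖∑' r : ℤ, g r * lagr P k f (((r : ℝ) / D) • e) x -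
        ∑ r ∈ S, g r * lagr P k f (((r : ℝ) / D) • e) x‖ ≤
      B * C * Real.exp (-(decayRate P f ((1 / (D : ℝ)) • e) * ε ^ 2 / 2 * k)) := by
  have hD' : (D : ℝ) ≠ 0 := by exact_mod_cast hD.ne'
  have he' : P.ω f ((1 / (D : ℝ)) • e) ≠ 0 := by
    rw [map_smul, smul_eq_mul]
    exact mul_ne_zero (by positivity) he
  obtain ⟨C, hC0, hC⟩ := norm_tsum_gaussian_le (decayRate_pos P hf he') Y
  refine ⟨C, hC0, fun k hk x ε B S g hY hε hg hm => ?_⟩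
  have hB : 0 ≤ B := (norm_nonneg _).trans (hg 0)
  have hterm : ∀ r : ℤ, ((r : ℝ) / D) • e = ((r : ℝ) + 0) • (1 / (D : ℝ)) • e := by
    intro r
    rw [smul_smul, add_zero, mul_one_div]
  have hy : P.ω f x / P.ω f ((1 / (D : ℝ)) • e) = D * (P.ω f x / P.ω f e) := by
    rw [map_smul, smul_eq_mul]
    field_simp
  have hn : ∀ r : ℤ, ‖g r * lagr P k f (((r : ℝ) / D) • e) x‖ ≤
      B * Real.exp (-(k * decayRate P f ((1 / (D : ℝ)) • e) *
        (-(D * (P.ω f x / P.ω f e)) - r) ^ 2)) := by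
    intro r
    rw [norm_mul, hterm, norm_lagr_smul P he', hy, add_zero]
    exact mul_le_mul_of_nonneg_right (hg r) (Real.exp_pos _).le
  have hsum : Summable fun r : ℤ => g r * lagr P k f (((r : ℝ) / D) • e) x := by
    refine Summable.of_norm_bounded ((summable_lagr P hf hk he' 0 x).norm.mul_left B) fun r => ?_
    rw [norm_mul, hterm]
    exact mul_le_mul_of_nonneg_right (hg r) (norm_nonneg _)
  have hfin : Summable fun r : ℤ => if r ∈ S then g r * lagr P k f (((r : ℝ) / D) • e) x else 0 :=
    summable_of_ne_finset_zero (s := S) fun r hr => if_neg hr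
  have h1 : ∑ r ∈ S, g r * lagr P k f (((r : ℝ) / D) • e) x =
      ∑' r : ℤ, if r ∈ S then g r * lagr P k f (((r : ℝ) / D) • e) x else 0 := by
    rw [tsum_eq_sum (s := S) fun r hr => if_neg hr]
    exact Finset.sum_congr rfl fun r hr => (if_pos hr).symm
  rw [h1, ← hsum.tsum_sub hfin]
  refine hC k hk (-(D * (P.ω f x / P.ω f e))) (by rwa [abs_neg]) ε B hε hB _ (fun r => ?_)
    (fun r => ?_)
  · split_ifs
    · rw [sub_self, norm_zero]; positivity
    · rw [sub_zero]; exact hn r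
  · by_cases hr : r ∈ S
    · exact Or.inl (by rw [if_pos hr, sub_self])
    · refine Or.inr ((hm r hr).trans (le_of_eq ?_))
      rw [← abs_neg]
      congr 1
      ring

end ThetaEstimates

theorem ampl_le {k : ℕ} (hk : 0 < k) : ampl k ≤ k := by
  have hk1 : (1 : ℝ) ≤ k := by exact_mod_cast hk
  have h1 : (k : ℝ) / (2 * Real.pi) ≤ k :=
    div_le_self (by linarith) (by linarith [Real.two_le_pi])
  calc ampl k ≤ (k : ℝ) ^ (1 / 4 : ℝ) :=
        Real.rpow_le_rpow (by positivity) h1 (by norm_num)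
    _ ≤ (k : ℝ) ^ (1 : ℝ) := Real.rpow_le_rpow_of_exponent_le hk1 (by norm_num)
    _ = k := Real.rpow_one _

/-- A phase that rotates `z` onto the positive half-line is as close to `1` as `z` is. -/
theorem norm_sub_one_le_of_mul_nonneg {u z : ℂ} (hu : ‖u‖ = 1) {r : ℝ} (hr : 0 ≤ r)
    (h : u * z = r) : ‖u - 1‖ ≤ 2 * ‖z - 1‖ := by
  have h1 : r = ‖z‖ := by
    have := congrArg norm h
    rwa [norm_mul, hu, one_mul, Complex.norm_real, Real.norm_of_nonneg hr, eq_comm] at this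
  have h2 : ‖(r : ℂ) - 1‖ ≤ ‖z - 1‖ := by
    have h3 := abs_norm_sub_norm_le z 1
    rw [norm_one, ← h1] at h3
    rw [← Complex.ofReal_one, ← Complex.ofReal_sub, Complex.norm_real]
    exact_mod_cast h3
  calc ‖u - 1‖ = ‖-(u * (z - 1)) + ((r : ℂ) - 1)‖ := by rw [← h]; congr 1; ring
    _ ≤ ‖u * (z - 1)‖ + ‖(r : ℂ) - 1‖ := by rw [← norm_neg (u * (z - 1))]; exact norm_add_le _ _
    _ ≤ 2 * ‖z - 1‖ := by rw [norm_mul, hu]; linarith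

/-! ### Bounds for the coefficients -/

section Coefficients

variable (a b k : ℕ)

theorem norm_jonesDiff_le (m : ℤ) : ‖jonesDiff a b k m‖ ≤ 2 := by
  have h : ∀ ε m : ℤ, ‖jonesTerm a b k ε m‖ = 1 := by
    intro ε m
    have := norm_qpow k (((a : ℝ) * b * m ^ 2 - 2 * (a + ε * b) * m + 2 * ε) / 2)
    push_cast at this
    exact this
  rw [jonesDiff]
  refine (norm_sub_le _ _).trans ?_
  rw [h, h]
  norm_num

theorem norm_jonesNum_le (ℓ : ℕ) : ‖jonesNum a b k ℓ‖ ≤ 2 * ℓ := by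
  have h := norm_qpow k ((a : ℝ) * b * (1 - ℓ ^ 2) / 2)
  push_cast at h
  rw [jonesNum, norm_mul, h, one_mul]
  refine (norm_sum_le_of_le _ fun s _ => norm_jonesDiff_le a b k _).trans (le_of_eq ?_)
  rw [Finset.sum_const, Finset.card_range, nsmul_eq_mul, mul_comm]

theorem norm_jonesHat_le (n : ℤ) : ‖jonesHat a b k n‖ ≤ 8 * k ^ 2 := by
  have h := norm_qpow k (-((n : ℝ) ^ 2 / (2 * a * b : ℕ)))
  have h1 : qpow k (((-((n : ℝ) ^ 2 / (2 * a * b : ℕ)) : ℝ)) : ℂ) =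
      qpow k (-(n ^ 2 / (2 * a * b : ℕ))) := by push_cast; rfl
  rw [h1] at h
  rw [jonesHat, norm_mul, h, one_mul]
  have h2 : ∀ ℓ ∈ Finset.range (2 * k), ‖qpow k (-(n * ℓ)) * jonesNum a b k ℓ‖ ≤ 4 * k := by
    intro ℓ hℓ
    have h3 := norm_qpow k (-((n : ℝ) * ℓ))
    push_cast at h3
    rw [norm_mul, h3, one_mul]
    have h4 : (ℓ : ℝ) ≤ 2 * k := by exact_mod_cast (Finset.mem_range.1 hℓ).le
    linarith [norm_jonesNum_le a b k ℓ]
  refine (norm_sum_le_of_le _ h2).trans (le_of_eq ?_)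
  rw [Finset.sum_const, Finset.card_range, nsmul_eq_mul]
  push_cast
  ring

variable [NeZero (2 * a * b)]

theorem norm_gammaHat_le (x : ZMod (2 * a * b)) : ‖gammaHat a b k x‖ ≤ 8 * k ^ 2 := by
  have hD : (0 : ℝ) < (2 * a * b : ℕ) := by exact_mod_cast NeZero.pos (2 * a * b)
  have h1 : ∀ y ∈ (Finset.univ : Finset (ZMod (2 * a * b))),
      ‖ZMod.stdAddChar (N := 2 * a * b) (-(y * x)) * periodicHat a b k y‖ ≤ 8 * k ^ 2 := by
    intro y _
    rw [norm_mul, AddChar.norm_apply, one_mul]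
    exact norm_jonesHat_le a b k _
  have h2 := norm_sum_le_of_le _ h1
  rw [Finset.sum_const, Finset.card_univ, ZMod.card, nsmul_eq_mul] at h2
  rw [gammaHat, norm_mul, norm_div, norm_one, Complex.norm_natCast]
  calc 1 / ((2 * a * b : ℕ) : ℝ) * _ ≤ 1 / ((2 * a * b : ℕ) : ℝ) *
        ((2 * a * b : ℕ) * (8 * k ^ 2)) := mul_le_mul_of_nonneg_left h2 (by positivity)
    _ = 8 * k ^ 2 := by field_simp

end Coefficients

theorem norm_knotScale_le {k : ℕ} (hk : 0 < k) : ‖knotScale k‖ ≤ 1 := by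
  have hk1 : (1 : ℝ) ≤ k := by exact_mod_cast hk
  have h1 : 1 ≤ √(k : ℝ) := Real.one_le_sqrt.2 hk1
  have h2 : 1 ≤ √(2 * (k : ℝ)) := Real.one_le_sqrt.2 (by linarith)
  rw [knotScale]
  simp only [norm_div, norm_mul, Complex.norm_I, Complex.norm_real, norm_one, RCLike.norm_ofNat,
    Real.norm_of_nonneg (Real.sqrt_nonneg _), mul_one]
  rw [div_le_one (by positivity)]
  nlinarith

end

section

variable {E : Type*} [NormedAddCommGroup E] [NormedSpace ℝ E]
variable {δ : Type*} [NormedAddCommGroup δ] [InnerProductSpace ℂ δ]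

/-! ### The phase of the knot basis -/

section KnotBasis

variable {P : PolarizedPlane E} {mu lam : E} {Ωμ : δ}

theorem ne_zero_of_omega_eq (hω : P.ω mu lam = 4 * Real.pi) : mu ≠ 0 ∧ lam ≠ 0 := by
  have hpi := Real.pi_pos
  constructor
  · rintro rfl
    rw [map_zero, LinearMap.zero_apply] at hω
    linarith
  · rintro rfl
    rw [map_zero] at hω
    linarith

theorem adapted_direction_ne_zero {D : ℕ} (hD : 0 < D) (hω : P.ω mu lam = 4 * Real.pi) :
    (D : ℝ) • mu - (2 : ℝ) • lam ≠ 0 := by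
  intro h
  have h1 := omega_adapted P (D := D) hω
  rw [h, map_zero] at h1
  have h2 : (0 : ℝ) < (2 * D : ℕ) := by exact_mod_cast (by positivity : 0 < 2 * D)
  have h3 : 0 < 2 * Real.pi * (2 * D : ℕ) := by positivity
  linarith

theorem thetaBasis_zero (P : PolarizedPlane E) {k N : ℕ} {e f : E} {v : δ} (hk : 0 < k)
    (hN : 0 < N) (x : E) :
    thetaBasis P k N e f v 0 x = (ampl k * theta P k e f 0 x : ℂ) • v := by
  have h := congrFun (thetaBasis_intCast P (e := e) (f := f) (v := v) hk hN 0) x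
  simpa using h

theorem isHeisenbergBasis_knot (H : HalfFormLine P δ) (hω : P.ω mu lam = 4 * Real.pi) (hΩμ : H.IsRootAt Ωμ mu) {k : ℕ}
    (hk : 0 < k) {u : ℂ} (hu : ‖u‖ = 1) :
    IsHeisenbergBasis P k 2 mu lam (thetaBasis P k 2 mu lam (u • Ωμ)) := by
  refine isHeisenbergBasis_thetaBasis P hk two_pos even_two ?_ H.finrank_eq_one ?_
  · rw [hω]; push_cast; ring
  · rw [norm_smul, hu, one_mul]
    exact H.norm_pow_four (ne_zero_of_omega_eq hω).1 (by rw [hΩμ, norm_one])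

/-- The theta basis, rotated by the phase that makes its value at the origin nonnegative. -/
theorem exists_isKnotBasis (H : HalfFormLine P δ) (hω : P.ω mu lam = 4 * Real.pi) (hΩμ : H.IsRootAt Ωμ mu) {k : ℕ}
    (hk : 0 < k) : ∃ ξ : ZMod (2 * k) → E → δ, IsKnotBasis P k mu lam Ωμ ξ := by
  set z : ℂ := theta P k mu lam 0 0 with hz
  obtain ⟨u, hu, huz⟩ : ∃ u : ℂ, ‖u‖ = 1 ∧ z * u = ‖z‖ := by
    by_cases h : z = 0
    · exact ⟨1, norm_one, by simp [h]⟩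
    · have hn : ‖z‖ ≠ 0 := norm_ne_zero_iff.2 h
      refine ⟨‖z‖ / z, ?_, by field_simp⟩
      rw [norm_div, Complex.norm_real, norm_norm, div_self hn]
  refine ⟨thetaBasis P k 2 mu lam (u • Ωμ), isHeisenbergBasis_knot H hω hΩμ hk hu,
    ampl k * ‖z‖, mul_nonneg (ampl_nonneg k) (norm_nonneg z), ?_⟩
  rw [thetaBasis_zero P hk two_pos, smul_smul, mul_assoc, ← hz, huz]
  push_cast
  rfl

theorem ampl_pos {k : ℕ} (hk : 0 < k) : 0 < ampl k :=
  Real.rpow_pos_of_pos (div_pos (by exact_mod_cast hk) (by positivity)) _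

/-- A knot basis is the theta basis up to a phase that is exponentially close to `1`: the value at
the origin of the theta series is exponentially close to `1`. -/
theorem exists_phase (H : HalfFormLine P δ) (hω : P.ω mu lam = 4 * Real.pi) (hΩμ : H.IsRootAt Ωμ mu)
    {ξ : ∀ k : ℕ, ZMod (2 * k) → E → δ} (hξ : ∀ k : ℕ, 0 < k → IsKnotBasis P k mu lam Ωμ (ξ k)) :
    ∃ (u : ℕ → ℂ) (C c : ℝ), 0 ≤ C ∧ 0 < c ∧ ∀ k : ℕ, 0 < k → ‖u k‖ = 1 ∧
      (∀ ℓ, ξ k ℓ = u k • thetaBasis P k 2 mu lam Ωμ ℓ) ∧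
      ‖u k - 1‖ ≤ C * Real.exp (-(c * k)) := by
  have hmu := (ne_zero_of_omega_eq hω).1
  have hω0 : P.ω mu lam ≠ 0 := by rw [hω]; positivity
  obtain ⟨C, hC0, hC⟩ := norm_theta_zero_sub_one_le P hmu hω0
  have h1 : ∀ k : ℕ, ∃ u : ℂ, 0 < k → ‖u‖ = 1 ∧
      (∀ ℓ, ξ k ℓ = u • thetaBasis P k 2 mu lam Ωμ ℓ) ∧
      ‖u - 1‖ ≤ 2 * C * Real.exp (-(decayRate P mu lam / 2 * k)) := by
    intro k
    by_cases hk : 0 < k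
    swap
    · exact ⟨1, fun h => absurd h hk⟩
    obtain ⟨hb, r, hr, hr0⟩ := hξ k hk
    have hstd := isHeisenbergBasis_knot H hω hΩμ hk norm_one
    rw [one_smul] at hstd
    obtain ⟨u, hu, huξ⟩ := hstd.eq_smul P hk two_pos hb
    refine ⟨u, fun _ => ⟨hu, huξ, ?_⟩⟩
    have hΩ : Ωμ ≠ 0 := by
      rintro rfl
      have : H.IsRootAt (0 : δ) mu := hΩμ
      simp [HalfFormLine.IsRootAt] at this
    have ha := ampl_pos hk
    have haC : (ampl k : ℂ) ≠ 0 := by exact_mod_cast ha.ne'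
    rw [huξ, Pi.smul_apply, thetaBasis_zero P hk two_pos, smul_smul] at hr0
    have h2 := smul_left_injective ℂ hΩ hr0
    have h3 : u * theta P k mu lam 0 0 = ((r / ampl k : ℝ) : ℂ) := by
      push_cast
      rw [eq_div_iff haC, ← h2]
      ring
    refine (norm_sub_one_le_of_mul_nonneg hu (by positivity) h3).trans ?_
    rw [mul_assoc]
    exact mul_le_mul_of_nonneg_left (hC k hk) zero_le_two
  choose u hu using h1
  exact ⟨u, 2 * C, decayRate P mu lam / 2, by positivity,
    half_pos (decayRate_pos P hmu hω0), fun k hk => hu k hk⟩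

end KnotBasis

/-! ### The sequences of coefficients -/

section Sequences

variable {a b : ℕ}

variable (a b) in
/-- The sequence `α(k)`, without error term. -/
def knotAlpha (k : ℕ) : ℂ :=
  Complex.I / ((√2 : ℝ) : ℂ) * Complex.exp (Complex.I * Real.pi / k *
    (-((a : ℂ) ^ 2 + (b : ℂ) ^ 2) / ((2 * a * b : ℕ) : ℂ) + ((2 * a * b : ℕ) : ℂ) / 4))

/-- The coefficients `jonesHat` descend to `ℤ / 2kD`, `D = 2ab`. -/
theorem jonesHat_add_mul_period (ha : 0 < a) (hb : 0 < b) {k : ℕ} (hk : 0 < k) (n j : ℤ) :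
    jonesHat a b k (n + (2 * (2 * a * b) * k : ℕ) * j) = jonesHat a b k n := by
  have ha' : (a : ℂ) ≠ 0 := by exact_mod_cast ha.ne'
  have hb' : (b : ℂ) ≠ 0 := by exact_mod_cast hb.ne'
  rw [jonesHat, jonesHat]
  congr 1
  · refine qpow_congr hk (-(2 * n * j + 2 * (2 * a * b) * k * j ^ 2)) ?_
    push_cast
    field_simp
    ring
  · refine Finset.sum_congr rfl fun ℓ _ => ?_
    congr 1
    exact qpow_congr hk (-(2 * a * b * j * ℓ)) (by push_cast; ring)

variable (a b) in
/-- The coefficient along `Ψ_n` of the difference of `Z_k` and `∑ γ_ℓ(k) Φ_ℓ`. -/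
def knotDefect (k : ℕ) (n : ℤ) : ℂ :=
  knotScale k * (jonesHat a b k n - periodicHat a b k (n : ZMod (2 * a * b)))

theorem norm_knotDefect_le {k : ℕ} (hk : 0 < k) (n : ℤ) :
    ‖knotDefect a b k n‖ ≤ 16 * k ^ 2 := by
  rw [knotDefect, norm_mul]
  have h1 : ‖jonesHat a b k n - periodicHat a b k (n : ZMod (2 * a * b))‖ ≤ 16 * k ^ 2 := by
    refine (norm_sub_le _ _).trans ?_
    have h1 := norm_jonesHat_le a b k n
    have h2 : ‖periodicHat a b k (n : ZMod (2 * a * b))‖ ≤ 8 * k ^ 2 := norm_jonesHat_le a b k _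
    linarith
  calc _ ≤ 1 * (16 * (k : ℝ) ^ 2) := by
        gcongr
        exact norm_knotScale_le hk
    _ = _ := one_mul _

theorem knotDefect_intCast_val (ha : 0 < a) (hb : 0 < b) {k : ℕ} (hk : 0 < k) (n : ℤ) :
    knotDefect a b k ((n : ZMod (2 * (2 * a * b) * k)).val : ℤ) = knotDefect a b k n := by
  have : NeZero (2 * (2 * a * b) * k) := ⟨by positivity⟩
  have h1 : ((n : ZMod (2 * (2 * a * b) * k)).val : ℤ) = n + (2 * (2 * a * b) * k : ℕ) *
      (-(n / (2 * (2 * a * b) * k : ℕ))) := by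
    rw [ZMod.val_intCast, Int.emod_def]
    ring
  rw [h1, knotDefect, knotDefect, jonesHat_add_mul_period ha hb hk]
  congr 3
  rw [show 2 * (2 * a * b) * k = (2 * a * b) * (2 * k) by ring]
  push_cast
  have h2 : ((2 : ZMod (2 * a * b)) * a * b) = 0 := by
    have := ZMod.natCast_self (2 * a * b)
    push_cast at this
    exact this
  rw [h2]
  ring

variable [NeZero (2 * a * b)]

variable (a b) in
/-- The sequences `γ_ℓ(k)`. They are set to `0` for the finitely many `k` for which the window
`-ab + a + b < n < 2k - ab - a - b` is empty. -/
def knotGamma (x : ZMod (2 * a * b)) (k : ℕ) : ℂ :=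
  if a + b + 1 ≤ k then
    (√(2 * (k : ℝ) * (2 * a * b : ℕ)) : ℝ) * knotScale k * gammaHat a b k x else 0

variable (a b) in
/-- The sequences `β_ℓ(k)`, set to `0` for the same `k` as `knotGamma`. -/
def knotBeta (x : ZMod (2 * a * b)) (k : ℕ) : ℂ :=
  if a + b + 1 ≤ k then
    (√(2 * (k : ℝ) * (2 * a * b : ℕ)) : ℝ) * knotScale k * betaHat a b k x else 0

theorem norm_knotGamma_le (x : ZMod (2 * a * b)) {k : ℕ} (hk : 0 < k) :
    ‖knotGamma a b x k‖ ≤ 16 * (2 * a * b : ℕ) * k ^ 3 := by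
  have hD1 : (1 : ℝ) ≤ (2 * a * b : ℕ) := by exact_mod_cast NeZero.pos (2 * a * b)
  have hk1 : (1 : ℝ) ≤ k := by exact_mod_cast hk
  rw [knotGamma]
  split_ifs
  · have h1 : √(2 * (k : ℝ) * (2 * a * b : ℕ)) ≤ 2 * (k : ℝ) * (2 * a * b : ℕ) :=
      Real.sqrt_le_self_iff.2 (Or.inr (by nlinarith))
    rw [norm_mul, norm_mul, Complex.norm_real, Real.norm_of_nonneg (Real.sqrt_nonneg _)]
    calc _ ≤ (2 * (k : ℝ) * (2 * a * b : ℕ)) * 1 * (8 * k ^ 2) := by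
          gcongr
          · exact norm_knotScale_le hk
          · exact norm_gammaHat_le a b k x
      _ = _ := by ring
  · rw [norm_zero]
    positivity

theorem knotDefect_eq_zero (ha : 0 < a) (hb : 0 < b) (hab : Nat.Coprime a b) {k : ℕ} (hk : 0 < k)
    {n : ℤ} (h1 : -(a * b : ℤ) + a + b < n) (h2 : n < 2 * k + a * b - a - b) :
    knotDefect a b k n = 0 := by
  rw [knotDefect, periodicHat_eq ha hb hab hk h1 h2, sub_self, mul_zero]

/-- The coefficients of `∑ γ_ℓ(k) Φ_ℓ` along the states `Ψ_n` are, up to a constant factor, the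
`D`-periodic sequence `periodicHat`. -/
theorem sum_knotGamma_fourierState {X : Type*} {k : ℕ} (hk : a + b + 1 ≤ k)
    (Ψ : ZMod (2 * (2 * a * b) * k) → X → δ) :
    ∑ ℓ ∈ Finset.range (2 * a * b), knotGamma a b (ℓ : ZMod (2 * a * b)) k •
      fourierState (2 * a * b) k Ψ ℓ = ∑ n ∈ Finset.range (2 * (2 * a * b) * k),
      (knotScale k * periodicHat a b k (n : ZMod (2 * a * b))) •
        Ψ (n : ZMod (2 * (2 * a * b) * k)) := by
  have hDpos : (0 : ℝ) < (2 * a * b : ℕ) := by exact_mod_cast NeZero.pos (2 * a * b)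
  have hkpos : (0 : ℝ) < k := by exact_mod_cast (by omega : 0 < k)
  have hs : ((√(2 * (k : ℝ) * (2 * a * b : ℕ)) : ℝ) : ℂ) ≠ 0 := by
    exact_mod_cast (Real.sqrt_pos.2 (mul_pos (mul_pos two_pos hkpos) hDpos)).ne'
  simp only [fourierState, Finset.smul_sum, smul_smul]
  rw [Finset.sum_comm]
  refine Finset.sum_congr rfl fun n _ => ?_
  rw [← Finset.sum_smul, ← sum_gammaHat, sum_zmod_eq_sum_range _ 0, Finset.mul_sum]
  congr 1
  refine Finset.sum_congr rfl fun ℓ _ => ?_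
  have h1 : ZMod.stdAddChar (N := 2 * a * b) ((n : ZMod (2 * a * b)) * ((0 + ℓ : ℤ) : ZMod _)) =
      Complex.exp (2 * Complex.I * Real.pi * n * ((ℓ : ℤ) : ℂ) / ((2 * a * b : ℕ) : ℂ)) := by
    have := stdAddChar_int (a := a) (b := b) (n * ℓ)
    push_cast at this ⊢
    rw [zero_add, this]
    congr 1
    ring
  rw [h1, knotGamma, if_pos hk, zero_add, Int.cast_natCast, Int.cast_natCast, Complex.ofReal_div,
    Complex.ofReal_one]
  field_simp

theorem knotGamma_neg_one (ha : 0 < a) (hb : 0 < b) (hab : Nat.Coprime a b) (k : ℕ) :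
    knotGamma a b (-1) k = 0 := by
  rw [knotGamma]
  split_ifs with h
  · rw [gammaHat_neg_one ha hb hab h, mul_zero]
  · rfl

theorem knotGamma_zero (ha : 0 < a) (hb : 0 < b) (hab : Nat.Coprime a b) (k : ℕ) :
    knotGamma a b 0 k = 1 / 2 * knotBeta a b 0 k := by
  rw [knotGamma, knotBeta]
  split_ifs with h
  · rw [gammaHat_zero ha hb hab h]
    ring
  · rw [mul_zero]

theorem knotGamma_rec (k : ℕ) (ℓ : ℤ) : knotGamma a b (ℓ : ZMod (2 * a * b)) k =
    Complex.exp (2 * Complex.I * Real.pi / ((2 * a * b : ℕ) : ℂ) * (2 * k * ((ℓ : ℂ) - 1))) *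
      knotGamma a b ((ℓ - 2 : ℤ) : ZMod (2 * a * b)) k + knotBeta a b (ℓ : ZMod (2 * a * b)) k := by
  rw [knotGamma, knotBeta, knotGamma]
  split_ifs with h
  · have h1 := stdAddChar_int (a := a) (b := b) (2 * k * (ℓ - 1))
    have h2 : Complex.exp (2 * Complex.I * Real.pi / ((2 * a * b : ℕ) : ℂ) *
        (2 * k * ((ℓ : ℂ) - 1))) =
        Complex.exp (2 * Real.pi * Complex.I * (2 * k * (ℓ - 1) : ℤ) / (2 * a * b : ℕ)) := by
      congr 1
      push_cast
      ring
    rw [h2, ← h1, betaHat]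
    push_cast
    ring
  · simp

/-- The asymptotic expansion of `β_ℓ(k)` is an equality as soon as the window of periodicity is not
empty. -/
theorem knotBeta_eq (ha : 0 < a) (hb : 0 < b) (hab : Nat.Coprime a b) {k : ℕ}
    (hk : a + b + 1 ≤ k) (ℓ : ℤ) : knotBeta a b (ℓ : ZMod (2 * a * b)) k =
      (-4 * knotAlpha a b k * ((√(2 * (k : ℝ) / ((2 * a * b : ℕ) : ℝ)) : ℝ) : ℂ)) *
      ((-1) ^ ℓ * ((Real.sin (Real.pi * ℓ / a) * Real.sin (Real.pi * ℓ / b) : ℝ) : ℂ)) := by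
  have hDpos : (0 : ℝ) < (2 * a * b : ℕ) := by exact_mod_cast NeZero.pos (2 * a * b)
  have hkpos : (0 : ℝ) < k := by exact_mod_cast (by omega : 0 < k)
  have hq : Complex.exp (Complex.I * Real.pi / k *
      (-((a : ℂ) ^ 2 + (b : ℂ) ^ 2) / ((2 * a * b : ℕ) : ℂ) + ((2 * a * b : ℕ) : ℂ) / 4)) =
      qpow k (-((a : ℂ) ^ 2 + (b : ℂ) ^ 2) / (2 * a * b : ℕ) + (2 * a * b : ℕ) / 4) := by
    rw [qpow]
    congr 1
    ring
  rw [knotBeta, if_pos hk, betaHat_eq_sum_jumps ha hb hab hk, sum_jump_phases ha hb, knotAlpha, hq,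
    knotScale]
  set D : ℝ := ((2 * a * b : ℕ) : ℝ) with hD
  have hDC : ((2 * a * b : ℕ) : ℂ) = (D : ℂ) := by rw [hD]; push_cast; rfl
  rw [hDC]
  set S : ℂ := (-1) ^ ℓ * ((Real.sin (Real.pi * ℓ / a) * Real.sin (Real.pi * ℓ / b) : ℝ) : ℂ)
  set Q := qpow k (-((a : ℂ) ^ 2 + (b : ℂ) ^ 2) / D + D / 4)
  have e1 : √(2 * (k : ℝ) * D) = √2 * √k * √D := by
    rw [Real.sqrt_mul (by positivity), Real.sqrt_mul zero_le_two]
  have e2 : √(2 * (k : ℝ) / D) = √2 * √k / √D := by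
    rw [Real.sqrt_div (by positivity), Real.sqrt_mul zero_le_two]
  have e3 : √(2 * (k : ℝ)) = √2 * √k := Real.sqrt_mul zero_le_two _
  have e4 : (k : ℂ) = ((√(k : ℝ) : ℝ) : ℂ) ^ 2 := by
    rw [← Complex.ofReal_pow, Real.sq_sqrt hkpos.le]
    simp
  have e5 : (D : ℂ) = ((√D : ℝ) : ℂ) ^ 2 := by
    rw [← Complex.ofReal_pow, Real.sq_sqrt hDpos.le]
  have n1 : ((√(k : ℝ) : ℝ) : ℂ) ≠ 0 := by exact_mod_cast (Real.sqrt_pos.2 hkpos).ne'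
  have n2 : ((√D : ℝ) : ℂ) ≠ 0 := by exact_mod_cast (Real.sqrt_pos.2 hDpos).ne'
  have n3 : ((√2 : ℝ) : ℂ) ≠ 0 := by exact_mod_cast (Real.sqrt_pos.2 two_pos).ne'
  have e6 : -(2 * (k : ℂ) / D) = -(2 * ((√(k : ℝ) : ℝ) : ℂ) ^ 2 / ((√D : ℝ) : ℂ) ^ 2) := by
    rw [← e4, ← e5]
  rw [e1, e2, e3, e6]
  push_cast
  field_simp
  rw [Complex.I_sq]
  ring

end Sequences

end

section

theorem continuous_sum_sections {ι X F : Type*} [TopologicalSpace X] [NormedAddCommGroup F]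
    (s : Finset ι) {Φ : ι → X → F}
    (h : ∀ i ∈ s, Continuous (Φ i)) : Continuous (∑ i ∈ s, Φ i) := by
  rw [show ∑ i ∈ s, Φ i = fun x => ∑ i ∈ s, Φ i x from funext fun x => Finset.sum_apply x s Φ]
  exact continuous_finsetSum s h

variable {E : Type*} [NormedAddCommGroup E] [NormedSpace ℝ E]
variable {δ : Type*} [NormedAddCommGroup δ] [InnerProductSpace ℂ δ]

/-! ### Comparison of the knot state with Lagrangian states -/

section Comparison

variable {P : PolarizedPlane E} {mu lam : E} {a b : ℕ}

variable (P mu lam a b) in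
/-- The basis `Ψ_n`, `n ∈ ℤ / 2kD`, of the space attached to the lattice `ℤ Dμ ⊕ ℤ lam`, where
`D = 2ab`. The phases `u k` are those of the given knot basis. -/
def adaptedBasis (v : δ) (u : ℕ → ℂ) (k : ℕ) : ZMod (2 * (2 * a * b) * k) → E → δ :=
  thetaBasis P k (2 * (2 * a * b)) (-lam) (((2 * a * b : ℕ) : ℝ) • mu - (2 : ℝ) • lam)
    (u k • poissonFactor P mu lam • v)

theorem continuous_adaptedBasis (ha : 0 < a) (hb : 0 < b) (hω : P.ω mu lam = 4 * Real.pi)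
    (v : δ) (u : ℕ → ℂ) {k : ℕ} (hk : 0 < k) (n : ZMod (2 * (2 * a * b) * k)) :
    Continuous (adaptedBasis P mu lam a b v u k n) :=
  continuous_thetaBasis P hk (by positivity) (omega_adapted P hω) n

theorem continuous_fourierState (ha : 0 < a) (hb : 0 < b) (hω : P.ω mu lam = 4 * Real.pi)
    (v : δ) (u : ℕ → ℂ) {k : ℕ} (hk : 0 < k) (ℓ : ℤ) :
    Continuous (fourierState (2 * a * b) k (adaptedBasis P mu lam a b v u k) ℓ) := by
  rw [fourierState]
  refine Continuous.const_smul (continuous_sum_sections _ fun n _ => ?_) _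
  exact (continuous_adaptedBasis ha hb hω v u hk (n : ZMod (2 * (2 * a * b) * k))).const_smul _

theorem continuous_knotState (hω : P.ω mu lam = 4 * Real.pi) {ξ : ∀ k : ℕ, ZMod (2 * k) → E → δ}
    {v : δ} {u : ℂ} {k : ℕ} (hk : 0 < k)
    (hξ : ∀ ℓ, ξ k ℓ = u • thetaBasis P k 2 mu lam v ℓ) : Continuous (knotState a b ξ k) := by
  have hω2 : P.ω mu lam = 2 * Real.pi * (2 : ℕ) := by rw [hω]; push_cast; ring
  refine (continuous_sum_sections _ fun ℓ _ => ?_).const_smul _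
  rw [hξ]
  exact ((continuous_thetaBasis P hk two_pos hω2 _).const_smul _).const_smul _

variable [NeZero (2 * a * b)]

theorem knotState_sub_eq_sum (ha : 0 < a) (hb : 0 < b) {k : ℕ} (hk : a + b + 1 ≤ k)
    (hω : P.ω mu lam = 4 * Real.pi) {ξ : ∀ k : ℕ, ZMod (2 * k) → E → δ} {v : δ} {u : ℕ → ℂ}
    (hξ : ∀ ℓ, ξ k ℓ = u k • thetaBasis P k 2 mu lam v ℓ) :
    knotState a b ξ k - ∑ ℓ ∈ Finset.range (2 * a * b), knotGamma a b (ℓ : ZMod (2 * a * b)) k •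
      fourierState (2 * a * b) k (adaptedBasis P mu lam a b v u k) ℓ =
    ∑ n ∈ Finset.range (2 * (2 * a * b) * k), knotDefect a b k n •
      adaptedBasis P mu lam a b v u k (n : ZMod (2 * (2 * a * b) * k)) := by
  rw [knotState_eq_sum P a b ha hb (by omega) hω hξ, sum_knotGamma_fourierState hk,
    ← Finset.sum_sub_distrib]
  refine Finset.sum_congr rfl fun n _ => ?_
  rw [knotDefect, mul_sub, sub_smul, Int.cast_natCast]
  rfl

theorem sectionInner_knotState_sub (ha : 0 < a) (hb : 0 < b) (hab : Nat.Coprime a b) {k : ℕ}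
    (hk : a + b + 1 ≤ k) (hω : P.ω mu lam = 4 * Real.pi)
    {ξ : ∀ k : ℕ, ZMod (2 * k) → E → δ} {v : δ} {u : ℕ → ℂ}
    (hξ : ∀ ℓ, ξ k ℓ = u k • thetaBasis P k 2 mu lam v ℓ)
    (hΨ : ∀ m n, sectionInner P (-lam) (((2 * a * b : ℕ) : ℝ) • mu - (2 : ℝ) • lam)
      (adaptedBasis P mu lam a b v u k m) (adaptedBasis P mu lam a b v u k n) =
        if m = n then 1 else 0)
    {n : ℤ} (h1 : -(a * b : ℤ) + a + b < n) (h2 : n < 2 * k - a * b - a - b) :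
    sectionInner P (-lam) (((2 * a * b : ℕ) : ℝ) • mu - (2 : ℝ) • lam)
      (adaptedBasis P mu lam a b v u k (n : ZMod (2 * (2 * a * b) * k)))
      (knotState a b ξ k - ∑ ℓ ∈ Finset.range (2 * a * b), knotGamma a b (ℓ : ZMod (2 * a * b)) k •
        fourierState (2 * a * b) k (adaptedBasis P mu lam a b v u k) ℓ) = 0 := by
  have hk0 : 0 < k := by omega
  have hne : NeZero (2 * (2 * a * b) * k) := ⟨by positivity⟩
  have hsum : ∑ n ∈ Finset.range (2 * (2 * a * b) * k), knotDefect a b k n •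
      adaptedBasis P mu lam a b v u k (n : ZMod (2 * (2 * a * b) * k)) =
      ∑ y : ZMod (2 * (2 * a * b) * k), knotDefect a b k (y.val : ℤ) •
        adaptedBasis P mu lam a b v u k y := by
    refine Finset.sum_bij' (fun n _ => (n : ZMod (2 * (2 * a * b) * k))) (fun y _ => y.val)
      (fun _ _ => Finset.mem_univ _) (fun y _ => Finset.mem_range.2 (ZMod.val_lt y))
      (fun n hn => ZMod.val_cast_of_lt (Finset.mem_range.1 hn))
      (fun y _ => ZMod.natCast_zmod_val y) (fun n hn => ?_)
    rw [ZMod.val_cast_of_lt (Finset.mem_range.1 hn)]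
  rw [knotState_sub_eq_sum ha hb hk hω hξ, hsum, sectionInner_sum_orthonormal P _ _
    (fun i => continuous_adaptedBasis ha hb hω v u hk0 i) hΨ, knotDefect_intCast_val ha hb hk0]
  have hpos : (0 : ℤ) ≤ a * b := by positivity
  exact knotDefect_eq_zero ha hb hab hk0 h1 (by linarith)

/-- In the strip `A`, the states `Ψ_n` with `n` outside the window on which the coefficients of
`Z_k` and `∑ γ_ℓ(k) Φ_ℓ` agree are exponentially small. -/
theorem rapidlyDecreasing_knotState_sub (ha : 0 < a) (hb : 0 < b) (hab : Nat.Coprime a b)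
    (hω : P.ω mu lam = 4 * Real.pi) {ξ : ∀ k : ℕ, ZMod (2 * k) → E → δ} {v : δ} {u : ℕ → ℂ}
    (hu : ∀ k, 0 < k → ‖u k‖ = 1)
    (hξ : ∀ k, 0 < k → ∀ ℓ, ξ k ℓ = u k • thetaBasis P k 2 mu lam v ℓ) {V : Set E}
    (hV : IsCompact V) {ε : ℝ} (hε : 0 < ε)
    (hVε : ∀ x ∈ V, -1 + 2 * ε ≤ P.ω (-lam) x / (4 * Real.pi) ∧
      P.ω (-lam) x / (4 * Real.pi) ≤ -(2 * ε)) :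
    RapidlyDecreasing V fun k => knotState a b ξ k - ∑ ℓ ∈ Finset.range (2 * a * b),
      knotGamma a b (ℓ : ZMod (2 * a * b)) k •
        fourierState (2 * a * b) k (adaptedBasis P mu lam a b v u k) ℓ := by
  set D : ℕ := 2 * a * b with hD
  set f : E := (D : ℝ) • mu - (2 : ℝ) • lam with hf
  have hDpos : 0 < D := by positivity
  have hD1 : (1 : ℝ) ≤ D := by exact_mod_cast hDpos
  have hDR : (D : ℝ) ≠ 0 := by positivity
  have hlf := omega_adapted P (D := D) hω
  rw [← hf] at hlf
  have hlf0 : P.ω (-lam) f ≠ 0 := (ne_zero_of_omega P (by positivity : 0 < 2 * D) hlf).2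
  have hlam0 : -lam ≠ 0 := (ne_zero_of_omega P (by positivity : 0 < 2 * D) hlf).1
  obtain ⟨C, hC0, hC⟩ := norm_theta_le P hlam0 hlf0 2
  obtain ⟨K, hK⟩ := exists_nat_ge (((a : ℝ) + b) / (2 * ε))
  set w : δ := poissonFactor P mu lam • v with hw
  -- `2kD` terms, coefficients `O(k²)` and the amplitude `O(k)` of the basis give the exponent `4`
  refine RapidlyDecreasing.of_exp hV (B := 2 * D * (16 * (C * ‖w‖))) (p := 4)
    (K := max (a + b + 1) K) (c := decayRate P (-lam) f * (ε / D) ^ 2 / 2) (fun k hk => ?_) ?_ ?_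
  · exact (continuous_knotState hω hk (hξ k hk)).sub (continuous_sum_sections _ fun ℓ _ =>
      (continuous_fourierState ha hb hω v u hk ℓ).const_smul _)
  · have := decayRate_pos P hlam0 hlf0
    positivity
  intro k hk hkK x hx
  have hkR : (0 : ℝ) < k := by exact_mod_cast hk
  have hkab : a + b + 1 ≤ k := (le_max_left _ _).trans hkK
  have hkε : ((a : ℝ) + b) ≤ ε * (2 * k) := by
    have h1 : ((a : ℝ) + b) / (2 * ε) ≤ k := hK.trans (by exact_mod_cast (le_max_right _ _).trans hkK)
    rw [div_le_iff₀ (by positivity)] at h1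
    linarith
  obtain ⟨hx1, hx2⟩ := hVε x hx
  set σ : ℝ := P.ω (-lam) x / (4 * Real.pi) with hσ
  have hratio : P.ω (-lam) x / P.ω (-lam) f = σ / D := by
    rw [hlf, hσ]
    push_cast
    field_simp
    ring
  rw [knotState_sub_eq_sum ha hb hkab hω (hξ k hk), Finset.sum_apply]
  set R : ℝ := Real.exp (-(decayRate P (-lam) f * (ε / D) ^ 2 / 2 * k)) with hR
  have hterm : ∀ n ∈ Finset.range (2 * D * k), ‖(knotDefect a b k n •
      adaptedBasis P mu lam a b v u k (n : ZMod (2 * (2 * a * b) * k))) x‖ ≤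
      16 * k ^ 2 * (k * (C * R) * ‖w‖) := by
    intro n hn
    have hn' : (n : ℝ) < 2 * D * k := by exact_mod_cast Finset.mem_range.1 hn
    by_cases hn0 : knotDefect a b k n = 0
    · rw [hn0, Pi.smul_apply, zero_smul, norm_zero]
      positivity
    -- the indices that remain are close to `0` or at least about `2k`; the lines attached to them
    -- avoid the part of the strip `A` that contains `V`
    have hout : (n : ℝ) ≤ ε * (2 * k) ∨ (1 - ε) * (2 * k) ≤ n := by
      by_contra hcon
      push Not at hcon
      obtain ⟨c1, c2⟩ := hcon
      apply hn0
      have hab0 : (0 : ℤ) ≤ a * b := by positivity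
      have c3 : ((a + b : ℕ) : ℝ) < n := by push_cast; linarith
      have c4 : ((n + (a + b) : ℕ) : ℝ) < ((2 * k : ℕ) : ℝ) := by push_cast; linarith
      have c5 : a + b < n := by exact_mod_cast c3
      have c6 : n + (a + b) < 2 * k := by exact_mod_cast c4
      have c7 : (a : ℤ) + b < n := by exact_mod_cast c5
      have c8 : (n : ℤ) + (a + b) < 2 * k := by exact_mod_cast c6
      exact knotDefect_eq_zero ha hb hab hk (by linarith) (by linarith)
    have hbasis := thetaBasis_intCast P (N := 2 * D) (e := -lam) (f := f) (v := u k • w) hk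
      (by positivity) n
    rw [Int.cast_natCast, Int.cast_natCast] at hbasis
    have hmain : adaptedBasis P mu lam a b v u k (n : ZMod (2 * (2 * a * b) * k)) x =
        (ampl k * theta P k (-lam) f (n / (((2 * D : ℕ) : ℝ) * k)) x : ℂ) • u k • w :=
      congrFun hbasis x
    set s : ℝ := n / (((2 * D : ℕ) : ℝ) * k) with hs
    have hsD : D * s = n / (2 * k) := by
      rw [hs]
      push_cast
      field_simp
    have hs0 : 0 ≤ n / (2 * (k : ℝ)) := by positivity
    have hs1 : n / (2 * (k : ℝ)) ≤ D := by
      rw [div_le_iff₀ (by positivity)]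
      linarith
    have hs2 : n / (2 * (k : ℝ)) ≤ ε ∨ 1 - ε ≤ n / (2 * (k : ℝ)) := by
      rcases hout with h | h
      · exact Or.inl ((div_le_iff₀ (by positivity)).2 h)
      · exact Or.inr ((le_div_iff₀ (by positivity)).2 h)
    have hscale : ∀ m : ℤ, P.ω (-lam) x / P.ω (-lam) f + s + m =
        (σ + n / (2 * k) + D * m) / D := by
      intro m
      rw [hratio, ← hsD]
      field_simp
    have hθ : ‖theta P k (-lam) f s x‖ ≤ C * R := by
      refine hC k hk s (ε / D) x ?_ (by positivity) fun m => ?_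
      · have := hscale 0
        rw [Int.cast_zero, add_zero, mul_zero, add_zero] at this
        rw [this, abs_div, abs_of_pos (by positivity : (0 : ℝ) < D), div_le_iff₀ (by positivity),
          abs_le]
        constructor <;> linarith
      · rw [hscale, abs_div, abs_of_pos (by positivity : (0 : ℝ) < D)]
        refine div_le_div_of_nonneg_right ?_ (by positivity)
        rw [le_abs]
        rcases lt_trichotomy m 0 with hm | hm | hm
        · have hm1 : (m : ℝ) ≤ -1 := by exact_mod_cast Int.le_sub_one_of_lt hm
          right
          nlinarith
        · rw [hm, Int.cast_zero, mul_zero, add_zero]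
          rcases hs2 with h | h
          · right; linarith
          · left; linarith
        · have hm1 : (1 : ℝ) ≤ m := by exact_mod_cast hm
          left
          nlinarith
    rw [Pi.smul_apply, hmain, norm_smul, norm_smul, norm_smul, hu k hk, one_mul, norm_mul,
      Complex.norm_real, Real.norm_of_nonneg (ampl_nonneg k)]
    refine mul_le_mul (norm_knotDefect_le hk _) ?_ (by have := ampl_nonneg k; positivity)
      (by positivity)
    gcongr
    exact ampl_le hk
  refine (norm_sum_le_of_le _ hterm).trans (le_of_eq ?_)
  rw [Finset.sum_const, Finset.card_range, nsmul_eq_mul]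
  push_cast
  ring

/-- In the sum `∑ γ_ℓ(k) Φ_ℓ`, only the Lagrangian states over the lines through `V` matter. -/
theorem rapidlyDecreasing_sum_fourierState_sub (ha : 0 < a) (hb : 0 < b)
    (hω : P.ω mu lam = 4 * Real.pi) {v : δ} {u : ℕ → ℂ}
    (hu : ∀ k, 0 < k → ‖u k‖ = 1) {V : Set E} (hV : IsCompact V) {ε Y : ℝ} (hε : 0 < ε)
    (hY : ∀ x ∈ V,
      |P.ω (((2 * a * b : ℕ) : ℝ) • mu - (2 : ℝ) • lam) x / (4 * Real.pi)| ≤ Y)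
    (S : Finset ℤ)
    (hVε : ∀ x ∈ V, ∀ r : ℤ, r ∉ S →
      ε ≤ |P.ω (((2 * a * b : ℕ) : ℝ) • mu - (2 : ℝ) • lam) x / (4 * Real.pi) - r|) :
    RapidlyDecreasing V fun k => (∑ ℓ ∈ Finset.range (2 * a * b),
      knotGamma a b (ℓ : ZMod (2 * a * b)) k •
        fourierState (2 * a * b) k (adaptedBasis P mu lam a b v u k) ℓ) -
      fun x => (ampl k * ∑ r ∈ S, knotGamma a b (r : ZMod (2 * a * b)) k *
        lagr P k (((2 * a * b : ℕ) : ℝ) • mu - (2 : ℝ) • lam)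
          (((r : ℝ) / (2 * a * b : ℕ)) • (-lam)) x : ℂ) •
        poissonFactor P (-lam) (((2 * a * b : ℕ) : ℝ) • mu - (2 : ℝ) • lam) •
          u k • poissonFactor P mu lam • v := by
  set D : ℕ := 2 * a * b with hD
  set f : E := (D : ℝ) • mu - (2 : ℝ) • lam with hf
  have hDpos : 0 < D := by positivity
  have hDR : (D : ℝ) ≠ 0 := by positivity
  have hlf := omega_adapted P (D := D) hω
  rw [← hf] at hlf
  have hf0 : f ≠ 0 := adapted_direction_ne_zero hDpos hω
  have hfl : P.ω f (-lam) = -(4 * Real.pi * D) := by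
    rw [P.omega_swap, hlf]
    push_cast
    ring
  have hfl0 : P.ω f (-lam) ≠ 0 := by
    rw [hfl, neg_ne_zero]
    positivity
  have hratio : ∀ x, D * (P.ω f x / P.ω f (-lam)) = -(P.ω f x / (4 * Real.pi)) := by
    intro x
    rw [hfl]
    field_simp
  obtain ⟨C, hC0, hC⟩ := norm_tsum_lagr_sub_le P hf0 hfl0 hDpos Y
  set w : δ := poissonFactor P mu lam • v with hw
  refine RapidlyDecreasing.of_exp hV (B := 16 * D * (C * ‖poissonFactor P (-lam) f‖ * ‖w‖))
    (p := 4) (K := 0) (c := decayRate P f ((1 / (D : ℝ)) • (-lam)) * ε ^ 2 / 2)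
    (fun k hk => ?_) ?_ ?_
  · refine Continuous.sub (continuous_sum_sections (Finset.range D) fun ℓ _ =>
      (continuous_fourierState ha hb hω v u hk ℓ).const_smul
        (knotGamma a b (ℓ : ZMod (2 * a * b)) k)) ?_
    exact (continuous_const.mul (continuous_finsetSum _ fun r _ =>
      continuous_const.mul (continuous_lagr P k f _))).smul continuous_const
  · have : 0 < decayRate P f ((1 / (D : ℝ)) • (-lam)) := by
      refine decayRate_pos P hf0 ?_
      rw [map_smul, smul_eq_mul]
      exact mul_ne_zero (by positivity) hfl0
    positivity
  intro k hk _ x hx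
  have hsum := sum_fourierState_eq_tsum (P := P) hk hlf (u k • w)
    (fun ℓ => knotGamma a b ℓ k) x
  have hbound := hC k hk x ε (16 * D * k ^ 3) S (fun r => knotGamma a b (r : ZMod (2 * a * b)) k)
    (by rw [hratio, abs_neg]; exact hY x hx) hε.le (fun r => norm_knotGamma_le _ hk)
    (fun r hr => by
      rw [hratio, ← abs_neg, neg_add, neg_neg, ← sub_eq_add_neg]
      exact hVε x hx r hr)
  rw [Pi.sub_apply]
  have hsum' : (∑ ℓ ∈ Finset.range D, knotGamma a b (ℓ : ZMod (2 * a * b)) k •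
      fourierState D k (adaptedBasis P mu lam a b v u k) ℓ) x =
      (ampl k * ∑' r : ℤ, knotGamma a b (r : ZMod (2 * a * b)) k *
        lagr P k f (((r : ℝ) / D) • (-lam)) x : ℂ) • (poissonFactor P (-lam) f • u k • w) := hsum
  rw [hsum', ← sub_smul, ← mul_sub, norm_smul, norm_smul, norm_smul, hu k hk, one_mul, norm_mul,
    Complex.norm_real, Real.norm_of_nonneg (ampl_nonneg k)]
  calc _ ≤ k * (16 * D * k ^ 3 * C * Real.exp (-(decayRate P f ((1 / (D : ℝ)) • (-lam)) *
          ε ^ 2 / 2 * k))) * (‖poissonFactor P (-lam) f‖ * ‖w‖) := by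
        gcongr
        exact ampl_le hk
    _ = _ := by ring

/-- The phase of the knot basis may be replaced by `1`. -/
theorem rapidlyDecreasing_phase {u : ℕ → ℂ} {C c : ℝ} (hc : 0 < c)
    (hu : ∀ k : ℕ, 0 < k → ‖u k - 1‖ ≤ C * Real.exp (-(c * k))) {V : Set E} (hV : IsCompact V)
    (S : Finset ℤ) (f : E) (v : δ) :
    RapidlyDecreasing V fun k x => (ampl k * ∑ r ∈ S, knotGamma a b (r : ZMod (2 * a * b)) k *
        lagr P k f (((r : ℝ) / (2 * a * b : ℕ)) • (-lam)) x : ℂ) • (u k - 1) • v := by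
  set D : ℕ := 2 * a * b with hD
  refine RapidlyDecreasing.of_exp hV (B := S.card * (16 * D) * (C * ‖v‖)) (p := 4) (K := 0)
    (fun k hk => ?_) hc ?_
  · exact (continuous_const.mul (continuous_finsetSum _ fun r _ =>
      continuous_const.mul (continuous_lagr P k f _))).smul continuous_const
  intro k hk _ x _
  have h1 : ∀ r ∈ S, ‖knotGamma a b (r : ZMod (2 * a * b)) k *
      lagr P k f (((r : ℝ) / D) • (-lam)) x‖ ≤ 16 * D * k ^ 3 := by
    intro r _
    have h2 : ‖lagr P k f (((r : ℝ) / D) • (-lam)) x‖ ≤ 1 := by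
      rw [norm_lagr, Real.exp_le_one_iff, neg_mul, neg_div, neg_nonpos]
      by_cases hf : f = 0
      · simp [hf, PolarizedPlane.normSq]
      · have := P.normSq_pos hf
        positivity
    rw [norm_mul]
    calc _ ≤ 16 * (D : ℝ) * k ^ 3 * 1 := by
          gcongr
          exact norm_knotGamma_le _ hk
      _ = _ := mul_one _
  have h3 := norm_sum_le_of_le _ h1
  rw [Finset.sum_const, nsmul_eq_mul] at h3
  rw [norm_smul, norm_smul, norm_mul, Complex.norm_real, Real.norm_of_nonneg (ampl_nonneg k)]
  calc _ ≤ k * (S.card * (16 * D * k ^ 3)) * (C * Real.exp (-(c * k)) * ‖v‖) := by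
        gcongr
        · exact ampl_le hk
        · exact hu k hk
    _ = _ := by ring

theorem exists_pos_forall_le_abs_sub {y : ℝ} {S : Finset ℤ} (h : ∀ r : ℤ, r ∉ S → y ≠ r) :
    ∃ ε : ℝ, 0 < ε ∧ ∀ r : ℤ, r ∉ S → ε ≤ |y - r| := by
  have hcl : IsClosed ((fun r : ℤ => (r : ℝ)) '' {r | r ∉ S}) :=
    Int.isClosedEmbedding_coe_real.isClosedMap _ (isClosed_discrete _)
  have hy : y ∈ ((fun r : ℤ => (r : ℝ)) '' {r | r ∉ S})ᶜ := by
    rintro ⟨r, hr, hry⟩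
    exact h r hr hry.symm
  obtain ⟨ε, hε, hball⟩ := Metric.isOpen_iff.1 hcl.isOpen_compl y hy
  refine ⟨ε, hε, fun r hr => ?_⟩
  by_contra hcon
  push Not at hcon
  have hr' : (r : ℝ) ∈ Metric.ball y ε := by
    rw [Metric.mem_ball, dist_comm, Real.dist_eq]
    exact hcon
  exact hball hr' ⟨r, hr, rfl⟩

/-- Near a point of the strip `A`, the knot state is the sum of the Lagrangian states
`γ_r(k) T^*_{-r lam/D} t^k_{Dμ-2lam}` over the lines through this point, up to
`O(k^{-∞})`. -/
theorem exists_rapidlyDecreasing_knotState (ha : 0 < a) (hb : 0 < b) (hab : Nat.Coprime a b)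
    (hω : P.ω mu lam = 4 * Real.pi) {ξ : ∀ k : ℕ, ZMod (2 * k) → E → δ} {v : δ} {u : ℕ → ℂ}
    {C c : ℝ} (hc : 0 < c) (hu : ∀ k, 0 < k → ‖u k‖ = 1)
    (hξ : ∀ k, 0 < k → ∀ ℓ, ξ k ℓ = u k • thetaBasis P k 2 mu lam v ℓ)
    (hu1 : ∀ k : ℕ, 0 < k → ‖u k - 1‖ ≤ C * Real.exp (-(c * k))) {s ρ : ℝ} (hs1 : -1 < s)
    (hs0 : s < 0) {S : Finset ℤ}
    (hS : ∀ r : ℤ, r ∉ S → ((2 * a * b : ℕ) : ℝ) * ρ + 2 * s ≠ r) :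
    ∃ V ∈ 𝓝 (s • mu + ρ • lam), RapidlyDecreasing V fun k => knotState a b ξ k -
      fun x => (ampl k * ∑ r ∈ S, knotGamma a b (r : ZMod (2 * a * b)) k *
        lagr P k (((2 * a * b : ℕ) : ℝ) • mu - (2 : ℝ) • lam)
          (((r : ℝ) / (2 * a * b : ℕ)) • (-lam)) x : ℂ) •
        poissonFactor P (-lam) (((2 * a * b : ℕ) : ℝ) • mu - (2 : ℝ) • lam) •
          poissonFactor P mu lam • v := by
  have := P.finiteDimensional
  have : ProperSpace E := FiniteDimensional.proper_real E
  have hpi := Real.pi_ne_zero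
  set D : ℕ := 2 * a * b with hD
  set f : E := (D : ℝ) • mu - (2 : ℝ) • lam with hf
  set x₀ : E := s • mu + ρ • lam with hx₀
  have hlm : P.ω lam mu = -(4 * Real.pi) := by rw [P.omega_swap, hω]
  have hσ₀ : P.ω (-lam) x₀ / (4 * Real.pi) = s := by
    rw [hx₀]
    simp only [map_neg, map_add, map_smul, LinearMap.neg_apply, smul_eq_mul, hlm, P.ω_self]
    field_simp
    ring
  have hτ₀ : P.ω f x₀ / (4 * Real.pi) = D * ρ + 2 * s := by
    rw [hx₀, hf]
    simp only [map_sub, map_add, map_smul, LinearMap.sub_apply, LinearMap.smul_apply, smul_eq_mul,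
      hlm, hω, P.ω_self]
    field_simp
    ring
  obtain ⟨η, hη, hηS⟩ := exists_pos_forall_le_abs_sub hS
  have hcσ : Continuous fun x => P.ω (-lam) x / (4 * Real.pi) :=
    (P.continuous_omega _).div_const _
  have hcτ : Continuous fun x => P.ω f x / (4 * Real.pi) := (P.continuous_omega _).div_const _
  set ε : ℝ := min (s + 1) (-s) / 3 with hε
  have hεpos : 0 < ε := by
    have : 0 < min (s + 1) (-s) := lt_min (by linarith) (by linarith)
    positivity
  have hε1 : 3 * ε ≤ s + 1 := by
    have := min_le_left (s + 1) (-s)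
    linarith
  have hε2 : 3 * ε ≤ -s := by
    have := min_le_right (s + 1) (-s)
    linarith
  set V : Set E := Metric.closedBall x₀ 1 ∩
    ({x | |P.ω (-lam) x / (4 * Real.pi) - s| ≤ ε} ∩
      {x | |P.ω f x / (4 * Real.pi) - (D * ρ + 2 * s)| ≤ η / 2}) with hVdef
  have hVc : IsCompact V := (isCompact_closedBall x₀ 1).inter_right
    ((isClosed_le (hcσ.sub continuous_const).abs continuous_const).inter
      (isClosed_le (hcτ.sub continuous_const).abs continuous_const))
  have hVn : V ∈ 𝓝 x₀ := by
    refine Filter.inter_mem (Metric.closedBall_mem_nhds _ one_pos) (Filter.inter_mem ?_ ?_)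
    · filter_upwards [(isOpen_lt (hcσ.sub continuous_const).abs
        (continuous_const (y := ε))).mem_nhds (show x₀ ∈ {x | |P.ω (-lam) x / (4 * Real.pi) - s| < ε}
          by rw [Set.mem_ofPred_eq, hσ₀, sub_self, abs_zero]; exact hεpos)] with x hx
      exact le_of_lt hx
    · filter_upwards [(isOpen_lt (hcτ.sub continuous_const).abs
        (continuous_const (y := η / 2))).mem_nhds
        (show x₀ ∈ {x | |P.ω f x / (4 * Real.pi) - (D * ρ + 2 * s)| < η / 2}
          by rw [Set.mem_ofPred_eq, hτ₀, sub_self, abs_zero]; exact half_pos hη)] with x hx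
      exact le_of_lt hx
  refine ⟨V, hVn, ?_⟩
  have h1 := rapidlyDecreasing_knotState_sub ha hb hab hω hu hξ hVc hεpos (fun x hx => by
    have hxs : |P.ω (-lam) x / (4 * Real.pi) - s| ≤ ε := hx.2.1
    have := abs_le.1 hxs
    constructor <;> linarith [this.1, this.2])
  have h2 := rapidlyDecreasing_sum_fourierState_sub (v := v) ha hb hω hu hVc (half_pos hη)
    (Y := |(D : ℝ) * ρ + 2 * s| + η / 2) (fun x hx => by
      have h3 := abs_add_le (P.ω f x / (4 * Real.pi) - (D * ρ + 2 * s)) (D * ρ + 2 * s)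
      rw [sub_add_cancel] at h3
      have h4 : |P.ω f x / (4 * Real.pi) - (D * ρ + 2 * s)| ≤ η / 2 := hx.2.2
      linarith) S (fun x hx r hr => by
      have h3 := abs_sub_le ((D : ℝ) * ρ + 2 * s) (P.ω f x / (4 * Real.pi)) r
      have h4 : |P.ω f x / (4 * Real.pi) - (D * ρ + 2 * s)| ≤ η / 2 := hx.2.2
      rw [abs_sub_comm] at h4
      linarith [hηS r hr])
  have h3 := rapidlyDecreasing_phase (P := P) (lam := lam) (a := a) (b := b) hc hu1 hVc S f
    (poissonFactor P (-lam) f • poissonFactor P mu lam • v)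
  convert (h1.add h2).add h3 using 1
  funext k x
  simp only [Pi.add_apply, Pi.sub_apply]
  rw [sub_add_sub_cancel, sub_smul, one_smul, smul_sub, smul_comm (u k) (poissonFactor P (-lam) f)]
  abel

end Comparison

/-- The first element of the adapted basis has the value at the origin required of it. -/
theorem isNegligible_adaptedBasis_zero {P : PolarizedPlane E} {mu lam : E} {a b : ℕ} (ha : 0 < a)
    (hb : 0 < b) (hω : P.ω mu lam = 4 * Real.pi) {v : δ} {u : ℕ → ℂ} {C c : ℝ} (hC : 0 ≤ C)
    (hc : 0 < c) (hu : ∀ k, 0 < k → ‖u k‖ = 1)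
    (hu1 : ∀ k : ℕ, 0 < k → ‖u k - 1‖ ≤ C * Real.exp (-(c * k))) :
    IsNegligible fun k : ℕ => adaptedBasis P mu lam a b v u k 0 0 -
      (ampl k : ℂ) • poissonFactor P mu lam • v := by
  have hDpos : 0 < 2 * a * b := by positivity
  have hlf := omega_adapted P (D := 2 * a * b) hω
  set f : E := ((2 * a * b : ℕ) : ℝ) • mu - (2 : ℝ) • lam with hf
  obtain ⟨hl, hlf0⟩ := ne_zero_of_omega P (by positivity : 0 < 2 * (2 * a * b)) hlf
  obtain ⟨C', hC'0, hC'⟩ := norm_theta_zero_sub_one_le P hl hlf0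
  set d : ℝ := decayRate P (-lam) f / 2 with hd
  have hdpos : 0 < d := half_pos (decayRate_pos P hl hlf0)
  set w : δ := poissonFactor P mu lam • v with hw
  refine IsNegligible.of_exp (B := (C' + C) * ‖w‖) (c := min c d) (p := 1) (K := 0)
    (lt_min hc hdpos) fun k hk _ => ?_
  have h1 : adaptedBasis P mu lam a b v u k 0 0 =
      (ampl k * theta P k (-lam) f 0 0 : ℂ) • u k • w := thetaBasis_zero P hk (by positivity) 0
  have h2 : (ampl k * theta P k (-lam) f 0 0 : ℂ) • u k • w - (ampl k : ℂ) • w =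
      (ampl k * (u k * (theta P k (-lam) f 0 0 - 1) + (u k - 1)) : ℂ) • w := by
    rw [smul_smul, ← sub_smul]
    congr 1
    ring
  have hexp : ∀ r : ℝ, min c d ≤ r → Real.exp (-(r * k)) ≤ Real.exp (-(min c d * k)) := by
    intro r hr
    refine Real.exp_le_exp.2 (neg_le_neg ?_)
    exact mul_le_mul_of_nonneg_right hr (Nat.cast_nonneg k)
  have h3 : ‖u k * (theta P k (-lam) f 0 0 - 1) + (u k - 1)‖ ≤
      C' * Real.exp (-(min c d * k)) + C * Real.exp (-(min c d * k)) := by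
    refine (norm_add_le _ _).trans (add_le_add ?_ ?_)
    · rw [norm_mul, hu k hk, one_mul]
      exact (hC' k hk).trans (mul_le_mul_of_nonneg_left (hexp d (min_le_right _ _)) hC'0)
    · exact (hu1 k hk).trans (mul_le_mul_of_nonneg_left (hexp c (min_le_left _ _)) hC)
  rw [h1, h2, norm_smul, norm_mul, Complex.norm_real, Real.norm_of_nonneg (ampl_nonneg k)]
  calc _ ≤ k * (C' * Real.exp (-(min c d * k)) + C * Real.exp (-(min c d * k))) * ‖w‖ := by
        gcongr
        exact ampl_le hk
    _ = _ := by ring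

theorem mem_intervalI {D : ℕ} (hD : 0 < D) {mu lam : E} {s ρ : ℝ} (hs1 : -1 < s) (hs0 : s < 0)
    {ℓ : ℤ} (h : (D : ℝ) * ρ + 2 * s = ℓ) : s • mu + ρ • lam ∈ intervalI D mu lam ℓ := by
  have hD' : (D : ℝ) ≠ 0 := by positivity
  refine ⟨-2 * s, by linarith, by linarith, ?_⟩
  have hρ : ρ = (ℓ : ℝ) / D + -2 * s * (1 / D) := by
    field_simp
    linarith
  rw [hρ]
  module

theorem exists_of_mem_intervalI {D : ℕ} (hD : 0 < D) {mu lam : E} {ℓ : ℤ} {x : E}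
    (hx : x ∈ intervalI D mu lam ℓ) : ∃ s ρ : ℝ, -1 < s ∧ s < 0 ∧ (D : ℝ) * ρ + 2 * s = ℓ ∧
      x = s • mu + ρ • lam := by
  have hD' : (D : ℝ) ≠ 0 := by positivity
  obtain ⟨t, ht0, ht2, rfl⟩ := hx
  refine ⟨-t / 2, (ℓ + t) / D, by linarith, by linarith, ?_, ?_⟩
  · field_simp
    ring
  · module

theorem isUnitSectionOn_lineSection (P : PolarizedPlane E) {d : E} (hd : d ≠ 0) :
    IsUnitSectionOn P d (P.lineSection d) := by
  constructor
  · have h := isHolomorphicSection_of_entire P hd 1 (differentiable_const (1 : ℂ)) (1 : ℂ)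
    simpa using h
  · intro s
    simp [PolarizedPlane.lineSection, P.ω_self]

end

end TorusKnotState

end

open TorusKnotState in
theorem theorem4p7 {E : Type*} [NormedAddCommGroup E] [NormedSpace ℝ E]
    {δ : Type*} [NormedAddCommGroup δ] [InnerProductSpace ℂ δ]
    (P : TorusKnotState.PolarizedPlane E) (H : TorusKnotState.HalfFormLine P δ)
    (mu lam : E) (hω : P.ω mu lam = 4 * Real.pi)
    (Ωμ : δ) (hΩμ : H.IsRootAt Ωμ mu)
    (a b : ℕ) (ha : 0 < a) (hb : 0 < b) (hab : Nat.Coprime a b) :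
    (∀ k : ℕ, 0 < k → ∃ ξ : ZMod (2 * k) → E → δ, TorusKnotState.IsKnotBasis P k mu lam Ωμ ξ) ∧
    ∀ ξ : ∀ k : ℕ, ZMod (2 * k) → E → δ,
      (∀ k : ℕ, 0 < k → TorusKnotState.IsKnotBasis P k mu lam Ωμ (ξ k)) →
      Disjoint (TorusKnotState.microsupport (TorusKnotState.knotState a b ξ))
        (TorusKnotState.stripA mu lam \ ⋃ ℓ : ℤ,
          TorusKnotState.intervalI (2 * a * b) mu lam ℓ) ∧
      ∃ (Ωlam Ω : δ) (t : E → ℂ)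
        (Ψ : ∀ k : ℕ, ZMod (2 * (2 * a * b) * k) → E → δ)
        (α : ℕ → ℂ) (β γ : ZMod (2 * a * b) → ℕ → ℂ),
        H.IsRootAt Ωlam lam ∧
        H.IsRootAt Ω (((2 * a * b : ℕ) : ℝ) • mu - (2 : ℝ) • lam) ∧
        TorusKnotState.IsUnitSectionOn P (((2 * a * b : ℕ) : ℝ) • mu - (2 : ℝ) • lam) t ∧
        TorusKnotState.IsAdaptedBasis P a b mu lam Ωlam Ψ ∧
        TorusKnotState.IsGammaSystem P a b mu lam ξ Ψ α β γ ∧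
        ∀ ℓ : ℤ, ∀ x₀ ∈ TorusKnotState.intervalI (2 * a * b) mu lam ℓ, ∃ V ∈ 𝓝 x₀,
          ∀ M : ℕ, ∃ C : ℝ, ∀ k : ℕ, 0 < k → ∀ x ∈ V,
            ‖TorusKnotState.knotState a b ξ k x -
              (((((k : ℝ) / (2 * Real.pi)) ^ (1 / 4 : ℝ) : ℝ) : ℂ) *
                γ (ℓ : ZMod (2 * a * b)) k *
                TorusKnotState.pullback P k (-(((ℓ : ℝ) / ((2 * a * b : ℕ) : ℝ)) • lam))
                  (fun y => t y ^ k) x) • Ω‖ ≤ C / (k : ℝ) ^ M := by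
  refine ⟨fun k hk => exists_isKnotBasis H hω hΩμ hk, fun ξ hξ => ?_⟩
  have hD : 0 < 2 * a * b := by positivity
  have : NeZero (2 * a * b) := ⟨hD.ne'⟩
  obtain ⟨hmu0, hlam0⟩ := ne_zero_of_omega_eq hω
  have hf0 := adapted_direction_ne_zero hD hω
  have hnlam0 : -lam ≠ 0 := neg_ne_zero.2 hlam0
  obtain ⟨u, C, c, hC, hc, hu⟩ := exists_phase H hω hΩμ hξ
  have hu1 : ∀ k, 0 < k → ‖u k‖ = 1 := fun k hk => (hu k hk).1
  have hu2 : ∀ k, 0 < k → ∀ ℓ, ξ k ℓ = u k • thetaBasis P k 2 mu lam Ωμ ℓ :=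
    fun k hk => (hu k hk).2.1
  have hu3 : ∀ k : ℕ, 0 < k → ‖u k - 1‖ ≤ C * Real.exp (-(c * k)) := fun k hk => (hu k hk).2.2
  set f : E := ((2 * a * b : ℕ) : ℝ) • mu - (2 : ℝ) • lam with hf
  -- `v` is a square root of the form with value `i` at `lam`
  set v : δ := poissonFactor P mu lam • Ωμ with hv
  have hvlam : (H.φ (v ⊗ₜ[ℂ] v) : E →ₗ[ℝ] ℂ) lam = Complex.I := by
    rw [hv, H.φ_poissonFactor hmu0 hlam0, hΩμ, mul_one]
  have hvneg : (H.φ (v ⊗ₜ[ℂ] v) : E →ₗ[ℝ] ℂ) (-lam) = -Complex.I := by rw [map_neg, hvlam]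
  have hbasis : ∀ k, 0 < k → IsHeisenbergBasis P k (2 * (2 * a * b)) (-lam) f
      (adaptedBasis P mu lam a b Ωμ u k) := by
    intro k hk
    refine isHeisenbergBasis_thetaBasis P hk (by positivity) ⟨2 * a * b, two_mul _⟩
      (omega_adapted P hω) H.finrank_eq_one ?_
    rw [norm_smul, hu1 k hk, one_mul]
    exact H.norm_pow_four hnlam0 (by rw [hvneg, norm_neg, Complex.norm_I])
  -- so `e^{-iπ/4} v` takes the value `1` at `lam`
  have hphase : Complex.exp (-(Complex.I * Real.pi / 4)) ^ 2 * Complex.I = 1 := by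
    rw [← Complex.exp_nat_mul]
    nth_rewrite 2 [← Complex.exp_pi_div_two_mul_I]
    rw [← Complex.exp_add, ← Complex.exp_zero]
    congr 1
    push_cast
    ring
  refine ⟨?_, Complex.exp (-(Complex.I * Real.pi / 4)) • v, poissonFactor P (-lam) f • v,
    P.lineSection f, adaptedBasis P mu lam a b Ωμ u, knotAlpha a b, knotBeta a b, knotGamma a b,
    ?_, ?_, isUnitSectionOn_lineSection P hf0, ⟨hbasis, ?_⟩, ?_, ?_⟩
  · rw [Set.disjoint_left]
    rintro x hx ⟨⟨s, ρ, hs1, hs0, rfl⟩, hxI⟩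
    obtain ⟨V, hV, hdecay⟩ := exists_rapidlyDecreasing_knotState (S := ∅) ha hb hab hω hc hu1
      hu2 hu3 hs1 hs0 (ρ := ρ) (fun r _ hr => hxI (Set.mem_iUnion.2
        ⟨r, mem_intervalI hD hs1 hs0 hr⟩))
    choose B hB using hdecay
    refine hx ⟨V, hV, fun M => max (B M) 1, fun M => lt_max_of_lt_right one_pos, ?_⟩
    intro M k hk y hy
    have h1 := hB M k hk y hy
    simp only [Pi.sub_apply, Finset.sum_empty, mul_zero, zero_smul, sub_zero] at h1
    exact h1.trans (div_le_div_of_nonneg_right (le_max_left _ _) (by positivity))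
  · rw [HalfFormLine.IsRootAt, H.φ_smul, hvlam, hphase]
  · rw [HalfFormLine.IsRootAt, H.φ_poissonFactor hnlam0 hf0, hvneg, mul_neg, Complex.I_mul_I,
      neg_neg]
  · have h1 := isNegligible_adaptedBasis_zero (v := Ωμ) ha hb hω hC hc hu1 hu3
    have h2 : ∀ k : ℕ, (Complex.exp (Complex.I * Real.pi / 4) *
        ((((k : ℝ) / (2 * Real.pi)) ^ (1 / 4 : ℝ) : ℝ) : ℂ)) •
        Complex.exp (-(Complex.I * Real.pi / 4)) • v = (ampl k : ℂ) • v := by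
      intro k
      rw [smul_smul, mul_right_comm, ← Complex.exp_add, add_neg_cancel, Complex.exp_zero, one_mul]
      rfl
    simp only [h2]
    exact h1
  · refine ⟨fun k hk n hn1 hn2 => ?_, fun k _ => knotGamma_neg_one ha hb hab k,
      fun k _ => knotGamma_zero ha hb hab k, fun k _ ℓ => knotGamma_rec k ℓ, fun ℓ => ?_, ?_⟩
    · exact sectionInner_knotState_sub ha hb hab (by omega) hω (hu2 k hk)
        (hbasis k hk).orthonormal hn1 hn2
    · refine IsNegligible.of_exp (B := 0) (p := 0) (K := a + b + 1) one_pos fun k _ hkK => ?_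
      rw [knotBeta_eq ha hb hab hkK, sub_self, norm_zero, zero_mul, zero_mul]
    · refine IsNegligible.of_exp (B := 0) (p := 0) (K := 0) one_pos fun k _ _ => ?_
      rw [knotAlpha, sub_self, norm_zero, zero_mul, zero_mul]
  · intro ℓ x₀ hx₀
    obtain ⟨s, ρ, hs1, hs0, hρ, rfl⟩ := exists_of_mem_intervalI hD hx₀
    obtain ⟨V, hV, hdecay⟩ := exists_rapidlyDecreasing_knotState (S := {ℓ}) ha hb hab hω hc hu1
      hu2 hu3 hs1 hs0 (ρ := ρ) (fun r hr hr' => hr (by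
        rw [hρ] at hr'
        rw [Finset.mem_singleton]
        exact_mod_cast hr'.symm))
    refine ⟨V, hV, fun M => ?_⟩
    obtain ⟨B, hB⟩ := hdecay M
    refine ⟨B, fun k hk x hx => ?_⟩
    have h1 := hB k hk x hx
    simp only [Pi.sub_apply, Finset.sum_singleton] at h1
    rw [smul_neg, ← mul_assoc] at h1
    exact h1
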